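/- Let $\mathbb K$ be a field of characteristic zero, $\mathfrak g$ a finite-dimensional Lie algebra over $\mathbb K$, and $\Omega_{\mathfrak g}=\wedge^\bullet\mathfrak g^\vee$ with its Chevalley–Eilenberg differential. A dg $\mathfrak g$-module is a bounded cochain complex $V=(V^\bullet,d^V)$ of $\mathfrak g$-modules; put $\Omega_{\mathfrak g}(V)=\wedge^\bullet\mathfrak g^\vee\otimes V$, graded by total degree, with differential $d^V_{\mathrm{tot}}=d_{CE}+d^V$, $d^V(\omega\otimes v)=(-1)^{|\omega|}\omega\otimes d^Vv$. The shift $V[1]$ has $V[1]^i=V^{i+1}$ and $d(v[1])=(dv)[1]$. $V$ is a resolution of a $\mathfrak g$-module $G$ if $V^i=0$ for $i<0$, $G\cong \ker(d^V\colon V^0\to V^1)$ as $\mathfrak g$-modules, and $H^i(V)=0$ for $i\ge 1$. A Loday–Pirashvili module $(G,X)$ is a $\mathfrak g$-module $G$ with a $\mathfrak g$-equivariant linear map $X\colon G\to\mathfrak g$ (adjoint action on $\mathfrak g$). A Leibniz$_\infty[1]$-algebra is a graded vector space $N$ with multilinear maps $\lambda_k\colon N^{\otimes k}\to N$ ($k\ge1$)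 of degree $+1$ such that for all $n\ge 1$ and homogeneous $v_1,\dots,v_n$ $$\sum_{i+j=n+1}\sum_{k=j}^{n}\sum_{\sigma\in\mathrm{sh}(k-j,j-1)}\epsilon(\sigma)(-1)^{|v_{\sigma(1)}|+\cdots+|v_{\sigma(k-j)}|}\lambda_i\big(v_{\sigma(1)},\dots,v_{\sigma(k-j)},\lambda_j(v_{\sigma(k-j+1)},\dots,v_{\sigma(k-1)},v_k),v_{k+1},\dots,v_n\big)=0;$$ it is a Leibniz$_\infty[1]$ $\Omega_{\mathfrak g}$-algebra if $(N,\lambda_1)$ is a dg $\Omega_{\mathfrak g}$-module and the $\lambda_k$, $k\ge2$, are $\Omega_{\mathfrak g}$-multilinear (in the graded sense), and a dg Leibniz$[1]$ algebra if moreover $\lambda_k=0$ for $k\ge3$. **Proposition.** Let $V$ be a resolution of $G$, with $G$ identified with $\ker(V^0\to V^1)$, and let $(G,X)$ be a Loday–Pirashvili module over $\mathfrak g$. 1. $\Omega_{\mathfrak g}(G[1])$, with the differential $d_{CE}$ and the $\Omega_{\mathfrak g}$-bilinear bracket of degree $+1$ extending $(x[1],y[1])\mapsto-(X(x)\triangleright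 y)[1]$, is a dg Leibniz$[1]$ algebra over $\Omega_{\mathfrak g}$. 2. There is a degree $0$, $\Omega_{\mathfrak g}$-linear map $\alpha\colon\Omega_{\mathfrak g}(V)\to\Omega_{\mathfrak g}(\mathfrak g)$ with $\alpha\circ d^V_{\mathrm{tot}}=d_{CE}\circ\alpha$ and $\alpha|_G=X$ (a dg Loday–Pirashvili module lifting $(G,X)$) such that the Kapranov brackets $\{\mathcal R^\nabla_k\}_{k\ge1}$ on $\Omega_{\mathfrak g}(V[1])$ of the connection $\nabla_b(\omega\otimes v'[1])=(\iota_{\alpha(b)}\omega)\otimes v'[1]$ exist, form a Leibniz$_\infty[1]$ $\Omega_{\mathfrak g}$-algebra, and extend the dg Leibniz$[1]$ algebra $\Omega_{\mathfrak g}(G[1])$: the injection $\Omega_{\mathfrak g}(G[1])\hookrightarrow\Omega_{\mathfrak g}(V[1])$ preserves degrees and intertwines all brackets. Here $\iota_{\eta\otimes x}=\eta\wedge\iota_x$, and with $\partial=d^{V[1]}_{\mathrm{tot}}$ the $\mathcal R^\nabla_k$ are defined on homogeneous elements by $\mathcal R^\nabla_1=\partial$, $\mathcal R^\nabla_2(b,e)=-\partial\nabla_be+\nabla_{\partial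 b}e+(-1)^{|b|}\nabla_b\partial e$, and for $k\ge2$ $$\mathcal R^\nabla_{k+1}(b_0,\dots,b_k)=(-1)^{|b_0|}\nabla_{b_0}\mathcal R^\nabla_k(b_1,\dots,b_k)-\sum_{i=1}^k(-1)^{|b_0|(|b_1|+\cdots+|b_{i-1}|)}\mathcal R^\nabla_k(b_1,\dots,\nabla_{b_0}b_i,\dots,b_k).$$ -/

import Mathlib

open scoped TensorProduct

noncomputable section

namespace DGLP

/-! ### The Chevalley–Eilenberg algebra -/

section CE

variable (K g : Type*) [Field K] [LieRing g] [LieAlgebra K g]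

/-- The exterior algebra on the dual of `g`. -/
abbrev CE : Type _ := ExteriorAlgebra K (Module.Dual K g)

variable {g}

/-- Contraction of forms by a vector `x`: the odd derivation with `ι_x ξ = ξ x`. -/
def interior (x : g) : CE K g →ₗ[K] CE K g :=
  CliffordAlgebra.contractLeft (Module.Dual.eval K g x)

variable (g)

/-- The operator `ι_{η ⊗ x} = η ∧ ι_x` attached to an element of `∧ g^∨ ⊗ g`. -/
def interiorVec : CE K g ⊗[K] g →ₗ[K] (CE K g →ₗ[K] CE K g) :=
  TensorProduct.lift
    (LinearMap.mk₂ K (fun (η : CE K g) (x : g) => (LinearMap.mulLeft K η).comp (interior K x))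
      (fun η η' x => LinearMap.ext fun ω => by simp [add_mul])
      (fun c η x => LinearMap.ext fun ω => by simp)
      (fun η x x' => LinearMap.ext fun ω => by simp [interior, mul_add])
      (fun c η x => LinearMap.ext fun ω => by simp [interior]))

/-- The grading involution `ω ↦ (-1)^p ω` for `ω ∈ ∧^p g^∨`. -/
def parity : CE K g →ₗ[K] CE K g :=
  (CliffordAlgebra.involute (Q := (0 : QuadraticForm K (Module.Dual K g)))).toLinearMap

/-- The degree `n` part of `∧ g^∨`. -/
def ceGr (n : ℤ) : Submodule K (CE K g) :=
  if 0 ≤ n then ⋀[K]^n.toNat (Module.Dual K g) else ⊥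

variable {K g}

theorem interior_ι (x : g) (ξ : Module.Dual K g) :
    interior K x (ExteriorAlgebra.ι K ξ) = algebraMap K (CE K g) (ξ x) :=
  CliffordAlgebra.contractLeft_ι (Q := (0 : QuadraticForm K (Module.Dual K g))) _ _

theorem interior_one (x : g) : interior K x (1 : CE K g) = 0 :=
  CliffordAlgebra.contractLeft_one (Q := (0 : QuadraticForm K (Module.Dual K g))) _

theorem interior_ι_mul (x : g) (ξ : Module.Dual K g) (ω : CE K g) :
    interior K x (ExteriorAlgebra.ι K ξ * ω) =
      ξ x • ω - ExteriorAlgebra.ι K ξ * interior K x ω :=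
  CliffordAlgebra.contractLeft_ι_mul _ _ _

variable (K g)

variable [FiniteDimensional K g]

/-- The element `e^i` of the basis of `g^∨` dual to the chosen basis `e_i` of `g`,
as an element of the exterior algebra. -/
def dualVec (i : Fin (Module.finrank K g)) : CE K g :=
  ExteriorAlgebra.ι K ((Module.finBasis K g).coord i)

/-- The Chevalley–Eilenberg differential of `∧ g^∨`, in a basis:
`d = - 1/2 ∑ e^i ∧ e^j ∧ ι_{[e_i, e_j]}`.  By `ceDiff_one`, `ceDiff_ι` and `ceDiff_ι_mul` it is the
odd derivation with `(d ξ)(x, y) = - ξ [x, y]`. -/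
def ceDiff : CE K g →ₗ[K] CE K g :=
  -((2 : K)⁻¹ • ∑ i, ∑ j, (LinearMap.mulLeft K (dualVec K g i * dualVec K g j)).comp
      (interior K ⁅Module.finBasis K g i, Module.finBasis K g j⁆))

/-- The Chevalley–Eilenberg differential of `∧ g^∨ ⊗ E`:
`d (ω ⊗ e) = d ω ⊗ e + ∑ (e^i ∧ ω) ⊗ (e_i ▷ e)`. -/
def ceDiffMod (E : Type*) [AddCommGroup E] [Module K E] [LieRingModule g E] [LieModule K g E] :
    CE K g ⊗[K] E →ₗ[K] CE K g ⊗[K] E :=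
  (ceDiff K g).rTensor E +
    ∑ i, TensorProduct.map (LinearMap.mulLeft K (dualVec K g i))
      (LieModule.toEnd K g E (Module.finBasis K g i))

variable {K g}

theorem ceDiff_apply (ω : CE K g) :
    ceDiff K g ω = -((2 : K)⁻¹ • ∑ i, ∑ j, dualVec K g i * dualVec K g j *
      interior K ⁅Module.finBasis K g i, Module.finBasis K g j⁆ ω) := by
  simp [ceDiff, LinearMap.sum_apply, mul_assoc]

theorem ceDiff_one : ceDiff K g 1 = 0 := by
  simp [ceDiff_apply, interior_one]

theorem ceDiff_ι [CharZero K] (ξ : Module.Dual K g) (x y : g) :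
    interior K y (interior K x (ceDiff K g (ExteriorAlgebra.ι K ξ))) =
      algebraMap K (CE K g) (-ξ ⁅x, y⁆) := by
  have key : ∀ i j, interior K y (interior K x (dualVec K g i * dualVec K g j)) =
      algebraMap K (CE K g) ((Module.finBasis K g).repr x i * (Module.finBasis K g).repr y j -
        (Module.finBasis K g).repr x j * (Module.finBasis K g).repr y i) := by
    intro i j
    simp only [dualVec, interior_ι_mul, interior_ι, map_sub, map_smul, Algebra.algebraMap_eq_smul_one,
      mul_smul_comm, mul_one, Module.Basis.coord_apply, smul_smul]
  have hxy : ∀ x y : g, ξ ⁅x, y⁆ = ∑ i, ∑ j, ξ ⁅Module.finBasis K g i, Module.finBasis K g j⁆ *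
      ((Module.finBasis K g).repr x i * (Module.finBasis K g).repr y j) := by
    intro x y
    conv_lhs => rw [← (Module.finBasis K g).sum_repr x, ← (Module.finBasis K g).sum_repr y]
    simp only [sum_lie, lie_sum, lie_smul, smul_lie, map_sum, map_smul,
      smul_eq_mul, Finset.mul_sum]
    rw [Finset.sum_comm]
    refine Finset.sum_congr rfl fun i _ => Finset.sum_congr rfl fun j _ => by ring
  have h2 : ∑ i, ∑ j, ξ ⁅Module.finBasis K g i, Module.finBasis K g j⁆ *
      ((Module.finBasis K g).repr x i * (Module.finBasis K g).repr y j -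
        (Module.finBasis K g).repr x j * (Module.finBasis K g).repr y i) = 2 * ξ ⁅x, y⁆ := by
    have hs : ξ ⁅y, x⁆ = -ξ ⁅x, y⁆ := by rw [← lie_skew, map_neg]
    calc _ = ξ ⁅x, y⁆ - ξ ⁅y, x⁆ := by
          rw [hxy x y, hxy y x]
          simp only [mul_sub, Finset.sum_sub_distrib]
          congr 1
          refine Finset.sum_congr rfl fun i _ => Finset.sum_congr rfl fun j _ => by ring
      _ = _ := by rw [hs]; ring
  rw [ceDiff_apply]
  simp only [interior_ι, ← Algebra.commutes, ← Algebra.smul_def, map_neg, map_smul, map_sum, key]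
  simp only [Algebra.smul_def, ← map_mul, ← map_sum, h2]
  rw [inv_mul_cancel_left₀ two_ne_zero]

theorem ceDiff_ι_mul (ξ : Module.Dual K g) (ω : CE K g) :
    ceDiff K g (ExteriorAlgebra.ι K ξ * ω) =
      ceDiff K g (ExteriorAlgebra.ι K ξ) * ω - ExteriorAlgebra.ι K ξ * ceDiff K g ω := by
  have anti : ∀ a b : Module.Dual K g, ExteriorAlgebra.ι K a * ExteriorAlgebra.ι K b =
      -(ExteriorAlgebra.ι K b * ExteriorAlgebra.ι K a) := fun a b =>
    eq_neg_of_add_eq_zero_left (ExteriorAlgebra.ι_add_mul_swap a b)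
  have comm : ∀ i j, dualVec K g i * dualVec K g j * ExteriorAlgebra.ι K ξ =
      ExteriorAlgebra.ι K ξ * (dualVec K g i * dualVec K g j) := by
    intro i j
    simp only [dualVec]
    rw [mul_assoc, anti _ ξ, mul_neg, ← mul_assoc, anti _ ξ, neg_mul, neg_neg, mul_assoc]
  simp only [ceDiff_apply, interior_ι, interior_ι_mul, mul_sub, ← mul_assoc, comm,
    Finset.sum_sub_distrib, smul_sub, neg_mul, mul_neg, smul_mul_assoc, mul_smul_comm,
    Finset.sum_mul, Finset.mul_sum, Algebra.algebraMap_eq_smul_one, mul_one]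
  abel

theorem ceDiffMod_one (E : Type*) [AddCommGroup E] [Module K E] [LieRingModule g E]
    [LieModule K g E] (e : E) (x : g) :
    (interior K x).rTensor E (ceDiffMod K g E (1 ⊗ₜ e)) = 1 ⊗ₜ ⁅x, e⁆ := by
  conv_rhs => rw [← (Module.finBasis K g).sum_repr x, sum_lie, TensorProduct.tmul_sum]
  simp [ceDiffMod, ceDiff_one, LinearMap.sum_apply, dualVec, interior_ι,
    Algebra.algebraMap_eq_smul_one, TensorProduct.smul_tmul]

end CE

/-! ### Differential graded modules over a Lie algebra -/

section DG

/-- A dg `g`-module structure on the `g`-module `M = ⊕ M^i`: a bounded cochain complex of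
`g`-modules. -/
structure DGLieModule (K g M : Type*) [Field K] [LieRing g] [LieAlgebra K g]
    [AddCommGroup M] [Module K M] [LieRingModule g M] [LieModule K g M] where
  gr : ℤ → LieSubmodule K g M
  internal : DirectSum.IsInternal (fun i => (gr i).toSubmodule)
  d : M →ₗ⁅K,g⁆ M
  d_mem : ∀ i, ∀ v ∈ gr i, d v ∈ gr (i + 1)
  d_d : ∀ v, d (d v) = 0
  bounded : ∃ a b : ℤ, ∀ i, i < a ∨ b < i → gr i = ⊥

variable {K g M M' : Type*} [Field K] [LieRing g] [LieAlgebra K g]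
  [AddCommGroup M] [Module K M] [LieRingModule g M] [LieModule K g M]
  [AddCommGroup M'] [Module K M'] [LieRingModule g M'] [LieModule K g M']

namespace DGLieModule

/-- The degree shift `V[1]`, `V[1]^i = V^{i+1}`.  It only regrades: `d (v[1]) = (d v)[1]`. -/
def shift (V : DGLieModule K g M) : DGLieModule K g M where
  gr i := V.gr (i + 1)
  internal := by
    have h := (DirectSum.isInternal_submodule_iff_iSupIndep_and_iSup_eq_top _).1 V.internal
    refine (DirectSum.isInternal_submodule_iff_iSupIndep_and_iSup_eq_top _).2 ⟨?_, ?_⟩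
    · exact h.1.comp (add_left_injective (1 : ℤ))
    · rw [← h.2]
      exact (Equiv.addRight (1 : ℤ)).iSup_comp (g := fun i => (V.gr i).toSubmodule)
  d := V.d
  d_mem i v hv := V.d_mem (i + 1) v hv
  d_d := V.d_d
  bounded := by
    obtain ⟨a, b, h⟩ := V.bounded
    exact ⟨a - 1, b - 1, fun i hi => h (i + 1) (by omega)⟩

variable (K g M) in
/-- A `g`-module, as a dg `g`-module concentrated in degree `0`. -/
def ofModule : DGLieModule K g M where
  gr i := if i = 0 then ⊤ else ⊥
  internal := by
    refine (DirectSum.isInternal_submodule_iff_iSupIndep_and_iSup_eq_top _).2 ⟨?_, ?_⟩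
    · intro i
      by_cases hi : i = 0
      · subst hi
        have : (⨆ j, ⨆ _ : j ≠ (0 : ℤ),
            ((if j = 0 then (⊤ : LieSubmodule K g M) else ⊥).toSubmodule)) = ⊥ := by
          simp only [iSup_eq_bot]
          intro j hj
          simp [hj]
        rw [this]
        exact disjoint_bot_right
      · simp [hi]
    · refine top_le_iff.1 (le_trans ?_ (le_iSup _ (0 : ℤ)))
      simp
  d := 0
  d_mem i v _ := by simp
  d_d := by simp
  bounded := ⟨0, 0, fun i hi => if_neg (by omega)⟩

/-- The degree `n` part of `Ω_g(V) = ∧ g^∨ ⊗ V`, the sum of the `∧^p g^∨ ⊗ V^{n-p}`. -/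
def omegaGr (V : DGLieModule K g M) (n : ℤ) : Submodule K (CE K g ⊗[K] M) :=
  ⨆ p : ℕ, Submodule.map₂ (TensorProduct.mk K (CE K g) M)
    (⋀[K]^p (Module.Dual K g)) (V.gr (n - p)).toSubmodule

/-- The total differential `d_CE + d^V` of `Ω_g(V)`, where
`d^V (ω ⊗ v) = (-1)^p ω ⊗ d v` for `ω ∈ ∧^p g^∨`. -/
def dtot [FiniteDimensional K g] (V : DGLieModule K g M) :
    CE K g ⊗[K] M →ₗ[K] CE K g ⊗[K] M :=
  ceDiffMod K g M +
    TensorProduct.map (parity K g) V.d.toLinearMap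

/-- The kernel of `d : V^0 → V^1`, which is `H^0(V)` when `V` is non-negative. -/
def H0 (V : DGLieModule K g M) : LieSubmodule K g M := V.gr 0 ⊓ V.d.ker

end DGLieModule

/-- A weak morphism `V ⇝ W`. -/
structure WeakMorphism [FiniteDimensional K g]
    (V : DGLieModule K g M) (W : DGLieModule K g M') where
  map : CE K g ⊗[K] M →ₗ[CE K g] CE K g ⊗[K] M'
  map_mem : ∀ n, ∀ x ∈ V.omegaGr n, map x ∈ W.omegaGr n
  map_dtot : ∀ x, map (V.dtot x) = W.dtot (map x)

/-- `V` is a resolution of the `g`-module `G`, with the identification of `G` with `H^0(V)`. -/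
structure Resolution (V : DGLieModule K g M) (G : Type*) [AddCommGroup G] [Module K G]
    [LieRingModule g G] [LieModule K g G] where
  nonneg : ∀ i < 0, V.gr i = ⊥
  iso : G ≃ₗ⁅K,g⁆ V.H0
  acyclic : ∀ i ≥ 1, ∀ v ∈ V.gr i, V.d v = 0 → ∃ w ∈ V.gr (i - 1), V.d w = v

variable {G : Type*} [AddCommGroup G] [Module K G] [LieRingModule g G] [LieModule K g G]

/-- The inclusion `G ≅ ker (V^0 → V^1) ⊆ V`. -/
def Resolution.incl {V : DGLieModule K g M} (r : Resolution V G) : G →ₗ[K] M :=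
  V.H0.toSubmodule.subtype ∘ₗ (r.iso : G →ₗ[K] V.H0)

/-- A weak morphism `α : V ⇝ g` makes `V` a dg Loday–Pirashvili module; here it is a dg lift of
`(G, X)`: on `G ≅ H^0(V)` its component `α_0` is `X`. -/
def IsDGLift [FiniteDimensional K g] {V : DGLieModule K g M} (r : Resolution V G)
    (X : G →ₗ⁅K,g⁆ g) (α : WeakMorphism V (DGLieModule.ofModule K g g)) : Prop :=
  ∀ x : G, α.map (1 ⊗ₜ r.incl x) = 1 ⊗ₜ X x

/-- The connection on `Ω_g(V[1])` given by an anchor `α`: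
`∇_b (ω ⊗ v') = ι_{α(b)} ω ⊗ v'`; it is `Ω_g`-linear in `b`, with `∇_{v[1]} = ι_{α(v)}`. -/
def nabla (α : CE K g ⊗[K] M →ₗ[CE K g] CE K g ⊗[K] g) :
    CE K g ⊗[K] M →ₗ[K] CE K g ⊗[K] M →ₗ[K] CE K g ⊗[K] M :=
  LinearMap.rTensorHom M ∘ₗ interiorVec K g ∘ₗ α.restrictScalars K

end DG

/-! ### Leibniz infinity algebras -/

section Leibniz

variable {K A N N' : Type*} [Field K] [Ring A] [Algebra K A]
  [AddCommGroup N] [Module K N] [Module A N] [IsScalarTower K A N]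
  [AddCommGroup N'] [Module K N'] [Module A N'] [IsScalarTower K A N']

/-- `(A, d)` with the grading `𝒜` is a (graded commutative) dg algebra. -/
structure IsDGAlgebra (𝒜 : ℤ → Submodule K A) (d : A →ₗ[K] A) : Prop where
  internal : DirectSum.IsInternal 𝒜
  one_mem : (1 : A) ∈ 𝒜 0
  mul_mem : ∀ m n, ∀ a ∈ 𝒜 m, ∀ b ∈ 𝒜 n, a * b ∈ 𝒜 (m + n)
  mul_comm : ∀ m n, ∀ a ∈ 𝒜 m, ∀ b ∈ 𝒜 n, a * b = Int.negOnePow (m * n) • (b * a)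
  d_mem : ∀ n, ∀ a ∈ 𝒜 n, d a ∈ 𝒜 (n + 1)
  d_mul : ∀ m, ∀ a ∈ 𝒜 m, ∀ b, d (a * b) = d a * b + Int.negOnePow m • (a * d b)
  d_d : ∀ a, d (d a) = 0

/-- `(N, ∂)` with the grading `𝒩` is a dg module over the dg algebra `(A, d)`. -/
structure IsDGModule (𝒜 : ℤ → Submodule K A) (d : A →ₗ[K] A)
    (𝒩 : ℤ → Submodule K N) (del : N →ₗ[K] N) : Prop where
  internal : DirectSum.IsInternal 𝒩
  smul_mem : ∀ m n, ∀ a ∈ 𝒜 m, ∀ x ∈ 𝒩 n, a • x ∈ 𝒩 (m + n)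
  del_mem : ∀ n, ∀ x ∈ 𝒩 n, del x ∈ 𝒩 (n + 1)
  del_smul : ∀ m, ∀ a ∈ 𝒜 m, ∀ x, del (a • x) = d a • x + Int.negOnePow m • (a • del x)
  del_del : ∀ x, del (del x) = 0

/-- A sequence of multilinear brackets; the entry at `0` plays no role. -/
abbrev Brackets (K N : Type*) [Field K] [AddCommGroup N] [Module K N] : Type _ :=
  ∀ k : ℕ, MultilinearMap K (fun _ : Fin k => N) N

namespace Brackets

/-- The bracket of the entries of a list. -/
def ev (lam : Brackets K N) (l : List N) : N := lam l.length l.get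

/-- The unary bracket, as a linear map. -/
def unary (lam : Brackets K N) : N →ₗ[K] N :=
  (MultilinearMap.ofSubsingleton K N N (0 : Fin 1)).symm (lam 1)

end Brackets

/-- The Koszul sign of the shuffle of `{t | t < k}` that puts the entries with index in `S` first,
followed by those with index outside `S`, where `deg` are the degrees of the entries. -/
def shuffleSign {n : ℕ} (deg : Fin n → ℤ) (k : Fin n) (S : Finset (Fin n)) : ℤˣ :=
  ∏ s ∈ S, ∏ t ∈ (Finset.Iio k \ S).filter (· < s), Int.negOnePow (deg s * deg t)

/-- The graded vector space `(N, 𝒩)` with the brackets `lam` is a Leibniz infinity `[1]` algebra.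
In the identity, shuffles of the entries before the `k`-th one are given by the set
`S` of indices that they put first. -/
structure IsLeibnizInfinity (𝒩 : ℤ → Submodule K N) (lam : Brackets K N) : Prop where
  internal : DirectSum.IsInternal 𝒩
  degree : ∀ k ≥ 1, ∀ (deg : Fin k → ℤ) (v : Fin k → N), (∀ i, v i ∈ 𝒩 (deg i)) →
    lam k v ∈ 𝒩 ((∑ i, deg i) + 1)
  identity : ∀ n ≥ 1, ∀ (deg : Fin n → ℤ) (v : Fin n → N), (∀ i, v i ∈ 𝒩 (deg i)) →
    ∑ k : Fin n, ∑ S ∈ (Finset.Iio k).powerset,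
      (shuffleSign deg k S * Int.negOnePow (∑ s ∈ S, deg s)) •
        lam.ev (((List.finRange n).filter (· ∈ S)).map v ++
          lam.ev (((List.finRange n).filter (fun t => t < k ∧ t ∉ S)).map v ++ [v k]) ::
          ((List.finRange n).filter (k < ·)).map v) = 0

/-- `(N, 𝒩)` with the brackets `lam` is a Leibniz infinity `[1]` algebra over the
dg algebra `(A, 𝒜, d)`. -/
structure IsLeibnizInfinityOver (𝒜 : ℤ → Submodule K A) (d : A →ₗ[K] A)
    (𝒩 : ℤ → Submodule K N) (lam : Brackets K N) : Prop where
  base : IsDGAlgebra 𝒜 d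
  leibniz : IsLeibnizInfinity 𝒩 lam
  dgModule : IsDGModule 𝒜 d 𝒩 lam.unary
  multilinear : ∀ k ≥ 2, ∀ (deg : Fin k → ℤ) (v : Fin k → N), (∀ i, v i ∈ 𝒩 (deg i)) →
    ∀ (i : Fin k) (m : ℤ), ∀ a ∈ 𝒜 m,
      lam k (Function.update v i (a • v i)) =
        Int.negOnePow (m * (1 + ∑ j ∈ Finset.Iio i, deg j)) • (a • lam k v)

/-- A dg Leibniz `[1]` algebra over `(A, 𝒜, d)`: all brackets of three or more entries vanish. -/
structure IsDGLeibnizOver (𝒜 : ℤ → Submodule K A) (d : A →ₗ[K] A)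
    (𝒩 : ℤ → Submodule K N) (lam : Brackets K N) : Prop where
  leibniz : IsLeibnizInfinityOver 𝒜 d 𝒩 lam
  higher : ∀ k ≥ 3, lam k = 0

/-- The brackets `lam` on `(N, 𝒩)` extend the brackets `lam'` on `(N', 𝒩')` along `j`: the map
`j` embeds `N'` as a graded submodule which is closed under all brackets `lam`, and these restrict
to `lam'`. -/
structure Extends (𝒩' : ℤ → Submodule K N') (lam' : Brackets K N')
    (𝒩 : ℤ → Submodule K N) (lam : Brackets K N) (j : N' →ₗ[A] N) : Prop where
  injective : Function.Injective j
  degree : ∀ n, ∀ x ∈ 𝒩' n, j x ∈ 𝒩 n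
  brackets : ∀ k ≥ 1, ∀ v : Fin k → N', lam k (fun i => j (v i)) = j (lam' k v)

/-- The Kapranov brackets of a connection `nab` on the dg module `(N, 𝒩, del)`: the unary bracket
is `del`, the binary one is the Atiyah cocycle of `nab`, and the bracket of `k + 1` entries is the
covariant derivative of that of `k` entries. -/
structure IsKapranov (𝒩 : ℤ → Submodule K N) (del : N →ₗ[K] N)
    (nab : N →ₗ[K] N →ₗ[K] N) (R : Brackets K N) : Prop where
  unary : R.unary = del
  binary : ∀ n, ∀ b ∈ 𝒩 n, ∀ e, R 2 ![b, e] =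
    -del (nab b e) + nab (del b) e + Int.negOnePow n • nab b (del e)
  higher : ∀ k ≥ 2, ∀ (n : ℤ) (deg : Fin k → ℤ), ∀ b₀ ∈ 𝒩 n, ∀ b : Fin k → N,
    (∀ i, b i ∈ 𝒩 (deg i)) →
    R (k + 1) (Fin.cons b₀ b) = Int.negOnePow n • nab b₀ (R k b) -
      ∑ i, Int.negOnePow (n * ∑ j ∈ Finset.Iio i, deg j) •
        R k (Function.update b i (nab b₀ (b i)))

end Leibniz

/-! ### The dg Leibniz algebra of a Loday–Pirashvili module -/

section LP

variable {K g G : Type*} [Field K] [LieRing g] [LieAlgebra K g]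
  [AddCommGroup G] [Module K G] [LieRingModule g G] [LieModule K g G]

/-- The `Ω_g`-bilinear extension, of degree `1`, of `(x[1], y[1]) ↦ - (X x ▷ y)[1]`:
for `ω ∈ ∧^p g^∨` it sends `(ω ⊗ x, η ⊗ y)` to `- (-1)^p (ω ∧ η) ⊗ (X x ▷ y)`. -/
def lpBracket (X : G →ₗ⁅K,g⁆ g) :
    CE K g ⊗[K] G →ₗ[K] CE K g ⊗[K] G →ₗ[K] CE K g ⊗[K] G :=
  TensorProduct.map₂ (LinearMap.mul K (CE K g) ∘ₗ (-parity K g))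
    ((LieModule.toEnd K g G : g →ₗ[K] Module.End K G) ∘ₗ (X : G →ₗ[K] g))

/-- The brackets of the dg Leibniz `[1]` algebra `Ω_g(G[1])` of the Loday–Pirashvili module
`(G, X)`. -/
def lpBrackets [FiniteDimensional K g] (X : G →ₗ⁅K,g⁆ g) : Brackets K (CE K g ⊗[K] G)
  | 1 => MultilinearMap.ofSubsingleton K _ _ 0 (ceDiffMod K g G)
  | 2 => LinearMap.uncurryLeft
      ((MultilinearMap.ofSubsingletonₗ K K _ _ (0 : Fin 1)).toLinearMap ∘ₗ lpBracket X)
  | _ => 0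

theorem lpBrackets_two [FiniteDimensional K g] (X : G →ₗ⁅K,g⁆ g) (b e : CE K g ⊗[K] G) :
    lpBrackets X 2 ![b, e] = lpBracket X b e := by
  rfl

end LP

end DGLP

end

open DGLP

set_option linter.unusedSectionVars false

open scoped TensorProduct

noncomputable section

namespace DGLP

/-! ### Signs and homogeneous lists -/

section Lists

/-! Both halves of the proposition come from one general fact about Kapranov brackets of a
connection `∇` on a dg module, and one homological construction.

General fact. Let `J_n` be the left side of the Leibniz identity in `n` entries. Since `R_{k+1}` is
the covariant derivative of `R_k`, inserting a new first entry `x` in all shuffles gives `J_{n+1}(x,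
L) = ∇_x J_n(L) - J_n(∇_x L)`, where the last term is the signed sum over the entries of `L`. Two
things have to be checked. When `x` is put first in the outer and in the inner bracket, the terms
with `∇_x` of the inner bracket cancel (`IsKapranov.evl_nested`, `IsKapranov.shuf_insert`). And
`R_2` is not quite the covariant derivative of `R_1 = ∂`: the extra term `∇_{∂b} e` produces
corrections, which add up to `-R(∂x, L)` and cancel the summand whose inner bracket is `R_1(x)`
(`IsKapranov.shuf_nil_nil_cons`). As `J_1 = ∂² = 0`, all `J_n` vanish. Multilinearity over `Ω_g`
holds for `R_2` because the anchor is a chain map, and passes to the higher brackets by the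
recursion (`IsKapranov.evl_smul`). For `∇_b = ι_{α(b)}` the chain map property is Cartan calculus
(`interiorVec_ceDiffMod`).

Part 1 is a special case: for `G` in degree `0` and the anchor `X`, the Atiyah cocycle is the given
bracket, and this bracket is parallel, so that the higher Kapranov brackets are zero
(`isKapranov_lpBrackets`).

For the lift, a linear homotopy `h` contracts `V` onto `G`. It need not be equivariant, so it does
not contract `Ω_g(V)` at once, but `1 - (DH + HD)` is an `Ω_g`-linear chain map, fixes `Ω_g(G)`, and
lowers a finite filtration by degree in `V`. A power of it therefore has image in `Ω_g(G)`
(`Resolution.exists_projection`), and following it by `X` gives `α`. For any lift the inclusion of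
`Ω_g(G[1])` intertwines differentials and connections, hence all brackets built from them
(`IsDGLift.extends`). -/

theorem negOnePow_congr {a b : ℤ} (h : (a : ZMod 2) = b) : a.negOnePow = b.negOnePow := by
  rw [Int.negOnePow_eq_iff]
  have : ((a - b : ℤ) : ZMod 2) = 0 := by push_cast; rw [h, sub_self]
  exact even_iff_two_dvd.2 ((ZMod.intCast_zmod_eq_zero_iff_dvd _ 2).1 this)

theorem negOnePow_smul_congr {P : Type*} [AddCommGroup P] {a b : ℤ} (x : P)
    (h : (a : ZMod 2) = b) : a.negOnePow • x = b.negOnePow • x := by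
  rw [negOnePow_congr h]

variable {N P Q : Type*} [AddCommGroup P] [AddCommGroup Q]

/-- The total degree of a list of elements with prescribed degrees. -/
def ldeg (l : List (ℤ × N)) : ℤ := (l.map Prod.fst).sum

@[simp] theorem ldeg_nil : ldeg ([] : List (ℤ × N)) = 0 := rfl

@[simp] theorem ldeg_cons (x : ℤ × N) (l : List (ℤ × N)) : ldeg (x :: l) = x.1 + ldeg l := by
  simp [ldeg]

@[simp] theorem ldeg_append (l l' : List (ℤ × N)) : ldeg (l ++ l') = ldeg l + ldeg l' := by
  simp [ldeg]

/-- The signed sum of the values of `f` at the lists obtained from `l` by applying the operator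
`D` of degree `n` to one entry. -/
def der (n : ℤ) (D : N → N) : (List (ℤ × N) → P) → List (ℤ × N) → P
  | _, [] => 0
  | f, x :: l => f ((n + x.1, D x.2) :: l) +
      (n * x.1).negOnePow • der n D (fun l' => f (x :: l')) l

theorem der_nil (n : ℤ) (D : N → N) (f : List (ℤ × N) → P) : der n D f [] = 0 := rfl

theorem der_cons (n : ℤ) (D : N → N) (f : List (ℤ × N) → P) (x : ℤ × N) (l : List (ℤ × N)) :
    der n D f (x :: l) = f ((n + x.1, D x.2) :: l) +
      (n * x.1).negOnePow • der n D (fun l' => f (x :: l')) l := rfl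

theorem der_append (n : ℤ) (D : N → N) (f : List (ℤ × N) → P) (l₁ l₂ : List (ℤ × N)) :
    der n D f (l₁ ++ l₂) = der n D (fun l => f (l ++ l₂)) l₁ +
      (n * ldeg l₁).negOnePow • der n D (fun l => f (l₁ ++ l)) l₂ := by
  induction l₁ generalizing f with
  | nil => simp [der_nil]
  | cons x l₁ ih =>
    simp only [List.cons_append, der_cons, ih, smul_add, smul_smul, ldeg_cons, mul_add,
      Int.negOnePow_add, add_assoc]

theorem der_singleton (n : ℤ) (D : N → N) (f : List (ℤ × N) → P) (x : ℤ × N) :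
    der n D f [x] = f [(n + x.1, D x.2)] := by
  simp [der_cons, der_nil]

theorem der_add (n : ℤ) (D : N → N) (f g : List (ℤ × N) → P) (l : List (ℤ × N)) :
    der n D (fun l => f l + g l) l = der n D f l + der n D g l := by
  induction l generalizing f g with
  | nil => simp [der_nil]
  | cons x l ih => simp only [der_cons, ih, smul_add]; abel

theorem map_der (n : ℤ) (D : N → N) (φ : P →+ Q) (f : List (ℤ × N) → P) (l : List (ℤ × N)) :
    φ (der n D f l) = der n D (fun l => φ (f l)) l := by
  induction l generalizing f with
  | nil => simp [der_nil]
  | cons x l ih => simp only [der_cons, map_add, Units.smul_def, map_zsmul, ih]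

theorem der_smul (n : ℤ) (D : N → N) (u : ℤˣ) (f : List (ℤ × N) → P) (l : List (ℤ × N)) :
    der n D (fun l => u • f l) l = u • der n D f l :=
  (map_der n D (DistribSMul.toAddMonoidHom P u) f l).symm

/-- Every list at which `der` evaluates its function has total degree `n + ldeg l`. Signs depending
only on the total degree can therefore be pulled out of `der`, with the degree raised by `n`. -/
theorem der_congr_of_ldeg (n : ℤ) (D : N → N) {f g : List (ℤ × N) → P} {l : List (ℤ × N)}
    (h : ∀ l', ldeg l' = n + ldeg l → f l' = g l') : der n D f l = der n D g l := by
  induction l generalizing f g with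
  | nil => rfl
  | cons x l ih =>
    rw [der_cons, der_cons, h _ (by simp [add_assoc]),
      ih (f := fun l' => f (x :: l')) (g := fun l' => g (x :: l'))
        (fun l' h' => h _ (by simp [h']; ring))]

variable {σ : Type*} [SetLike σ N] {𝒩 : ℤ → σ}

/-- The entries of the list lie in the parts of the prescribed degrees. -/
def Homog (𝒩 : ℤ → σ) (l : List (ℤ × N)) : Prop := ∀ x ∈ l, x.2 ∈ 𝒩 x.1

theorem homog_nil : Homog 𝒩 [] := by simp [Homog]

theorem homog_cons {x : ℤ × N} {l : List (ℤ × N)} :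
    Homog 𝒩 (x :: l) ↔ x.2 ∈ 𝒩 x.1 ∧ Homog 𝒩 l := by simp [Homog]

theorem homog_append {l l' : List (ℤ × N)} :
    Homog 𝒩 (l ++ l') ↔ Homog 𝒩 l ∧ Homog 𝒩 l' := by
  simp [Homog, or_imp, forall_and]

/-- `der` is a signed sum of values at homogeneous lists of unchanged length. This is used both for
degrees of brackets and for the vanishing of the Leibniz identity. -/
theorem der_induction (n : ℤ) (D : N → N) (hD : ∀ m, ∀ x ∈ 𝒩 m, D x ∈ 𝒩 (n + m))
    (C : P → Prop) (h0 : C 0) (hadd : ∀ x y, C x → C y → C (x + y))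
    (hsmul : ∀ (u : ℤˣ) x, C x → C (u • x)) {f : List (ℤ × N) → P} {l : List (ℤ × N)}
    (hl : Homog 𝒩 l) (h : ∀ l', l'.length = l.length → ldeg l' = n + ldeg l → Homog 𝒩 l' → C (f l')) :
    C (der n D f l) := by
  induction l generalizing f with
  | nil => exact h0
  | cons x l ih =>
    rw [homog_cons] at hl
    rw [der_cons]
    refine hadd _ _ (h _ (by simp) (by simp [add_assoc]) (homog_cons.2 ⟨hD _ _ hl.1, hl.2⟩))
      (hsmul _ _ (ih hl.2 fun l' h1 h2 h3 => h _ (by simp [h1]) (by simp [h2]; ring)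
        (homog_cons.2 ⟨hl.1, h3⟩)))

theorem der_congr (n : ℤ) (D : N → N) (hD : ∀ m, ∀ x ∈ 𝒩 m, D x ∈ 𝒩 (n + m))
    {f g : List (ℤ × N) → P} {l : List (ℤ × N)} (hl : Homog 𝒩 l)
    (h : ∀ l', l'.length = l.length → ldeg l' = n + ldeg l → Homog 𝒩 l' → f l' = g l') :
    der n D f l = der n D g l := by
  induction l generalizing f g with
  | nil => rfl
  | cons x l ih =>
    rw [homog_cons] at hl
    rw [der_cons, der_cons, h _ (by simp) (by simp [add_assoc]) (homog_cons.2 ⟨hD _ _ hl.1, hl.2⟩),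
      ih (f := fun l' => f (x :: l')) (g := fun l' => g (x :: l')) hl.2
        (fun l' h1 h2 h3 => h _ (by simp [h1]) (by simp [h2]; ring) (homog_cons.2 ⟨hl.1, h3⟩))]

theorem _root_.Fin.Iio_succ_eq_insert {k : ℕ} (i : Fin k) :
    Finset.Iio i.succ = insert 0 ((Finset.Iio i).map (Fin.succEmb k)) := by
  ext j
  refine Fin.cases ?_ (fun j => ?_) j <;> simp

theorem der_ofFn {k : ℕ} (n : ℤ) (D : N → N) (f : List (ℤ × N) → P) (w : Fin k → ℤ × N) :
    der n D f (List.ofFn w) = ∑ i, (n * ∑ j ∈ Finset.Iio i, (w j).1).negOnePow •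
      f (List.ofFn (Function.update w i (n + (w i).1, D (w i).2))) := by
  induction k generalizing f with
  | zero => simp [der_nil]
  | succ k ih =>
    rw [List.ofFn_succ, der_cons, ih, Fin.sum_univ_succ, Finset.smul_sum]
    congr 1
    · have : Finset.Iio (0 : Fin (k + 1)) = ∅ := by ext; simp
      rw [this]
      simp [List.ofFn_succ]
    · refine Finset.sum_congr rfl fun i _ => ?_
      rw [smul_smul, ← Int.negOnePow_add, ← mul_add, Fin.Iio_succ_eq_insert,
        Finset.sum_insert (by simp), Finset.sum_map, List.ofFn_succ (f := Function.update w _ _),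
        Function.update_of_ne (Fin.succ_ne_zero i).symm]
      congr 4
      funext j
      by_cases h : j = i
      · subst h; simp
      · rw [Function.update_of_ne h, Function.update_of_ne (by simpa using h)]

end Lists

/-! ### Brackets of lists -/

namespace Brackets

variable {K N : Type*} [Field K] [AddCommGroup N] [Module K N] (lam : Brackets K N)

theorem ev_eq_getD {l : List N} {n : ℕ} (h : l.length = n) :
    lam.ev l = lam n (fun i => l.getD i 0) := by
  subst h
  unfold ev
  congr 1
  funext i
  simp

theorem ev_ofFn {n : ℕ} (v : Fin n → N) : lam.ev (List.ofFn v) = lam n v := by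
  rw [ev_eq_getD lam (List.length_ofFn)]
  congr 1
  funext i
  simp

/-- The bracket as a function of the entry that follows the entries of `A`. -/
def slot (A L : List N) : N →ₗ[K] N :=
  (lam (A.length + (L.length + 1))).toLinearMap (fun i => (A ++ 0 :: L).getD i 0)
    ⟨A.length, by omega⟩

theorem slot_apply (A L : List N) (x : N) : lam.slot A L x = lam.ev (A ++ x :: L) := by
  rw [ev_eq_getD lam (n := A.length + (L.length + 1)) (by simp), slot,
    MultilinearMap.toLinearMap_apply]
  congr 1
  funext i
  by_cases h : i = ⟨A.length, by omega⟩
  · subst h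
    simp
  · rw [Function.update_of_ne h]
    have h' : (i : ℕ) ≠ A.length := fun h' => h (Fin.ext h')
    rcases lt_or_gt_of_ne h' with h1 | h1
    · rw [List.getD_append _ _ _ _ h1, List.getD_append _ _ _ _ h1]
    · rw [List.getD_append_right _ _ _ _ h1.le, List.getD_append_right _ _ _ _ h1.le]
      obtain ⟨m, hm⟩ : ∃ m, (i : ℕ) - A.length = m + 1 := ⟨i - A.length - 1, by omega⟩
      simp [hm]

/-- The bracket of the entries of a list of elements with prescribed degrees. -/
def evl (l : List (ℤ × N)) : N := lam.ev (l.map Prod.snd)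

theorem evl_ofFn {n : ℕ} (w : Fin n → ℤ × N) :
    lam.evl (List.ofFn w) = lam n (fun i => (w i).2) := by
  rw [evl, List.map_ofFn, ev_ofFn]; rfl

/-- The degree attached to an entry does not influence the bracket, only linearity in the entry
matters. Hence the placeholder degree `0` in `shufCorr` is harmless. -/
theorem evl_slot (A L : List (ℤ × N)) (d : ℤ) (x : N) :
    lam.evl (A ++ (d, x) :: L) = lam.slot (A.map Prod.snd) (L.map Prod.snd) x := by
  rw [slot_apply, evl]; simp

end Brackets

/-! ### The Kapranov recursion in terms of lists -/

section Shuffle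

variable {K N : Type*} [Field K] [AddCommGroup N] [Module K N]

/-- The value of `φ` at the entry of a list with one entry, and `0` for all other lists. -/
def single (φ : N → N) : List (ℤ × N) → N
  | [x] => φ x.2
  | _ => 0

theorem single_append_cons {φ : N → N} {A : List (ℤ × N)} (hA : A ≠ []) (x : ℤ × N)
    (L : List (ℤ × N)) : single φ (A ++ x :: L) = 0 := by
  obtain ⟨a, A, rfl⟩ := List.exists_cons_of_ne_nil hA
  cases A <;> rfl

theorem single_cons_cons {φ : N → N} (x y : ℤ × N) (L : List (ℤ × N)) :
    single φ (x :: y :: L) = 0 := rfl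

variable {𝒩 : ℤ → Submodule K N} {del : N →ₗ[K] N} {nab : N →ₗ[K] N →ₗ[K] N} {R : Brackets K N}

namespace IsKapranov

variable (hR : IsKapranov 𝒩 del nab R)

include hR

theorem evl_singleton (x : ℤ × N) : R.evl [x] = del x.2 := by
  rw [← hR.unary, Brackets.unary, Brackets.evl, Brackets.ev]
  simp only [MultilinearMap.ofSubsingleton_symm_apply_apply]
  congr 1
  funext i
  simp

/-- The Atiyah cocycle and the higher recursion become one formula: the term `∇_{∂b} e`, peculiar to
the binary bracket, is carried by `single` and vanishes as soon as `l` has two entries. Inductions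
on the length need no separate binary case. -/
theorem evl_cons {x : ℤ × N} {l : List (ℤ × N)} (hl : l ≠ []) (h : Homog 𝒩 (x :: l)) :
    R.evl (x :: l) = x.1.negOnePow • nab x.2 (R.evl l) - der x.1 (nab x.2) R.evl l +
      single (nab (del x.2)) l := by
  rw [homog_cons] at h
  match l, hl with
  | [y], _ =>
    have : R.evl [x, y] = R 2 ![x.2, y.2] := by
      rw [← Brackets.ev_ofFn]; simp [Brackets.evl, List.ofFn_succ]
    rw [this, hR.binary _ _ h.1, der_singleton, hR.evl_singleton, hR.evl_singleton, single]
    abel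
  | y :: z :: l, _ =>
    rw [single_cons_cons, add_zero]
    obtain ⟨k, w, hw⟩ : ∃ k, ∃ w : Fin k → ℤ × N, List.ofFn w = y :: z :: l :=
      ⟨_, (y :: z :: l).get, List.ofFn_get _⟩
    have hk : 2 ≤ k := by
      have := congrArg List.length hw
      simp at this; omega
    rw [← hw] at h ⊢
    have hw' : ∀ i, (w i).2 ∈ 𝒩 (w i).1 := fun i => h.2 _ ((List.mem_ofFn' _ _).2 ⟨i, rfl⟩)
    have := hR.higher k hk x.1 (fun i => (w i).1) x.2 h.1 (fun i => (w i).2) hw'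
    rw [← Brackets.evl_ofFn] at this
    rw [der_ofFn]
    convert this using 1
    · rw [← Brackets.ev_ofFn, Brackets.evl, List.ofFn_succ]
      simp [List.map_ofFn, Function.comp_def]
    · congr 1
      refine Finset.sum_congr rfl fun i _ => ?_
      congr 1
      rw [Brackets.evl_ofFn]
      congr 1
      funext j
      by_cases hj : j = i
      · subst hj; simp
      · simp [Function.update_of_ne hj]

variable (hdel : ∀ n, ∀ x ∈ 𝒩 n, del x ∈ 𝒩 (n + 1))
  (hnab : ∀ n, ∀ x ∈ 𝒩 n, ∀ m, ∀ y ∈ 𝒩 m, nab x y ∈ 𝒩 (n + m))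

include hdel hnab

theorem evl_mem {l : List (ℤ × N)} (hl : l ≠ []) (h : Homog 𝒩 l) :
    R.evl l ∈ 𝒩 (ldeg l + 1) := by
  obtain ⟨k, hk⟩ : ∃ k, l.length = k := ⟨_, rfl⟩
  induction k generalizing l with
  | zero => exact absurd (List.length_eq_zero_iff.1 hk) hl
  | succ k ih =>
    obtain ⟨x, l, rfl⟩ := List.exists_cons_of_ne_nil hl
    have hx := homog_cons.1 h
    by_cases hl' : l = []
    · subst hl'
      rw [hR.evl_singleton]
      simpa using hdel _ _ hx.1
    have hk' : l.length = k := by simpa using hk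
    rw [hR.evl_cons hl' h, ldeg_cons]
    refine add_mem (sub_mem ?_ ?_) ?_
    · rw [Units.smul_def]
      refine zsmul_mem ?_ _
      rw [add_assoc]
      exact hnab _ _ hx.1 _ _ (ih hl' hx.2 hk')
    · refine der_induction (𝒩 := 𝒩) _ _ (hnab _ _ hx.1) (fun z => z ∈ 𝒩 (x.1 + ldeg l + 1))
        (zero_mem _) (fun _ _ => add_mem) (fun u z hz => ?_) hx.2 fun l' h1 h2 h3 => ?_
      · rw [Units.smul_def]; exact zsmul_mem hz _
      · rw [← h2]
        refine ih ?_ h3 (h1.trans hk')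
        rintro rfl
        exact hl' (List.length_eq_zero_iff.1 h1.symm)
    · match l, hl' with
      | [y], _ =>
        have := hnab _ _ (hdel _ _ hx.1) _ _ (homog_cons.1 hx.2).1
        rw [single, ldeg_cons, ldeg_nil]
        convert this using 2
        ring
      | y :: z :: l, _ => exact zero_mem _

end IsKapranov

/-- The sum over the ways to distribute the entries of an initial part of `L` to the ends of `A`
and `B`, the last one to `B`, of `± [A, [B], L']`, where `L'` is the remaining part of `L`. -/
def shuf (f : List (ℤ × N) → N) : List (ℤ × N) → List (ℤ × N) → List (ℤ × N) → N
  | _, _, [] => 0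
  | A, B, v :: L =>
    (ldeg A).negOnePow • f (A ++ (ldeg B + v.1 + 1, f (B ++ [v])) :: L) +
      shuf f A (B ++ [v]) L + (v.1 * ldeg B).negOnePow • shuf f (A ++ [v]) B L

theorem shuf_nil (f : List (ℤ × N) → N) (A B : List (ℤ × N)) : shuf f A B [] = 0 := by
  rw [shuf]

/-- An entry `v` has three fates: it closes the inner bracket, it joins the inner entries `B`, or it
passes `B` with a Koszul sign and joins the outer entries `A`. -/
theorem shuf_cons (f : List (ℤ × N) → N) (A B : List (ℤ × N)) (v : ℤ × N) (L : List (ℤ × N)) :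
    shuf f A B (v :: L) =
      (ldeg A).negOnePow • f (A ++ (ldeg B + v.1 + 1, f (B ++ [v])) :: L) +
      shuf f A (B ++ [v]) L + (v.1 * ldeg B).negOnePow • shuf f (A ++ [v]) B L := by
  rw [shuf]

/-- The contribution to `shuf f (x :: A) B L ± shuf f A (x :: B) L` of the correction terms in
`IsKapranov.evl_cons`. -/
def shufCorr (f : List (ℤ × N) → N) (n : ℤ) (D' : N → N) :
    List (ℤ × N) → List (ℤ × N) → List (ℤ × N) → N
  | _, _, [] => 0
  | A, B, v :: L =>
    (n + ldeg A).negOnePow • single D' (A ++ (ldeg B + v.1 + 1, f (B ++ [v])) :: L) +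
      (n * ldeg A + ldeg A).negOnePow • f (A ++ (0, single D' (B ++ [v])) :: L) +
      shufCorr f n D' A (B ++ [v]) L +
      (v.1 * ldeg B).negOnePow • shufCorr f n D' (A ++ [v]) B L

theorem shufCorr_nil (f : List (ℤ × N) → N) (n : ℤ) (D' : N → N) (A B : List (ℤ × N)) :
    shufCorr f n D' A B [] = 0 := by rw [shufCorr]

theorem shufCorr_cons (f : List (ℤ × N) → N) (n : ℤ) (D' : N → N) (A B : List (ℤ × N))
    (v : ℤ × N) (L : List (ℤ × N)) : shufCorr f n D' A B (v :: L) =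
      (n + ldeg A).negOnePow • single D' (A ++ (ldeg B + v.1 + 1, f (B ++ [v])) :: L) +
      (n * ldeg A + ldeg A).negOnePow • f (A ++ (0, single D' (B ++ [v])) :: L) +
      shufCorr f n D' A (B ++ [v]) L +
      (v.1 * ldeg B).negOnePow • shufCorr f n D' (A ++ [v]) B L := by rw [shufCorr]

end Shuffle

/-! ### Correction terms coming from the binary bracket -/

section Shuffle

variable {K N : Type*} [Field K] [AddCommGroup N] [Module K N]
  {𝒩 : ℤ → Submodule K N} {del : N →ₗ[K] N} {nab : N →ₗ[K] N →ₗ[K] N} {R : Brackets K N}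

/-- A correction arises only where the bracket beginning with `x` is binary. With entries in both
`A` and `B` neither the outer nor the inner bracket can be binary. -/
theorem shufCorr_of_ne_nil (n : ℤ) (D' : N → N) {A B : List (ℤ × N)} (hA : A ≠ []) (hB : B ≠ [])
    (L : List (ℤ × N)) : shufCorr R.evl n D' A B L = 0 := by
  induction L generalizing A B with
  | nil => rw [shufCorr_nil]
  | cons v L ih =>
    rw [shufCorr_cons, single_append_cons hA, single_append_cons hB, ih hA (by simp),
      ih (by simp) hB, Brackets.evl_slot]
    simp

/-- Only a binary outer bracket contributes, which forces all of `L` into the inner bracket. -/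
theorem shufCorr_nil_left (n : ℤ) (D' : N → N) {B L : List (ℤ × N)} (hB : B ≠ []) (hL : L ≠ []) :
    shufCorr R.evl n D' [] B L = n.negOnePow • D' (R.evl (B ++ L)) := by
  induction L generalizing B with
  | nil => exact absurd rfl hL
  | cons v L ih =>
    have h0 : R.evl ([] ++ (0, (0 : N)) :: L) = 0 := by rw [Brackets.evl_slot, map_zero]
    rw [shufCorr_cons, single_append_cons hB, h0, shufCorr_of_ne_nil n D' (by simp) hB]
    by_cases h : L = []
    · subst h
      simp [shufCorr_nil, single]
    · obtain ⟨w, L, rfl⟩ := List.exists_cons_of_ne_nil h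
      rw [ih (by simp) (by simp)]
      simp [single_cons_cons]

/-- Only a binary inner bracket `[x, v]` contributes, with `v` running over `L`. The result is `D'`
acting as an operator of degree `n + 1`. -/
theorem shufCorr_nil_right (n : ℤ) (D' : N → N) {A : List (ℤ × N)} (hA : A ≠ [])
    (L : List (ℤ × N)) : shufCorr R.evl n D' A [] L =
      ((n + 1) * ldeg A).negOnePow • der (n + 1) D' (fun l => R.evl (A ++ l)) L := by
  induction L generalizing A with
  | nil => simp [shufCorr_nil, der_nil]
  | cons v L ih =>
    rw [shufCorr_cons, single_append_cons hA, shufCorr_of_ne_nil n D' hA (by simp),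
      ih (by simp), der_cons, List.nil_append, single, Brackets.evl_slot, Brackets.evl_slot]
    simp only [smul_zero, zero_add, add_zero, smul_add, smul_smul, ← Int.negOnePow_add, ldeg_nil,
      ldeg_append, ldeg_cons, List.append_assoc, List.cons_append, List.nil_append, mul_zero]
    congr 2 <;> congr 1 <;> ring

/-- For `D' = ∇_{∂x}` and `n = |x|` the right side is minus the recursion for the bracket with first
entry `∂x`, an element of degree `n + 1`. This is what makes the corrections cancel. -/
theorem shufCorr_nil_nil (n : ℤ) (D' : N → N) {L : List (ℤ × N)} (hL : L ≠ []) :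
    shufCorr R.evl n D' [] [] L =
      n.negOnePow • D' (R.evl L) + der (n + 1) D' R.evl L := by
  obtain ⟨v, L, rfl⟩ := List.exists_cons_of_ne_nil hL
  rw [shufCorr_cons, shufCorr_nil_right n D' (by simp), der_cons]
  simp only [List.nil_append, ldeg_nil, ldeg_cons, mul_zero, add_zero, zero_add,
    Int.negOnePow_zero, one_smul, List.cons_append]
  have h1 : R.evl ((0, single D' [v]) :: L) = R.evl ((n + 1 + v.1, D' v.2) :: L) := rfl
  rw [h1]
  by_cases h : L = []
  · subst h
    simp only [shufCorr_nil, single, add_zero, der_nil, smul_zero]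
  · rw [shufCorr_nil_left n D' (by simp) h]
    obtain ⟨w, L, rfl⟩ := List.exists_cons_of_ne_nil h
    rw [single_cons_cons, smul_zero, zero_add, List.cons_append, List.nil_append]
    abel

namespace IsKapranov

variable (hR : IsKapranov 𝒩 del nab R)
  (hdel : ∀ n, ∀ x ∈ 𝒩 n, del x ∈ 𝒩 (n + 1))
  (hnab : ∀ n, ∀ x ∈ 𝒩 n, ∀ m, ∀ y ∈ 𝒩 m, nab x y ∈ 𝒩 (n + m))

include hR hdel hnab

/-- Expanding the outer bracket produces `∇_x` applied to the inner bracket as one of its entries.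
Expanding the inner bracket produces the same term with the opposite sign. After the cancellation
`∇_x` acts on the whole expression and, as a derivation, on `A`, `B`, `v` and `L`. -/
theorem evl_nested {x v : ℤ × N} {A B L : List (ℤ × N)} (hx : x.2 ∈ 𝒩 x.1) (hA : Homog 𝒩 A)
    (hB : Homog 𝒩 B) (hv : v.2 ∈ 𝒩 v.1) (hL : Homog 𝒩 L) :
    (ldeg (x :: A)).negOnePow •
        R.evl (x :: A ++ (ldeg B + v.1 + 1, R.evl (B ++ [v])) :: L) +
      (x.1 * ldeg A).negOnePow • (ldeg A).negOnePow •
        R.evl (A ++ (ldeg (x :: B) + v.1 + 1, R.evl (x :: B ++ [v])) :: L) =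
    (ldeg A).negOnePow • nab x.2 (R.evl (A ++ (ldeg B + v.1 + 1, R.evl (B ++ [v])) :: L)) -
      der x.1 (nab x.2) (fun A => (ldeg A).negOnePow •
        R.evl (A ++ (ldeg B + v.1 + 1, R.evl (B ++ [v])) :: L)) A -
      (x.1 * ldeg A).negOnePow • (ldeg A).negOnePow •
        (der x.1 (nab x.2) (fun B =>
          R.evl (A ++ (ldeg B + v.1 + 1, R.evl (B ++ [v])) :: L)) B +
        (x.1 * ldeg B).negOnePow •
          R.evl (A ++ (ldeg B + (x.1 + v.1) + 1, R.evl (B ++ [(x.1 + v.1, nab x.2 v.2)])) :: L)) -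
      (x.1 * (ldeg A + ldeg B + v.1)).negOnePow • (ldeg A).negOnePow •
        der x.1 (nab x.2) (fun L =>
          R.evl (A ++ (ldeg B + v.1 + 1, R.evl (B ++ [v])) :: L)) L +
      (x.1 + ldeg A).negOnePow •
        single (nab (del x.2)) (A ++ (ldeg B + v.1 + 1, R.evl (B ++ [v])) :: L) +
      (x.1 * ldeg A + ldeg A).negOnePow •
        R.evl (A ++ (0, single (nab (del x.2)) (B ++ [v])) :: L) := by
  have hBv : Homog 𝒩 (B ++ [v]) := homog_append.2 ⟨hB, homog_cons.2 ⟨hv, homog_nil⟩⟩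
  have hy : R.evl (B ++ [v]) ∈ 𝒩 (ldeg B + v.1 + 1) := by
    have := hR.evl_mem hdel hnab (by simp) hBv
    simpa using this
  rw [List.cons_append, hR.evl_cons (by simp)
    (homog_cons.2 ⟨hx, homog_append.2 ⟨hA, homog_cons.2 ⟨hy, hL⟩⟩⟩), List.cons_append,
    hR.evl_cons (by simp) (homog_cons.2 ⟨hx, hBv⟩), der_append, der_append, der_singleton, der_cons]
  -- Applying `∇_x` to an entry of `A` raises the degree of `A` by `|x|`, so the sign pulled out is
  -- not that of `A` itself.
  have hA' : der x.1 (nab x.2) (fun A => (ldeg A).negOnePow •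
        R.evl (A ++ (ldeg B + v.1 + 1, R.evl (B ++ [v])) :: L)) A = (x.1 + ldeg A).negOnePow •
      der x.1 (nab x.2) (fun A =>
        R.evl (A ++ (ldeg B + v.1 + 1, R.evl (B ++ [v])) :: L)) A := by
    rw [← der_smul]
    exact der_congr_of_ldeg _ _ fun l' h => by rw [h]
  have hB' : der x.1 (nab x.2) (fun B =>
        R.evl (A ++ (ldeg B + v.1 + 1, R.evl (B ++ [v])) :: L)) B =
      R.slot (A.map Prod.snd) (L.map Prod.snd)
        (der x.1 (nab x.2) (fun B => R.evl (B ++ [v])) B) := by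
    simp only [Brackets.evl_slot R A L]
    exact (map_der _ _ (R.slot (A.map Prod.snd) (L.map Prod.snd)).toAddMonoidHom _ _).symm
  rw [hA', hB']
  have hs : ∀ (u : ℤˣ) (z : N), R.slot (A.map Prod.snd) (L.map Prod.snd) (u • z) =
    u • R.slot (A.map Prod.snd) (L.map Prod.snd) z := fun u z => by
      rw [Units.smul_def, map_zsmul, Units.smul_def]
  simp only [Brackets.evl_slot R A L, ldeg_cons, map_add, map_sub, hs]
  simp only [mul_add, Int.negOnePow_add, mul_one]
  generalize R.slot (A.map Prod.snd) (L.map Prod.snd) = φ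
  -- All exponents are now split into products of basic signs. The comparison of coefficients uses
  -- only that each sign squares to `1`.
  have sq : ∀ u : ℤˣ, (u : ℤ) * u = 1 := fun u => by
    rw [← Units.val_mul, Int.units_mul_self, Units.val_one]
  have s1 := sq x.1.negOnePow
  have s2 := sq (ldeg A).negOnePow
  have s3 := sq (x.1 * ldeg A).negOnePow
  have s4 := sq (x.1 * ldeg B).negOnePow
  have s5 := sq (x.1 * v.1).negOnePow
  simp only [Units.smul_def, Units.val_mul]
  clear * - s1 s2 s3 s4 s5
  match_scalars <;> grind

end IsKapranov

end Shuffle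

/-! ### The Leibniz identity -/

section Shuffle

variable {K N : Type*} [Field K] [AddCommGroup N] [Module K N]
  {𝒩 : ℤ → Submodule K N} {del : N →ₗ[K] N} {nab : N →ₗ[K] N →ₗ[K] N} {R : Brackets K N}

namespace IsKapranov

variable (hR : IsKapranov 𝒩 del nab R)
  (hdel : ∀ n, ∀ x ∈ 𝒩 n, del x ∈ 𝒩 (n + 1))
  (hnab : ∀ n, ∀ x ∈ 𝒩 n, ∀ m, ∀ y ∈ 𝒩 m, nab x y ∈ 𝒩 (n + m))

include hR hdel hnab

/-- Induction on `L`: the term in which `v` closes the inner bracket is `evl_nested`, and the two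
others are the induction hypotheses with `v` moved to the end of `B` or of `A`. The pieces where
`∇_x` hits `v` recombine to the derivative along `v :: L`. -/
theorem shuf_insert {x : ℤ × N} {A B L : List (ℤ × N)} (hx : x.2 ∈ 𝒩 x.1) (hA : Homog 𝒩 A)
    (hB : Homog 𝒩 B) (hL : Homog 𝒩 L) :
    shuf R.evl (x :: A) B L + (x.1 * ldeg A).negOnePow • shuf R.evl A (x :: B) L =
      nab x.2 (shuf R.evl A B L) -
      der x.1 (nab x.2) (fun A => shuf R.evl A B L) A -
      (x.1 * ldeg A).negOnePow • der x.1 (nab x.2) (fun B => shuf R.evl A B L) B -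
      (x.1 * (ldeg A + ldeg B)).negOnePow • der x.1 (nab x.2) (fun L => shuf R.evl A B L) L +
      shufCorr R.evl x.1 (nab (del x.2)) A B L := by
  induction L generalizing A B with
  | nil =>
    have h0 : ∀ l : List (ℤ × N), der x.1 (nab x.2) (fun _ => (0 : N)) l = 0 := fun l => by
      have := der_smul x.1 (nab x.2) (-1) (fun _ => (0 : N)) l
      simpa using (map_der x.1 (nab x.2) (0 : N →+ N) (fun _ => (0 : N)) l).symm
    simp only [shuf_nil, shufCorr_nil, der_nil, h0]
    simp
  | cons v L ih =>
    obtain ⟨hv, hL⟩ := homog_cons.1 hL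
    have hv' : Homog 𝒩 [v] := homog_cons.2 ⟨hv, homog_nil⟩
    have e1 := hR.evl_nested hdel hnab hx hA hB hv hL
    have e2 := ih hA (homog_append.2 ⟨hB, hv'⟩) hL
    have e3 := ih (homog_append.2 ⟨hA, hv'⟩) hB hL
    rw [der_append, der_singleton] at e2 e3
    have d1 : der x.1 (nab x.2) (fun A => shuf R.evl A B (v :: L)) A =
        der x.1 (nab x.2) (fun A => (ldeg A).negOnePow •
          R.evl (A ++ (ldeg B + v.1 + 1, R.evl (B ++ [v])) :: L)) A +
        der x.1 (nab x.2) (fun A => shuf R.evl A (B ++ [v]) L) A +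
        (v.1 * ldeg B).negOnePow • der x.1 (nab x.2) (fun A => shuf R.evl (A ++ [v]) B L) A := by
      simp only [shuf_cons, der_add, der_smul]
    have d2 : der x.1 (nab x.2) (fun B => shuf R.evl A B (v :: L)) B =
        (ldeg A).negOnePow • der x.1 (nab x.2) (fun B =>
          R.evl (A ++ (ldeg B + v.1 + 1, R.evl (B ++ [v])) :: L)) B +
        der x.1 (nab x.2) (fun B => shuf R.evl A (B ++ [v]) L) B +
        (v.1 * (x.1 + ldeg B)).negOnePow •
          der x.1 (nab x.2) (fun B => shuf R.evl (A ++ [v]) B L) B := by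
      simp only [shuf_cons, der_add, der_smul]
      congr 1
      rw [← der_smul]
      exact der_congr_of_ldeg _ _ fun l' h => by rw [h]
    have d3 : der x.1 (nab x.2) (fun L => shuf R.evl A B (v :: L)) L =
        (ldeg A).negOnePow • der x.1 (nab x.2) (fun L =>
          R.evl (A ++ (ldeg B + v.1 + 1, R.evl (B ++ [v])) :: L)) L +
        der x.1 (nab x.2) (fun L => shuf R.evl A (B ++ [v]) L) L +
        (v.1 * ldeg B).negOnePow • der x.1 (nab x.2) (fun L => shuf R.evl (A ++ [v]) B L) L := by
      simp only [shuf_cons, der_add, der_smul]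
    rw [der_cons, d1, d2, d3, shuf_cons (A := x :: A), shuf_cons (A := A) (B := x :: B),
      shuf_cons (A := A) (B := B) (v := v), shuf_cons (v := (x.1 + v.1, nab x.2 v.2)),
      shufCorr_cons]
    have m1 : ∀ (u : ℤˣ) (z : N), nab x.2 (u • z) = u • nab x.2 z := fun u z => by
      rw [Units.smul_def, map_zsmul, Units.smul_def]
    simp only [map_add, m1]
    simp only [List.cons_append] at e1 e2 e3 ⊢
    have e23 : shuf R.evl (x :: A) (B ++ [v]) L = _ := eq_sub_of_add_eq e2
    have e33 : shuf R.evl (x :: (A ++ [v])) B L = _ := eq_sub_of_add_eq e3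
    have e13 := eq_sub_of_add_eq e1
    rw [e13, e23, e33]
    simp only [ldeg_cons, ldeg_append, ldeg_nil, add_zero, mul_add, add_mul,
      Int.negOnePow_add, mul_comm v.1 x.1]
    have sq : ∀ u : ℤˣ, (u : ℤ) * u = 1 := fun u => by
      rw [← Units.val_mul, Int.units_mul_self, Units.val_one]
    have s1 := sq x.1.negOnePow
    have s2 := sq (ldeg A).negOnePow
    have s3 := sq (x.1 * ldeg A).negOnePow
    have s4 := sq (x.1 * ldeg B).negOnePow
    have s5 := sq (x.1 * v.1).negOnePow
    have s6 := sq (v.1 * ldeg B).negOnePow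
    simp only [Units.smul_def, Units.val_mul]
    clear * - s1 s2 s3 s4 s5 s6
    match_scalars <;> grind

/-- If `x` alone closes the inner bracket, the contribution is `R(∂x, L)`. The other fates of `x`
are `shuf_insert` with `A` and `B` empty, and its correction is `-R(∂x, L)`. -/
theorem shuf_nil_nil_cons {x : ℤ × N} {L : List (ℤ × N)} (hx : x.2 ∈ 𝒩 x.1) (hL : Homog 𝒩 L)
    (hL' : L ≠ []) (hdd : ∀ x, del (del x) = 0) :
    shuf R.evl [] [] (x :: L) =
      nab x.2 (shuf R.evl [] [] L) - der x.1 (nab x.2) (fun L => shuf R.evl [] [] L) L := by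
  have key := hR.shuf_insert hdel hnab hx homog_nil homog_nil hL
  simp only [der_nil, ldeg_nil, mul_zero, Int.negOnePow_zero, one_smul, sub_zero, add_zero,
    smul_zero] at key
  rw [shufCorr_nil_nil _ _ hL'] at key
  rw [shuf_cons]
  simp only [ldeg_nil, mul_zero, Int.negOnePow_zero, one_smul, List.nil_append, zero_add]
  -- The recursion for first entry `∂x` has its own extra term `∇_{∂∂x}`, which is zero.
  have h0 : single (⇑(nab (del (del x.2)))) L = 0 := by
    rw [hdd, map_zero]
    match L with
    | [] => rfl
    | [y] => rfl
    | y :: z :: L => rfl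
  have hx' : R.evl [x] = del x.2 := hR.evl_singleton x
  rw [hx', hR.evl_cons hL' (homog_cons.2 ⟨hdel _ _ hx, hL⟩), h0, add_zero, add_assoc,
    add_comm (shuf R.evl [] [x] L), key, Int.negOnePow_succ, Units.neg_smul]
  abel

theorem shuf_nil_nil_eq_zero (hdd : ∀ x, del (del x) = 0) {L : List (ℤ × N)} (hL : Homog 𝒩 L) :
    shuf R.evl [] [] L = 0 := by
  obtain ⟨k, hk⟩ : ∃ k, L.length = k := ⟨_, rfl⟩
  induction k generalizing L with
  | zero => rw [List.length_eq_zero_iff.1 hk, shuf_nil]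
  | succ k ih =>
    obtain ⟨x, L, rfl⟩ := List.exists_cons_of_length_eq_add_one hk
    obtain ⟨hx, hL⟩ := homog_cons.1 hL
    have hk' : L.length = k := by simpa using hk
    by_cases hL' : L = []
    · subst hL'
      rw [shuf_cons, shuf_nil, shuf_nil]
      simp only [List.nil_append, smul_zero, add_zero]
      rw [hR.evl_singleton, hR.evl_singleton, hdd, smul_zero]
    · rw [hR.shuf_nil_nil_cons hdel hnab hx hL hL' hdd, ih hL hk', map_zero, zero_sub, neg_eq_zero]
      exact der_induction (P := N) (𝒩 := 𝒩) _ _ (hnab _ _ hx) (fun z => z = 0) rfl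
        (fun _ _ h h' => by rw [h, h', add_zero]) (fun u z h => by rw [h, smul_zero]) hL
        fun l' h1 _ h3 => ih h3 (h1.trans hk')

end IsKapranov

end Shuffle

/-! ### Comparison with sums over shuffles -/

section Sums

theorem _root_.List.filter_map_finRange_succ {α : Type*} {n : ℕ} (p : Fin (n + 1) → Bool)
    (v : Fin (n + 1) → α) : ((List.finRange (n + 1)).filter p).map v =
      (if p 0 then [v 0] else []) ++
        ((List.finRange n).filter (fun i => p i.succ)).map (fun i => v i.succ) := by
  rw [List.finRange_succ, List.filter_cons, List.filter_map]
  split_ifs <;> simp [Function.comp_def]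

theorem _root_.Fin.sum_powerset_Iio_succ {P : Type*} [AddCommMonoid P] {n : ℕ} (k : Fin n)
    (f : Finset (Fin (n + 1)) → P) :
    ∑ S ∈ (Finset.Iio k.succ).powerset, f S =
      ∑ S ∈ (Finset.Iio k).powerset, f (S.map (Fin.succEmb n)) +
      ∑ S ∈ (Finset.Iio k).powerset, f (insert 0 (S.map (Fin.succEmb n))) := by
  have hm : ∀ F : Finset (Fin (n + 1)) → P,
      ∑ S ∈ ((Finset.Iio k).map (Fin.succEmb n)).powerset, F S =
      ∑ S ∈ (Finset.Iio k).powerset, F (S.map (Fin.succEmb n)) := by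
    intro F
    symm
    refine Finset.sum_bij (fun S _ => S.map (Fin.succEmb n)) ?_ ?_ ?_ ?_
    · intro S hS
      exact Finset.mem_powerset.2 (Finset.map_subset_map.2 (Finset.mem_powerset.1 hS))
    · intro S _ T _ h
      exact Finset.map_injective _ h
    · intro T hT
      obtain ⟨S, hS, rfl⟩ := Finset.subset_map_iff.1 (Finset.mem_powerset.1 hT)
      exact ⟨S, Finset.mem_powerset.2 hS, rfl⟩
    · intros; rfl
  rw [Fin.Iio_succ_eq_insert, Finset.sum_powerset_insert (by simp), hm, hm]

/-- With the entry `0` left outside `S`, every entry of `S` has to pass it. -/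
theorem shuffleSign_map_succ {n : ℕ} (deg : Fin (n + 1) → ℤ) (k : Fin n) {S : Finset (Fin n)} :
    shuffleSign deg k.succ (S.map (Fin.succEmb n)) =
      (deg 0 * ∑ s ∈ S, deg s.succ).negOnePow * shuffleSign (fun i => deg i.succ) k S := by
  have hp : ∀ (T : Finset (Fin n)) (f : Fin n → ℤ), (∑ s ∈ T, f s).negOnePow =
      ∏ s ∈ T, (f s).negOnePow := by
    intro T f
    induction T using Finset.cons_induction with
    | empty => rfl
    | cons a T ha ih => rw [Finset.sum_cons, Finset.prod_cons, Int.negOnePow_add, ih]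
  rw [Finset.mul_sum, hp, shuffleSign, shuffleSign, ← Finset.prod_mul_distrib, Finset.prod_map]
  refine Finset.prod_congr rfl fun s hs => ?_
  have : ((Finset.Iio k.succ) \ S.map (Fin.succEmb n)).filter (· < Fin.succEmb n s) =
      insert 0 (((Finset.Iio k \ S).filter (· < s)).map (Fin.succEmb n)) := by
    ext j
    rw [Finset.mem_filter]
    refine Fin.cases ?_ (fun j => ?_) j <;> simp
  rw [this, Finset.prod_insert (by simp), Finset.prod_map]
  simp [mul_comm]

/-- An entry `0` in `S` already stands first, so no new transposition occurs. -/
theorem shuffleSign_insert_zero {n : ℕ} (deg : Fin (n + 1) → ℤ) (k : Fin n)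
    {S : Finset (Fin n)} : shuffleSign deg k.succ (insert 0 (S.map (Fin.succEmb n))) =
      shuffleSign (fun i => deg i.succ) k S := by
  have h0 : ∀ T : Finset (Fin (n + 1)), T.filter (· < 0) = ∅ := by intro T; ext; simp
  rw [shuffleSign, shuffleSign, Finset.prod_insert (by simp), h0, Finset.prod_empty, one_mul,
    Finset.prod_map]
  refine Finset.prod_congr rfl fun s hs => ?_
  have : ((Finset.Iio k.succ) \ insert 0 (S.map (Fin.succEmb n))).filter (· < Fin.succEmb n s) =
      ((Finset.Iio k \ S).filter (· < s)).map (Fin.succEmb n) := by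
    ext j
    rw [Finset.mem_filter]
    refine Fin.cases ?_ (fun j => ?_) j <;> simp
  rw [this, Finset.prod_map]
  simp

variable {N : Type*} [AddCommGroup N]

/-- The induction moves the first entry into `A` or `B`, so both must be arbitrary. The additional
sign accounts for the entries of `S` passing `B` and for the odd inner bracket passing `A` and `S`;
the application has `A = B = []`. -/
theorem shuf_ofFn (f : List (ℤ × N) → N) {n : ℕ} (w : Fin n → ℤ × N) (A B : List (ℤ × N)) :
    shuf f A B (List.ofFn w) = ∑ k : Fin n, ∑ S ∈ (Finset.Iio k).powerset,
      (shuffleSign (fun i => (w i).1) k S *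
        ((∑ s ∈ S, (w s).1) * ldeg B + (ldeg A + ∑ s ∈ S, (w s).1)).negOnePow) •
        f (A ++ (((List.finRange n).filter (· ∈ S)).map w ++
          (ldeg (B ++ ((List.finRange n).filter (fun t => t < k ∧ t ∉ S)).map w) + (w k).1 + 1,
            f (B ++ ((List.finRange n).filter (fun t => t < k ∧ t ∉ S)).map w ++ [w k])) ::
          ((List.finRange n).filter (k < ·)).map w)) := by
  induction n generalizing A B with
  | zero => simp [shuf]
  | succ n ih =>
    have h0 : Finset.Iio (0 : Fin (n + 1)) = ∅ := by ext; simp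
    rw [List.ofFn_succ, shuf_cons, ih, ih, Fin.sum_univ_succ, h0, Finset.powerset_empty,
      Finset.sum_singleton, add_assoc]
    congr 1
    · simp [shuffleSign, List.filter_map_finRange_succ, List.ofFn_eq_map]
    · rw [Finset.smul_sum, ← Finset.sum_add_distrib]
      refine Finset.sum_congr rfl fun k _ => ?_
      rw [Fin.sum_powerset_Iio_succ, Finset.smul_sum]
      congr 1
      · refine Finset.sum_congr rfl fun S _ => ?_
        simp only [List.filter_map_finRange_succ, shuffleSign_map_succ, Finset.sum_map]
        simp only [ldeg_append, Int.negOnePow_add, mul_add]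
        simp [add_assoc, mul_assoc, mul_comm, mul_left_comm]
      · refine Finset.sum_congr rfl fun S _ => ?_
        rw [Finset.sum_insert (by simp)]
        simp only [List.filter_map_finRange_succ, shuffleSign_insert_zero, Finset.sum_map,
          smul_smul]
        simp [Int.negOnePow_add, add_mul]
        simp [mul_comm, mul_left_comm, mul_assoc]

end Sums

/-! ### Existence, functoriality and the Leibniz identity of the Kapranov brackets -/

section Kapranov

variable {K N P : Type*} [Field K] [AddCommGroup N] [Module K N] [AddCommGroup P] [Module K P]
  {𝒩 : ℤ → Submodule K N} {del : N →ₗ[K] N} {nab : N →ₗ[K] N →ₗ[K] N} {R : Brackets K N}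

theorem IsKapranov.isLeibnizInfinity (hR : IsKapranov 𝒩 del nab R)
    (hdel : ∀ n, ∀ x ∈ 𝒩 n, del x ∈ 𝒩 (n + 1))
    (hnab : ∀ n, ∀ x ∈ 𝒩 n, ∀ m, ∀ y ∈ 𝒩 m, nab x y ∈ 𝒩 (n + m))
    (hdd : ∀ x, del (del x) = 0) (hint : DirectSum.IsInternal 𝒩) : IsLeibnizInfinity 𝒩 R where
  internal := hint
  degree k hk deg v hv := by
    have hl : Homog 𝒩 (List.ofFn fun i => (deg i, v i)) := by
      intro x hx
      obtain ⟨i, rfl⟩ := (List.mem_ofFn' _ _).1 hx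
      exact hv i
    have := hR.evl_mem hdel hnab (l := List.ofFn fun i => (deg i, v i))
      (by rw [← List.length_pos_iff]; simp; omega) hl
    rw [Brackets.evl_ofFn] at this
    simpa [ldeg, List.map_ofFn, List.sum_ofFn] using this
  identity n _ deg v hv := by
    have hl : Homog 𝒩 (List.ofFn fun i => (deg i, v i)) := by
      intro x hx
      obtain ⟨i, rfl⟩ := (List.mem_ofFn' _ _).1 hx
      exact hv i
    have := hR.shuf_nil_nil_eq_zero hdel hnab hdd hl
    rw [shuf_ofFn] at this
    simpa [Brackets.evl, Function.comp_def] using this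

/-- The linear map on a graded vector space with prescribed restrictions to the graded parts. -/
def gradedLift (h : DirectSum.IsInternal 𝒩) (φ : ℤ → N →ₗ[K] P) : N →ₗ[K] P :=
  DirectSum.toModule K ℤ P (fun n => (φ n).domRestrict (𝒩 n)) ∘ₗ
    (LinearEquiv.ofBijective (DirectSum.coeLinearMap 𝒩) h).symm.toLinearMap

theorem gradedLift_apply (h : DirectSum.IsInternal 𝒩) (φ : ℤ → N →ₗ[K] P) {n : ℤ} {x : N}
    (hx : x ∈ 𝒩 n) : gradedLift h φ x = φ n x := by
  have : (LinearEquiv.ofBijective (DirectSum.coeLinearMap 𝒩) h).symm x =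
      DirectSum.lof K ℤ (fun n => 𝒩 n) n ⟨x, hx⟩ := by
    rw [LinearEquiv.symm_apply_eq]
    exact (DirectSum.coeLinearMap_lof 𝒩 n ⟨x, hx⟩).symm
  rw [gradedLift, LinearMap.comp_apply, LinearEquiv.coe_coe, this, DirectSum.toModule_lof,
    LinearMap.domRestrict_apply]

theorem LinearMap.ext_of_isInternal (h : DirectSum.IsInternal 𝒩) {f g : N →ₗ[K] P}
    (hfg : ∀ n, ∀ x ∈ 𝒩 n, f x = g x) : f = g := by
  have htop := ((DirectSum.isInternal_submodule_iff_iSupIndep_and_iSup_eq_top _).1 h).2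
  refine LinearMap.ext fun x => ?_
  have hx : x ∈ ⨆ n, 𝒩 n := htop ▸ Submodule.mem_top
  induction hx using Submodule.iSup_induction' with
  | mem n x hx => exact hfg n x hx
  | zero => simp
  | add x y _ _ hx hy => rw [map_add, map_add, hx, hy]

theorem MultilinearMap.ext_of_isInternal (h : DirectSum.IsInternal 𝒩) {k : ℕ}
    {f g : MultilinearMap K (fun _ : Fin k => N) P}
    (hfg : ∀ (deg : Fin k → ℤ) (v : Fin k → N), (∀ i, v i ∈ 𝒩 (deg i)) → f v = g v) : f = g := by
  induction k with
  | zero => exact MultilinearMap.ext fun v => hfg (fun _ => 0) v fun i => i.elim0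
  | succ k ih =>
    rw [← f.uncurry_curryLeft, ← g.uncurry_curryLeft]
    congr 1
    refine LinearMap.ext_of_isInternal h fun n x hx => ih fun deg v hv => ?_
    rw [MultilinearMap.curryLeft_apply, MultilinearMap.curryLeft_apply]
    refine hfg (Fin.cons n deg) _ fun i => ?_
    refine Fin.cases ?_ (fun i => ?_) i
    · simpa using hx
    · simpa using hv i

/-- The sum over `i` of the multilinear maps obtained from `f` by applying `D` to the `i`-th entry
and `s` to all entries before it. -/
def derOp {k : ℕ} (s : N →ₗ[K] N) (f : MultilinearMap K (fun _ : Fin k => N) N) :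
    (N →ₗ[K] N) →ₗ[K] MultilinearMap K (fun _ : Fin k => N) N :=
  ∑ i : Fin k, (LinearMap.applyₗ f).comp
    ((MultilinearMap.compLinearMapMultilinear (R := K) (M₁ := fun _ : Fin k => N)
      (M₁' := fun _ : Fin k => N) (M₂ := N)).toLinearMap
        (fun j => if j < i then s else LinearMap.id) i)

theorem derOp_apply {k : ℕ} (s D : N →ₗ[K] N) (f : MultilinearMap K (fun _ : Fin k => N) N)
    (v : Fin k → N) : derOp s f D v =
      ∑ i : Fin k, f (Function.update (fun j => if j < i then s (v j) else v j) i (D (v i))) := by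
  rw [derOp, LinearMap.sum_apply, sum_apply]
  refine Finset.sum_congr rfl fun i _ => ?_
  simp only [LinearMap.comp_apply, LinearMap.applyₗ_apply_apply, MultilinearMap.toLinearMap_apply,
    MultilinearMap.compLinearMapMultilinear_apply, MultilinearMap.compLinearMapₗ_apply,
    MultilinearMap.compLinearMap_apply]
  congr 1
  funext j
  by_cases hj : j = i
  · subst hj; simp
  · simp only [Function.update_of_ne hj]
    split_ifs <;> rfl

theorem MultilinearMap.map_update_units_smul {k : ℕ} (f : MultilinearMap K (fun _ : Fin k => N) N)
    (u : Fin k → ℤˣ) (v : Fin k → N) (T : Finset (Fin k)) :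
    f (fun j => if j ∈ T then u j • v j else v j) = (∏ j ∈ T, u j) • f v := by
  induction T using Finset.cons_induction with
  | empty => simp
  | cons a T ha ih =>
    have hc : ∀ (w : ℤˣ) (x : N), w • x = ((w : ℤ) : K) • x := fun w x => by
      rw [Units.smul_def, Int.cast_smul_eq_zsmul]
    have : (fun j => if j ∈ Finset.cons a T ha then u j • v j else v j) =
        Function.update (fun j => if j ∈ T then u j • v j else v j) a
          (((u a : ℤ) : K) • (fun j => if j ∈ T then u j • v j else v j) a) := by
      funext j
      by_cases hj : j = a
      · subst hj; simp [ha, hc]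
      · simp [hj]
    rw [this, MultilinearMap.map_update_smul, Function.update_eq_self, ih, Finset.prod_cons,
      ← hc, smul_smul]

theorem negOnePow_sum {ι : Type*} (T : Finset ι) (f : ι → ℤ) :
    (∑ s ∈ T, f s).negOnePow = ∏ s ∈ T, (f s).negOnePow := by
  induction T using Finset.cons_induction with
  | empty => rfl
  | cons a T ha ih => rw [Finset.sum_cons, Finset.prod_cons, Int.negOnePow_add, ih]

/-- The operator that multiplies elements of degree `m` by `(-1)^{n m}`. -/
def koszulOp (h : DirectSum.IsInternal 𝒩) (n : ℤ) : N →ₗ[K] N :=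
  gradedLift h fun m => ((((n * m).negOnePow : ℤˣ) : ℤ) : K) • LinearMap.id

theorem koszulOp_apply (h : DirectSum.IsInternal 𝒩) (n : ℤ) {m : ℤ} {x : N} (hx : x ∈ 𝒩 m) :
    koszulOp h n x = (n * m).negOnePow • x := by
  rw [koszulOp, gradedLift_apply h _ hx, LinearMap.smul_apply, LinearMap.id_apply, Units.smul_def,
    Int.cast_smul_eq_zsmul]

/-- Composition of a multilinear map with linear maps, as a linear function of the latter. -/
def postcomp {k : ℕ} (f : MultilinearMap K (fun _ : Fin k => N) N) :
    (N →ₗ[K] N) →ₗ[K] MultilinearMap K (fun _ : Fin k => N) N where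
  toFun g := g.compMultilinearMap f
  map_add' _ _ := rfl
  map_smul' _ _ := rfl

/-- The Kapranov brackets of a connection. -/
def kapranov (h : DirectSum.IsInternal 𝒩) (del : N →ₗ[K] N) (nab : N →ₗ[K] N →ₗ[K] N) :
    Brackets K N
  | 0 => 0
  | 1 => MultilinearMap.ofSubsingleton K _ _ 0 del
  | 2 => LinearMap.uncurryLeft
      ((MultilinearMap.ofSubsingletonₗ K K _ _ (0 : Fin 1)).toLinearMap ∘ₗ
        gradedLift h fun n => -(LinearMap.compRight K del ∘ₗ nab) + nab ∘ₗ del +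
          (((n.negOnePow : ℤˣ) : ℤ) : K) • (LinearMap.lcomp K N del ∘ₗ nab))
  | k + 3 => LinearMap.uncurryLeft (gradedLift h fun n =>
      (((n.negOnePow : ℤˣ) : ℤ) : K) •
        (postcomp (kapranov h del nab (k + 2)) ∘ₗ nab) -
        derOp (koszulOp h n) (kapranov h del nab (k + 2)) ∘ₗ nab)

/-- The signs in the recursion depend on the degree of the first entry, so the formula is linear
only degree by degree. `gradedLift` glues these linear maps, and `koszulOp` produces the signs from
the preceding entries. -/
theorem isKapranov_kapranov (h : DirectSum.IsInternal 𝒩) (del : N →ₗ[K] N)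
    (nab : N →ₗ[K] N →ₗ[K] N) : IsKapranov 𝒩 del nab (kapranov h del nab) where
  unary := by
    ext x
    simp [Brackets.unary, kapranov]
  binary n b hb e := by
    rw [kapranov, LinearMap.uncurryLeft_apply, LinearMap.comp_apply]
    change (gradedLift h _ b : N →ₗ[K] N) e = _
    rw [gradedLift_apply h _ hb]
    change -del (nab b e) + nab (del b) e + ((n.negOnePow : ℤ) : K) • nab b (del e) = _
    rw [Int.cast_smul_eq_zsmul, Units.smul_def]
  higher k hk n deg b₀ hb₀ b hb := by
    obtain ⟨k, rfl⟩ : ∃ m, k = m + 2 := ⟨k - 2, by omega⟩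
    rw [kapranov, LinearMap.uncurryLeft_apply, Fin.cons_zero, gradedLift_apply h _ hb₀]
    change ((n.negOnePow : ℤ) : K) • nab b₀ (kapranov h del nab (k + 2) b) -
      derOp (koszulOp h n) (kapranov h del nab (k + 2)) (nab b₀) b = _
    rw [Int.cast_smul_eq_zsmul, Units.smul_def, derOp_apply]
    congr 1
    refine Finset.sum_congr rfl fun i _ => ?_
    -- The Koszul sign is a product of one factor for each earlier entry. By multilinearity the
    -- factors can be moved onto the entries, which is how `derOp` contains them.
    rw [Finset.mul_sum, negOnePow_sum, ← MultilinearMap.map_update_units_smul]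
    congr 1
    funext j
    by_cases hj : j = i
    · subst hj; simp
    · simp only [Function.update_of_ne hj, Finset.mem_Iio, koszulOp_apply h n (hb j)]

/-- A map of graded vector spaces with connections preserves Kapranov brackets. -/
theorem IsKapranov.map_evl {N' : Type*} [AddCommGroup N'] [Module K N'] {𝒩' : ℤ → Submodule K N'}
    {del' : N' →ₗ[K] N'} {nab' : N' →ₗ[K] N' →ₗ[K] N'} {R' : Brackets K N'}
    (hR : IsKapranov 𝒩 del nab R) (hR' : IsKapranov 𝒩' del' nab' R') (j : N' →ₗ[K] N)
    (hj : ∀ n, ∀ x ∈ 𝒩' n, j x ∈ 𝒩 n) (hdel : ∀ x, del (j x) = j (del' x))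
    (hnab : ∀ x y, nab (j x) (j y) = j (nab' x y))
    (hmem : ∀ n, ∀ x ∈ 𝒩' n, ∀ m, ∀ y ∈ 𝒩' m, nab' x y ∈ 𝒩' (n + m))
    {l : List (ℤ × N')} (hl : l ≠ []) (h : Homog 𝒩' l) :
    R.evl (l.map (Prod.map id j)) = j (R'.evl l) := by
  have hder : ∀ (n : ℤ) (x : N') (f : List (ℤ × N) → N) (l : List (ℤ × N')),
      der n (nab (j x)) f (l.map (Prod.map id j)) =
        der n (nab' x) (fun l => f (l.map (Prod.map id j))) l := by
    intro n x f l
    induction l generalizing f with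
    | nil => rfl
    | cons y l ih =>
      rw [List.map_cons, der_cons, der_cons, ih]
      simp [hnab]
  obtain ⟨k, hk⟩ : ∃ k, l.length = k := ⟨_, rfl⟩
  induction k generalizing l with
  | zero => exact absurd (List.length_eq_zero_iff.1 hk) hl
  | succ k ih =>
    obtain ⟨x, l, rfl⟩ := List.exists_cons_of_ne_nil hl
    obtain ⟨hx, hl'⟩ := homog_cons.1 h
    by_cases h0 : l = []
    · subst h0
      rw [List.map_cons, List.map_nil, hR.evl_singleton, hR'.evl_singleton]
      exact hdel _
    have hk' : l.length = k := by simpa using hk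
    have hm : Homog 𝒩 (List.map (Prod.map id j) (x :: l)) := by
      intro y hy
      obtain ⟨z, hz, rfl⟩ := List.mem_map.1 hy
      exact hj _ _ (h z hz)
    rw [List.map_cons] at hm ⊢
    rw [hR.evl_cons (by simpa using h0) hm, hR'.evl_cons h0 h, ih h0 hl' hk']
    simp only [Prod.map_fst, Prod.map_snd, id_eq, map_add, map_sub, hder, hnab, Units.smul_def,
      map_zsmul]
    congr 1
    · congr 1
      rw [show j (der x.1 (nab' x.2) R'.evl l) = _ from
        map_der x.1 (nab' x.2) j.toAddMonoidHom R'.evl l]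
      refine der_congr (𝒩 := 𝒩') _ _ (hmem _ _ hx) hl' fun l' h1 _ h3 => ih ?_ h3 (h1.trans hk')
      rintro rfl
      exact h0 (List.length_eq_zero_iff.1 h1.symm)
    · match l with
      | [] => simp [single]
      | [y] => simp [single, hdel, hnab]
      | y :: z :: l => simp [single]

theorem IsKapranov.map_apply {N' : Type*} [AddCommGroup N'] [Module K N']
    {𝒩' : ℤ → Submodule K N'}
    {del' : N' →ₗ[K] N'} {nab' : N' →ₗ[K] N' →ₗ[K] N'} {R' : Brackets K N'}
    (hR : IsKapranov 𝒩 del nab R) (hR' : IsKapranov 𝒩' del' nab' R')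
    (hint : DirectSum.IsInternal 𝒩') (j : N' →ₗ[K] N)
    (hj : ∀ n, ∀ x ∈ 𝒩' n, j x ∈ 𝒩 n) (hdel : ∀ x, del (j x) = j (del' x))
    (hnab : ∀ x y, nab (j x) (j y) = j (nab' x y))
    (hmem : ∀ n, ∀ x ∈ 𝒩' n, ∀ m, ∀ y ∈ 𝒩' m, nab' x y ∈ 𝒩' (n + m)) {k : ℕ} (hk : 1 ≤ k)
    (v : Fin k → N') : R k (fun i => j (v i)) = j (R' k v) := by
  suffices (R k).compLinearMap (fun _ => j) = j.compMultilinearMap (R' k) from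
    congrArg (fun f => f v) this
  refine MultilinearMap.ext_of_isInternal hint fun deg v hv => ?_
  have := hR.map_evl hR' j hj hdel hnab hmem (l := List.ofFn fun i => (deg i, v i))
    (by rw [← List.length_pos_iff]; simp; omega) (by
      intro x hx
      obtain ⟨i, rfl⟩ := (List.mem_ofFn' _ _).1 hx
      exact hv i)
  rw [List.map_ofFn, Brackets.evl_ofFn, Brackets.evl_ofFn] at this
  exact this

end Kapranov

/-! ### Multilinearity of the Kapranov brackets -/

section Multilinear

variable {K A N : Type*} [Field K] [Ring A] [Algebra K A]
  [AddCommGroup N] [Module K N] [Module A N] [IsScalarTower K A N]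

/-- `nab` is a connection on the dg module `(N, 𝒩, del)` over `(A, 𝒜, d)`, where `N` acts on `A`
by derivations through a chain map `anc`. -/
structure IsConnection (𝒜 : ℤ → Submodule K A) (d : A →ₗ[K] A) (𝒩 : ℤ → Submodule K N)
    (del : N →ₗ[K] N) (nab : N →ₗ[K] N →ₗ[K] N) (anc : N → A → A) : Prop where
  mem : ∀ n, ∀ x ∈ 𝒩 n, ∀ m, ∀ y ∈ 𝒩 m, nab x y ∈ 𝒩 (n + m)
  anc_mem : ∀ n, ∀ x ∈ 𝒩 n, ∀ m, ∀ a ∈ 𝒜 m, anc x a ∈ 𝒜 (n + m)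
  smul_left : ∀ (a : A) x y, nab (a • x) y = a • nab x y
  smul_right : ∀ n, ∀ x ∈ 𝒩 n, ∀ m, ∀ a ∈ 𝒜 m, ∀ y,
    nab x (a • y) = anc x a • y + (n * m).negOnePow • (a • nab x y)
  anc_del : ∀ n, ∀ x ∈ 𝒩 n, ∀ a, anc (del x) a = d (anc x a) - n.negOnePow • anc x (d a)

variable {𝒜 : ℤ → Submodule K A} {d : A →ₗ[K] A} {𝒩 : ℤ → Submodule K N}
  {del : N →ₗ[K] N} {nab : N →ₗ[K] N →ₗ[K] N} {anc : N → A → A} {R : Brackets K N}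

theorem smul_units_smul (a : A) (u : ℤˣ) (x : N) : a • u • x = u • a • x := by
  rw [Units.smul_def, Units.smul_def, smul_comm]

theorem units_smul_smul (a : A) (u : ℤˣ) (x : N) : (u • a) • x = u • a • x := by
  rw [Units.smul_def, Units.smul_def, smul_assoc]

theorem map_units_smul {P Q : Type*} [AddCommGroup P] [AddCommGroup Q] (φ : P →+ Q) (u : ℤˣ)
    (x : P) : φ (u • x) = u • φ x := by
  rw [Units.smul_def, Units.smul_def, map_zsmul]

/-- A graded `A`-linear function of lists is compatible with the passage from `der p D` to
`der (m + p) (a D)`. -/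
theorem der_smul_left {f : List (ℤ × N) → N} {D : N → N} {a : A} {m p c : ℤ} {l : List (ℤ × N)}
    (h : ∀ l₁ z l₂, l = l₁ ++ z :: l₂ → f (l₁ ++ (m + p + z.1, a • D z.2) :: l₂) =
      (m * (c + ldeg l₁)).negOnePow • a • f (l₁ ++ (p + z.1, D z.2) :: l₂)) :
    der (m + p) (fun x => a • D x) f l = (m * c).negOnePow • a • der p D f l := by
  induction l generalizing f c with
  | nil => simp [der_nil]
  | cons x l ih =>
    have h0 := h [] x l rfl
    simp only [List.nil_append, ldeg_nil, add_zero] at h0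
    rw [der_cons, der_cons, h0, ih (f := fun l => f (x :: l)) (c := c + x.1)
      fun l₁ z l₂ hl => by
        have := h (x :: l₁) z l₂ (by rw [hl]; rfl)
        simpa [add_assoc] using this]
    rw [smul_add, smul_add, smul_units_smul, smul_smul, smul_smul, ← Int.negOnePow_add,
      ← Int.negOnePow_add]
    congr 1
    apply negOnePow_smul_congr
    push_cast
    grind

namespace IsKapranov

variable (hR : IsKapranov 𝒩 del nab R) (hM : IsDGModule 𝒜 d 𝒩 del)
  (hC : IsConnection 𝒜 d 𝒩 del nab anc)

include hR hM hC

/-- The two terms with `d a`, from `∂(a ∇_x y)` and from `∇_{∂(a x)} y`, cancel. -/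
theorem evl_smul_left_pair {m p : ℤ} {a : A} (ha : a ∈ 𝒜 m) {x : N} (hx : x ∈ 𝒩 p) {y : ℤ × N}
    (hy : y.2 ∈ 𝒩 y.1) :
    R.evl [(m + p, a • x), y] = m.negOnePow • a • R.evl [(p, x), y] := by
  rw [hR.evl_cons (by simp) (homog_cons.2 ⟨hM.smul_mem _ _ _ ha _ hx, homog_cons.2 ⟨hy, homog_nil⟩⟩),
    hR.evl_cons (by simp) (homog_cons.2 ⟨hx, homog_cons.2 ⟨hy, homog_nil⟩⟩)]
  simp only [der_singleton, hR.evl_singleton, single]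
  simp only [hC.smul_left, hM.del_smul _ _ ha, map_add, LinearMap.add_apply, smul_add, smul_sub,
    smul_units_smul]
  have : nab (m.negOnePow • a • del x) y.2 = m.negOnePow • a • nab (del x) y.2 := by
    simp only [Units.smul_def, map_zsmul, LinearMap.smul_apply, hC.smul_left]
  rw [this, Int.negOnePow_add, mul_smul]
  abel

/-- All terms in which `a` is differentiated cancel. For those with both `d` and the anchor applied
to `a`, this is the compatibility `anc_del` of the anchor with the differentials. -/
theorem evl_smul_right_pair {m p : ℤ} {a : A} (ha : a ∈ 𝒜 m) (hda : d a ∈ 𝒜 (m + 1))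
    {x : N} (hx : x ∈ 𝒩 p) {y : ℤ × N} (hy : y.2 ∈ 𝒩 y.1) :
    R.evl [y, (m + p, a • x)] = (m * (1 + y.1)).negOnePow • a • R.evl [y, (p, x)] := by
  rw [hR.evl_cons (by simp) (homog_cons.2 ⟨hy, homog_cons.2 ⟨hM.smul_mem _ _ _ ha _ hx, homog_nil⟩⟩),
    hR.evl_cons (by simp) (homog_cons.2 ⟨hy, homog_cons.2 ⟨hx, homog_nil⟩⟩)]
  simp only [der_singleton, hR.evl_singleton, single]
  have hy' := hM.del_mem _ _ hy
  have m1 := fun u x => map_units_smul (nab y.2).toAddMonoidHom u x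
  have m2 := fun u x => map_units_smul del.toAddMonoidHom u x
  simp only [LinearMap.toAddMonoidHom_coe] at m1 m2
  simp only [hC.smul_right _ _ hy _ _ ha, hC.smul_right _ _ hy' _ _ ha, hM.del_smul _ _ ha,
    hM.del_smul _ _ (hC.anc_mem _ _ hy _ _ ha), map_add, m1, m2,
    hC.smul_right _ _ hy _ _ hda, hC.anc_del _ _ hy, smul_add, smul_sub, sub_smul,
    smul_units_smul, units_smul_smul]
  simp only [mul_add, add_mul, mul_one, one_mul, Int.negOnePow_add, mul_comm m y.1]
  generalize d (anc y.2 a) • x = t1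
  generalize anc y.2 (d a) • x = t2
  generalize anc y.2 a • del x = t3
  generalize d a • nab y.2 x = t4
  generalize a • nab y.2 (del x) = t5
  generalize a • del (nab y.2 x) = t6
  generalize a • nab (del y.2) x = t7
  have sq : ∀ u : ℤˣ, (u : ℤ) * u = 1 := fun u => by
    rw [← Units.val_mul, Int.units_mul_self, Units.val_one]
  have s1 := sq y.1.negOnePow
  have s2 := sq m.negOnePow
  have s3 := sq (y.1 * m).negOnePow
  simp only [Units.smul_def, Units.val_mul]
  clear * - s1 s2 s3
  match_scalars <;> grind

/-- Induction on the number of other entries, starting from one: the unary bracket is a derivation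
and not linear. If `a • x` stands first, `∇_{a x} = a ∇_x` reduces the claim to linearity of the
shorter brackets. Otherwise `∇_y` produces a term with the anchor acting on `a`, once from the whole
bracket and once from the entry, and these cancel. -/
theorem evl_smul (hd : ∀ m, ∀ a ∈ 𝒜 m, d a ∈ 𝒜 (m + 1)) {m p : ℤ} {a : A} (ha : a ∈ 𝒜 m) {x : N} (hx : x ∈ 𝒩 p)
    {l₁ l₂ : List (ℤ × N)} (h₁ : Homog 𝒩 l₁) (h₂ : Homog 𝒩 l₂) (hlen : 1 ≤ l₁.length + l₂.length) :
    R.evl (l₁ ++ (m + p, a • x) :: l₂) =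
      (m * (1 + ldeg l₁)).negOnePow • a • R.evl (l₁ ++ (p, x) :: l₂) := by
  obtain ⟨k, hk⟩ : ∃ k, l₁.length + l₂.length = k + 1 := ⟨_, (Nat.sub_add_cancel hlen).symm⟩
  clear hlen
  induction k generalizing m p a x l₁ l₂ with
  | zero =>
    match l₁, l₂, hk with
    | [], [y], _ =>
      have := hR.evl_smul_left_pair hM hC ha hx (homog_cons.1 h₂).1
      simpa using this
    | [y], [], _ =>
      have := hR.evl_smul_right_pair hM hC ha (hd _ _ ha) hx (homog_cons.1 h₁).1
      simpa using this
    | _ :: _ :: _, _, h => simp at h; omega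
    | _ :: _, _ :: _, h => simp at h; omega
    | _, _ :: _ :: _, h => simp at h; omega
  | succ k ih =>
    have hax := hM.smul_mem _ _ _ ha _ hx
    match l₁ with
    | [] =>
      simp only [List.length_nil, zero_add] at hk
      have hne : l₂ ≠ [] := by rintro rfl; simp at hk
      have hs : ∀ φ : N → N, single φ l₂ = 0 := by
        intro φ
        match l₂, hk with
        | y :: z :: l, _ => rfl
      rw [List.nil_append, List.nil_append, hR.evl_cons hne (homog_cons.2 ⟨hax, h₂⟩),
        hR.evl_cons hne (homog_cons.2 ⟨hx, h₂⟩), hs, hs]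
      have : ⇑(nab (a • x)) = fun y => a • nab x y := funext fun y => hC.smul_left a x y
      simp only [this, ldeg_nil, add_zero, smul_sub, smul_units_smul, mul_one, Int.negOnePow_add,
        mul_smul]
      congr 1
      rw [der_smul_left (c := 1), mul_one]
      intro l₁' z l₂' hl
      subst hl
      obtain ⟨h3, h4⟩ := homog_append.1 h₂
      obtain ⟨h4, h5⟩ := homog_cons.1 h4
      have := ih ha (hC.mem _ _ hx _ _ h4) h3 h5 (by simp at hk; omega)
      rw [← this, ← add_assoc]
    | y :: l₁ =>
      obtain ⟨hy, h₁⟩ := homog_cons.1 h₁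
      have hk' : l₁.length + l₂.length = k + 1 := by simp at hk; omega
      have hs : ∀ (φ : N → N) (w : ℤ × N), single φ (l₁ ++ w :: l₂) = 0 := by
        intro φ w
        match l₁, l₂, hk' with
        | [], y :: l, _ => rfl
        | y :: l, _, _ => exact single_append_cons (by simp) _ _
      rw [List.cons_append, List.cons_append, hR.evl_cons (by simp)
        (homog_cons.2 ⟨hy, homog_append.2 ⟨h₁, homog_cons.2 ⟨hax, h₂⟩⟩⟩), hR.evl_cons (by simp)
        (homog_cons.2 ⟨hy, homog_append.2 ⟨h₁, homog_cons.2 ⟨hx, h₂⟩⟩⟩), hs, hs,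
        ih ha hx h₁ h₂ hk']
      have m1 := fun u x => map_units_smul (nab y.2).toAddMonoidHom u x
      simp only [LinearMap.toAddMonoidHom_coe] at m1
      rw [m1, hC.smul_right _ _ hy _ _ ha]
      simp only [der_append, der_cons]
      have e1 : der y.1 (nab y.2) (fun l => R.evl (l ++ (m + p, a • x) :: l₂)) l₁ =
          (m * (1 + (y.1 + ldeg l₁))).negOnePow • a •
            der y.1 (nab y.2) (fun l => R.evl (l ++ (p, x) :: l₂)) l₁ := by
        have := map_der y.1 (nab y.2) (DistribSMul.toAddMonoidHom N a)
          (fun l => R.evl (l ++ (p, x) :: l₂)) l₁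
        simp only [DistribSMul.toAddMonoidHom_apply] at this
        rw [this, ← der_smul]
        refine der_congr (𝒩 := 𝒩) _ _ (hC.mem _ _ hy) h₁ fun l' h1 h2 h3 => ?_
        rw [ih ha hx h3 h₂ (h1 ▸ hk'), h2]
      have e2 : der y.1 (nab y.2) (fun l => R.evl (l₁ ++ (m + p, a • x) :: l)) l₂ =
          (m * (1 + ldeg l₁)).negOnePow • a •
            der y.1 (nab y.2) (fun l => R.evl (l₁ ++ (p, x) :: l)) l₂ := by
        have := map_der y.1 (nab y.2) (DistribSMul.toAddMonoidHom N a)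
          (fun l => R.evl (l₁ ++ (p, x) :: l)) l₂
        simp only [DistribSMul.toAddMonoidHom_apply] at this
        rw [this, ← der_smul]
        exact der_congr (𝒩 := 𝒩) _ _ (hC.mem _ _ hy) h₂ fun l' h1 h2 h3 =>
          ih ha hx h₁ h3 (h1 ▸ hk')
      -- The anchor term here is to cancel the one from `∇_y` of the whole bracket. The shorter
      -- bracket is linear for the scalar `anc y a` as well, whose degree is `|y| + m`.
      have e3 : R.evl (l₁ ++ (y.1 + (m + p), nab y.2 (a • x)) :: l₂) =
          ((y.1 + m) * (1 + ldeg l₁)).negOnePow • anc y.2 a • R.evl (l₁ ++ (p, x) :: l₂) +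
          (y.1 * m).negOnePow • (m * (1 + ldeg l₁)).negOnePow • a •
            R.evl (l₁ ++ (y.1 + p, nab y.2 x) :: l₂) := by
        rw [← ih (hC.anc_mem _ _ hy _ _ ha) hx h₁ h₂ hk',
          ← ih ha (hC.mem _ _ hy _ _ hx) h₁ h₂ hk']
        simp only [Brackets.evl_slot]
        rw [hC.smul_right _ _ hy _ _ ha, map_add]
        congr 1
        exact map_units_smul (R.slot _ _).toAddMonoidHom _ _
      rw [e1, e2, e3]
      simp only [ldeg_cons, smul_add, smul_sub, smul_units_smul, add_zero]
      simp only [mul_add, add_mul, mul_one, Int.negOnePow_add, mul_comm m y.1]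
      generalize anc y.2 a • R.evl (l₁ ++ (p, x) :: l₂) = t1
      generalize a • nab y.2 (R.evl (l₁ ++ (p, x) :: l₂)) = t2
      generalize a • R.evl (l₁ ++ (y.1 + p, nab y.2 x) :: l₂) = t3
      generalize a • der y.1 (nab y.2) (fun l => R.evl (l ++ (p, x) :: l₂)) l₁ = t4
      generalize a • der y.1 (nab y.2) (fun l => R.evl (l₁ ++ (p, x) :: l)) l₂ = t5
      have sq : ∀ u : ℤˣ, (u : ℤ) * u = 1 := fun u => by
        rw [← Units.val_mul, Int.units_mul_self, Units.val_one]
      have s1 := sq y.1.negOnePow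
      have s2 := sq m.negOnePow
      have s3 := sq (y.1 * m).negOnePow
      have s4 := sq (m * ldeg l₁).negOnePow
      have s5 := sq (y.1 * ldeg l₁).negOnePow
      simp only [Units.smul_def, Units.val_mul]
      clear * - s1 s2 s3 s4 s5
      match_scalars <;> grind

theorem isLeibnizInfinityOver (hA : IsDGAlgebra 𝒜 d) :
    IsLeibnizInfinityOver 𝒜 d 𝒩 R where
  base := hA
  leibniz := hR.isLeibnizInfinity hM.del_mem hC.mem hM.del_del hM.internal
  dgModule := by rw [hR.unary]; exact hM
  multilinear k hk deg v hv i m a ha := by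
    have hl : Homog 𝒩 (List.ofFn fun j => (deg j, v j)) := by
      intro x hx
      obtain ⟨j, rfl⟩ := (List.mem_ofFn' _ _).1 hx
      exact hv j
    set w : Fin k → ℤ × N := fun j => (deg j, v j) with hw
    have hset : ∀ z, List.ofFn (Function.update w i z) =
        (List.ofFn w).take i ++ z :: (List.ofFn w).drop (i + 1) := by
      intro z
      have : List.ofFn (Function.update w i z) = (List.ofFn w).set i z := by
        refine List.ext_getElem (by simp) fun j h1 h2 => ?_
        simp only [List.getElem_ofFn, List.getElem_set, Function.update_apply, Fin.ext_iff,
          eq_comm (a := j)]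
      rw [this, List.set_eq_take_append_cons_drop, if_pos (by simp)]
    have hself : List.ofFn w = (List.ofFn w).take i ++ w i :: (List.ofFn w).drop (i + 1) := by
      conv_lhs => rw [← Function.update_eq_self i w, hset]
    have hdeg : ldeg ((List.ofFn w).take i) = ∑ j ∈ Finset.Iio i, deg j := by
      rw [ldeg, List.map_take, List.map_ofFn, List.sum_take_ofFn]
      exact Finset.sum_congr (by ext j; simp) fun _ _ => rfl
    have key := hR.evl_smul hM hC hA.d_mem ha (hv i) (l₁ := (List.ofFn w).take i)
      (l₂ := (List.ofFn w).drop (i + 1)) (fun x hx => hl x (List.mem_of_mem_take hx))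
      (fun x hx => hl x (List.mem_of_mem_drop hx)) (by simp; omega)
    rw [← hset, hdeg] at key
    have : R.evl (List.ofFn w) = R k v := Brackets.evl_ofFn _ _
    rw [← this, hself, ← key, Brackets.evl_ofFn]
    congr 1
    funext j
    by_cases hj : j = i
    · subst hj; simp
    · simp [hj, hw]

end IsKapranov

end Multilinear

/-! ### The Chevalley–Eilenberg algebra as a dg algebra -/

section CEAlgebra

variable {K g : Type*} [Field K] [LieRing g] [LieAlgebra K g]

theorem ce_induction {C : CE K g → Prop} (algebraMap : ∀ c : K, C (algebraMap K _ c))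
    (add : ∀ x y, C x → C y → C (x + y))
    (ι_mul : ∀ (ξ : Module.Dual K g) x, C x → C (ExteriorAlgebra.ι K ξ * x)) (x : CE K g) : C x :=
  CliffordAlgebra.left_induction (Q := (0 : QuadraticForm K (Module.Dual K g))) algebraMap add
    (fun x m h => ι_mul m x h) x

theorem algebraMap_mem_exteriorPower (c : K) :
    algebraMap K (CE K g) c ∈ ⋀[K]^0 (Module.Dual K g) := by
  rw [ExteriorAlgebra.exteriorPower, pow_zero]
  exact Submodule.mem_one.2 ⟨c, rfl⟩

theorem ι_mul_mem_exteriorPower (ξ : Module.Dual K g) {n : ℕ} {a : CE K g}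
    (ha : a ∈ ⋀[K]^n (Module.Dual K g)) :
    ExteriorAlgebra.ι K ξ * a ∈ ⋀[K]^(n + 1) (Module.Dual K g) := by
  rw [ExteriorAlgebra.exteriorPower, pow_succ']
  exact Submodule.mul_mem_mul ⟨ξ, rfl⟩ ha

theorem exteriorPower_induction
    {C : ∀ (n : ℕ) (x : CE K g), x ∈ ⋀[K]^n (Module.Dual K g) → Prop}
    (algebraMap : ∀ c : K, C 0 (algebraMap K _ c) (algebraMap_mem_exteriorPower c))
    (add : ∀ n x y hx hy, C n x hx → C n y hy → C n (x + y) (add_mem hx hy))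
    (ι_mul : ∀ n (ξ : Module.Dual K g) x (hx : x ∈ ⋀[K]^n (Module.Dual K g)), C n x hx →
      C (n + 1) (ExteriorAlgebra.ι K ξ * x) (ι_mul_mem_exteriorPower ξ hx)) {n : ℕ} {x : CE K g}
    (hx : x ∈ ⋀[K]^n (Module.Dual K g)) : C n x hx := by
  induction n generalizing x with
  | zero =>
    have hx' : x ∈ (1 : Submodule K (CE K g)) := by
      rwa [ExteriorAlgebra.exteriorPower, pow_zero] at hx
    obtain ⟨c, rfl⟩ := Submodule.mem_one.1 hx'
    exact algebraMap c
  | succ n ih =>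
    have h : ∃ h, C (n + 1) x h := by
      have hx' := hx
      rw [ExteriorAlgebra.exteriorPower, pow_succ'] at hx'
      clear hx
      induction hx' using Submodule.mul_induction_on' with
      | mem_mul_mem a ha b hb =>
        obtain ⟨ξ, rfl⟩ := ha
        exact ⟨_, ι_mul n ξ b hb (ih hb)⟩
      | add x _ y _ hx hy =>
        obtain ⟨hx, hx'⟩ := hx
        obtain ⟨hy, hy'⟩ := hy
        exact ⟨_, add _ _ _ hx hy hx' hy'⟩
    exact h.2

theorem mul_mem_exteriorPower {m n : ℕ} {a b : CE K g} (ha : a ∈ ⋀[K]^m (Module.Dual K g))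
    (hb : b ∈ ⋀[K]^n (Module.Dual K g)) : a * b ∈ ⋀[K]^(m + n) (Module.Dual K g) := by
  rw [ExteriorAlgebra.exteriorPower, pow_add]
  exact Submodule.mul_mem_mul ha hb

theorem ι_mem_exteriorPower (ξ : Module.Dual K g) :
    ExteriorAlgebra.ι K ξ ∈ ⋀[K]^1 (Module.Dual K g) := by
  rw [ExteriorAlgebra.exteriorPower, pow_one]
  exact ⟨ξ, rfl⟩

theorem parity_algebraMap (c : K) : parity K g (algebraMap K (CE K g) c) = algebraMap K _ c :=
  AlgHom.commutes _ c

theorem parity_one : parity K g 1 = 1 :=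
  map_one (CliffordAlgebra.involute (Q := (0 : QuadraticForm K (Module.Dual K g))))

theorem parity_mul (a b : CE K g) : parity K g (a * b) = parity K g a * parity K g b :=
  map_mul (CliffordAlgebra.involute (Q := (0 : QuadraticForm K (Module.Dual K g)))) a b

theorem parity_ι (ξ : Module.Dual K g) :
    parity K g (ExteriorAlgebra.ι K ξ) = -ExteriorAlgebra.ι K ξ :=
  CliffordAlgebra.involute_ι (Q := (0 : QuadraticForm K (Module.Dual K g))) ξ

theorem parity_parity (a : CE K g) : parity K g (parity K g a) = a :=
  CliffordAlgebra.involute_involute (Q := (0 : QuadraticForm K (Module.Dual K g))) a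

theorem parity_apply {n : ℕ} {a : CE K g} (ha : a ∈ ⋀[K]^n (Module.Dual K g)) :
    parity K g a = (n : ℤ).negOnePow • a := by
  induction ha using exteriorPower_induction with
  | algebraMap c => rw [parity_algebraMap]; simp
  | add n x y _ _ hx hy => rw [map_add, hx, hy, smul_add]
  | ι_mul n ξ x _ hx =>
    rw [parity_mul, parity_ι, hx]
    push_cast
    rw [Int.negOnePow_succ, Units.neg_smul, neg_mul, Units.smul_def, Units.smul_def, mul_smul_comm]

theorem ι_mul_eq (ξ : Module.Dual K g) (a : CE K g) :
    ExteriorAlgebra.ι K ξ * a = parity K g a * ExteriorAlgebra.ι K ξ := by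
  induction a using ce_induction with
  | algebraMap c => rw [parity_algebraMap, Algebra.commutes]
  | add x y hx hy => rw [map_add, mul_add, add_mul, hx, hy]
  | ι_mul η x hx =>
    rw [parity_mul, parity_ι, mul_assoc, ← hx, ← mul_assoc, ← mul_assoc, neg_mul,
      eq_neg_of_add_eq_zero_left (ExteriorAlgebra.ι_add_mul_swap ξ η)]

theorem mul_comm_exteriorPower {m n : ℕ} {a b : CE K g} (ha : a ∈ ⋀[K]^m (Module.Dual K g))
    (hb : b ∈ ⋀[K]^n (Module.Dual K g)) : a * b = ((m : ℤ) * n).negOnePow • (b * a) := by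
  induction ha using exteriorPower_induction with
  | algebraMap c => simp [Algebra.commutes]
  | add n x y _ _ hx hy => rw [add_mul, mul_add, hx, hy, smul_add]
  | ι_mul m ξ x _ hx =>
    rw [mul_assoc, hx, Units.smul_def, mul_smul_comm, ← mul_assoc, ι_mul_eq, parity_apply hb,
      ← Units.smul_def, Units.smul_def ((n : ℤ).negOnePow), smul_mul_assoc, smul_mul_assoc,
      ← Units.smul_def, smul_smul, mul_assoc]
    push_cast
    rw [add_mul, Int.negOnePow_add, one_mul]

/-- A linear map which is an odd derivation with respect to generators is an odd derivation. -/
theorem odd_derivation {D : CE K g →ₗ[K] CE K g} (h1 : D 1 = 0)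
    (h : ∀ ξ ω, D (ExteriorAlgebra.ι K ξ * ω) =
      D (ExteriorAlgebra.ι K ξ) * ω - ExteriorAlgebra.ι K ξ * D ω) (a b : CE K g) :
    D (a * b) = D a * b + parity K g a * D b := by
  induction a using ce_induction with
  | algebraMap c =>
    rw [parity_algebraMap, Algebra.algebraMap_eq_smul_one, map_smul, h1]
    simp
  | add x y hx hy => simp only [add_mul, map_add, hx, hy]; abel
  | ι_mul ξ x hx =>
    rw [mul_assoc, h, hx, h ξ x, parity_mul, parity_ι]
    noncomm_ring

/-- A derivation which vanishes on generators is zero. -/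
theorem eq_zero_of_derivation {T : CE K g →ₗ[K] CE K g} (h1 : T 1 = 0)
    (h : ∀ ξ ω, T ω = 0 → T (ExteriorAlgebra.ι K ξ * ω) = 0) (a : CE K g) : T a = 0 := by
  induction a using ce_induction with
  | algebraMap c => rw [Algebra.algebraMap_eq_smul_one, map_smul, h1, smul_zero]
  | add x y hx hy => rw [map_add, hx, hy, add_zero]
  | ι_mul ξ x hx => exact h ξ x hx

theorem interior_mul (x : g) (a b : CE K g) :
    interior K x (a * b) = interior K x a * b + parity K g a * interior K x b :=
  odd_derivation (interior_one x) (fun ξ ω => by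
    rw [interior_ι_mul, interior_ι, Algebra.smul_def]) a b

theorem interior_algebraMap (x : g) (c : K) : interior K x (algebraMap K (CE K g) c) = 0 := by
  rw [Algebra.algebraMap_eq_smul_one, map_smul, interior_one, smul_zero]

theorem interior_mem {n : ℕ} {a : CE K g} (x : g) (ha : a ∈ ⋀[K]^(n + 1) (Module.Dual K g)) :
    interior K x a ∈ ⋀[K]^n (Module.Dual K g) := by
  -- Degree `0` is treated together with positive degree: contracting `ξ ∧ a` for a scalar `a`
  -- requires `ι_x a = 0`.
  have : ∀ m, ∀ a ∈ ⋀[K]^m (Module.Dual K g), (m = 0 → interior K x a = 0) ∧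
      ∀ n, m = n + 1 → interior K x a ∈ ⋀[K]^n (Module.Dual K g) := by
    intro m a ha
    induction ha using exteriorPower_induction with
    | algebraMap c => exact ⟨fun _ => interior_algebraMap x c, by simp⟩
    | add n a b _ _ hx hy =>
      refine ⟨fun h => ?_, fun n h => ?_⟩
      · rw [map_add, hx.1 h, hy.1 h, add_zero]
      · rw [map_add]
        exact add_mem (hx.2 n h) (hy.2 n h)
    | ι_mul n ξ a ha hx =>
      refine ⟨by simp, fun n' h => ?_⟩
      obtain rfl : n = n' := by omega
      rw [interior_ι_mul]
      refine sub_mem (Submodule.smul_mem _ _ ha) ?_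
      cases n with
      | zero => rw [hx.1 rfl, mul_zero]; exact zero_mem _
      | succ n => exact ι_mul_mem_exteriorPower ξ (hx.2 n rfl)
  exact (this _ a ha).2 n rfl

theorem interior_exteriorPower_zero {a : CE K g} (x : g) (ha : a ∈ ⋀[K]^0 (Module.Dual K g)) :
    interior K x a = 0 := by
  rw [ExteriorAlgebra.exteriorPower, pow_zero] at ha
  obtain ⟨c, rfl⟩ := Submodule.mem_one.1 ha
  exact interior_algebraMap x c

theorem parity_interior (x : g) (a : CE K g) :
    parity K g (interior K x a) = -interior K x (parity K g a) := by
  induction a using ce_induction with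
  | algebraMap c => simp [parity_algebraMap, interior_algebraMap]
  | add x y hx hy => rw [map_add, map_add, map_add, map_add, hx, hy, neg_add]
  | ι_mul ξ x hx =>
    rw [parity_mul, parity_ι, neg_mul, map_neg, interior_ι_mul, interior_ι_mul, map_sub, map_smul,
      parity_mul, hx, parity_ι]
    noncomm_ring

theorem iSup_exteriorPower : ⨆ n : ℕ, ⋀[K]^n (Module.Dual K g) = (⊤ : Submodule K (CE K g)) := by
  refine eq_top_iff.2 fun a _ => ?_
  have hmem : ∀ a : CE K g, a ∈ ⨆ n : ℕ, ⋀[K]^n (Module.Dual K g) := by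
    intro a
    induction a using ce_induction with
    | algebraMap c => exact Submodule.mem_iSup_of_mem 0 (algebraMap_mem_exteriorPower c)
    | add x y hx hy => exact add_mem hx hy
    | ι_mul ξ x hx =>
      induction hx using Submodule.iSup_induction' with
      | mem n x hx => exact Submodule.mem_iSup_of_mem (n + 1) (ι_mul_mem_exteriorPower ξ hx)
      | zero => rw [mul_zero]; exact zero_mem _
      | add x y _ _ hx hy => rw [mul_add]; exact add_mem hx hy
  exact hmem a

theorem mem_ceGr {n : ℤ} {a : CE K g} : a ∈ ceGr K g n ↔
    a = 0 ∨ ∃ p : ℕ, n = p ∧ a ∈ ⋀[K]^p (Module.Dual K g) := by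
  unfold ceGr
  split_ifs with h
  · obtain ⟨p, rfl⟩ := Int.eq_ofNat_of_zero_le h
    simp only [Int.toNat_natCast, Nat.cast_inj]
    refine ⟨fun h => Or.inr ⟨p, rfl, h⟩, ?_⟩
    rintro (rfl | ⟨q, rfl, h⟩)
    · exact zero_mem _
    · exact h
  · rw [Submodule.mem_bot]
    refine ⟨Or.inl, ?_⟩
    rintro (h' | ⟨q, rfl, _⟩)
    · exact h'
    · exact absurd (Int.natCast_nonneg q) h

theorem natCast_mem_ceGr {p : ℕ} {a : CE K g} (ha : a ∈ ⋀[K]^p (Module.Dual K g)) :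
    a ∈ ceGr K g p := mem_ceGr.2 (Or.inr ⟨p, rfl, ha⟩)

variable [FiniteDimensional K g]

theorem dualVec_mem (i : Fin (Module.finrank K g)) :
    dualVec K g i ∈ ⋀[K]^1 (Module.Dual K g) := ι_mem_exteriorPower _

/-- The Euler operator, which multiplies elements of degree `n` by `n`. -/
def euler (K g : Type*) [Field K] [LieRing g] [LieAlgebra K g] [FiniteDimensional K g] :
    CE K g →ₗ[K] CE K g :=
  ∑ i, (LinearMap.mulLeft K (dualVec K g i)).comp (interior K (Module.finBasis K g i))

theorem euler_eq (a : CE K g) :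
    euler K g a = ∑ i, dualVec K g i * interior K (Module.finBasis K g i) a := by
  simp [euler, LinearMap.sum_apply]

theorem sum_smul_dualVec (ξ : Module.Dual K g) :
    ∑ i, ξ (Module.finBasis K g i) • dualVec K g i = ExteriorAlgebra.ι K ξ := by
  simp only [dualVec, ← map_smul, ← map_sum]
  congr 1
  refine (Module.finBasis K g).ext fun j => ?_
  simp

/-- Each further factor `ξ` contributes `∑ ξ(e_i) e^i = ξ` once. -/
theorem euler_apply {n : ℕ} {a : CE K g} (ha : a ∈ ⋀[K]^n (Module.Dual K g)) :
    euler K g a = (n : K) • a := by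
  induction ha using exteriorPower_induction with
  | algebraMap c => simp [euler_eq, interior_algebraMap]
  | add n x y _ _ hx hy => rw [map_add, hx, hy, smul_add]
  | ι_mul n ξ x _ hx =>
    rw [euler_eq] at hx ⊢
    have : ∀ i, dualVec K g i * (ExteriorAlgebra.ι K ξ * interior K (Module.finBasis K g i) x) =
        -(ExteriorAlgebra.ι K ξ * (dualVec K g i * interior K (Module.finBasis K g i) x)) := by
      intro i
      rw [← mul_assoc, ← mul_assoc, dualVec,
        eq_neg_of_add_eq_zero_left (ExteriorAlgebra.ι_add_mul_swap _ ξ), neg_mul]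
    simp only [interior_ι_mul, mul_sub, this, Finset.sum_sub_distrib, Finset.sum_neg_distrib,
      ← Finset.mul_sum, hx]
    rw [sub_neg_eq_add, mul_smul_comm]
    simp only [mul_smul_comm, ← smul_mul_assoc]
    rw [← Finset.sum_mul, sum_smul_dualVec]
    push_cast
    rw [add_smul, one_smul, add_mul, add_comm]

/-- The Euler operator recovers `(n + 1) a` from the contractions of `a`, and `n + 1` is invertible
in characteristic zero. -/
theorem eq_zero_of_interior [CharZero K] {n : ℕ} {a : CE K g}
    (ha : a ∈ ⋀[K]^(n + 1) (Module.Dual K g)) (h : ∀ x, interior K x a = 0) : a = 0 := by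
  have := euler_apply ha
  rw [euler_eq] at this
  simp only [h, mul_zero, Finset.sum_const_zero] at this
  exact (smul_eq_zero.1 this.symm).resolve_left (Nat.cast_ne_zero.2 (Nat.succ_ne_zero n))

theorem ceDiff_mul (a b : CE K g) :
    ceDiff K g (a * b) = ceDiff K g a * b + parity K g a * ceDiff K g b :=
  odd_derivation ceDiff_one ceDiff_ι_mul a b

theorem ceDiff_algebraMap (c : K) : ceDiff K g (algebraMap K (CE K g) c) = 0 := by
  rw [Algebra.algebraMap_eq_smul_one, map_smul, ceDiff_one, smul_zero]

theorem ceDiff_mem {n : ℕ} {a : CE K g} (ha : a ∈ ⋀[K]^n (Module.Dual K g)) :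
    ceDiff K g a ∈ ⋀[K]^(n + 1) (Module.Dual K g) := by
  rw [ceDiff_apply]
  refine neg_mem (Submodule.smul_mem _ _ (sum_mem fun i _ => sum_mem fun j _ => ?_))
  cases n with
  | zero => rw [interior_exteriorPower_zero _ ha, mul_zero]; exact zero_mem _
  | succ n =>
    have := mul_mem_exteriorPower (mul_mem_exteriorPower (dualVec_mem i) (dualVec_mem j))
      (interior_mem ⁅Module.finBasis K g i, Module.finBasis K g j⁆ ha)
    rwa [show 1 + 1 + n = n + 1 + 1 by ring] at this

/-- The Lie derivative of forms. -/
def lieDer (x : g) : CE K g →ₗ[K] CE K g :=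
  ceDiff K g ∘ₗ interior K x + interior K x ∘ₗ ceDiff K g

theorem lieDer_apply (x : g) (a : CE K g) :
    lieDer x a = ceDiff K g (interior K x a) + interior K x (ceDiff K g a) := rfl

theorem parity_ceDiff (a : CE K g) : parity K g (ceDiff K g a) = -ceDiff K g (parity K g a) := by
  have h2 : ∀ i j, parity K g (dualVec K g i * dualVec K g j) = dualVec K g i * dualVec K g j := by
    intro i j
    rw [parity_mul, dualVec, dualVec, parity_ι, parity_ι, neg_mul_neg]
  rw [ceDiff_apply, ceDiff_apply, map_neg, map_smul, map_sum, neg_neg]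
  simp only [map_sum, parity_mul _ (interior K _ _), h2, parity_interior, mul_neg,
    Finset.sum_neg_distrib, smul_neg, neg_neg]

theorem lieDer_mul (x : g) (a b : CE K g) :
    lieDer x (a * b) = lieDer x a * b + a * lieDer x b := by
  simp only [lieDer_apply, interior_mul, ceDiff_mul, map_add, parity_parity, parity_interior,
    parity_ceDiff]
  noncomm_ring

theorem lieDer_algebraMap (x : g) (c : K) : lieDer x (algebraMap K (CE K g) c) = 0 := by
  rw [lieDer_apply, interior_algebraMap, ceDiff_algebraMap, map_zero, map_zero, add_zero]

theorem lieDer_one (x : g) : lieDer x (1 : CE K g) = 0 := by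
  rw [← map_one (algebraMap K (CE K g)), lieDer_algebraMap]

theorem lieDer_ι [CharZero K] (x : g) (ξ : Module.Dual K g) :
    lieDer x (ExteriorAlgebra.ι K ξ) =
      ExteriorAlgebra.ι K (-(ξ ∘ₗ (LieAlgebra.ad K g x : g →ₗ[K] g))) := by
  have h := interior_mem x (ceDiff_mem (ι_mem_exteriorPower ξ))
  rw [ExteriorAlgebra.exteriorPower, pow_one] at h
  obtain ⟨η, hη⟩ := h
  rw [lieDer_apply, interior_ι, ceDiff_algebraMap, zero_add, ← hη]
  congr 1
  ext y
  have := ceDiff_ι ξ x y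
  rw [← hη, interior_ι] at this
  simpa using FaithfulSMul.algebraMap_injective K (CE K g) this

theorem interior_ceDiff_ι [CharZero K] (x : g) (ξ : Module.Dual K g) :
    interior K x (ceDiff K g (ExteriorAlgebra.ι K ξ)) = lieDer x (ExteriorAlgebra.ι K ξ) := by
  rw [lieDer_apply, interior_ι, ceDiff_algebraMap, zero_add]

/-- Cartan's formula `[L_x, ι_y] = ι_{[x, y]}`. Both sides are odd derivations, so the generators
decide. -/
theorem lieDer_interior [CharZero K] (x y : g) (a : CE K g) :
    lieDer x (interior K y a) = interior K y (lieDer x a) + interior K ⁅x, y⁆ a := by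
  have := eq_zero_of_derivation
    (T := lieDer x ∘ₗ interior K y - interior K y ∘ₗ lieDer x - interior K ⁅x, y⁆)
    (by simp [interior_one, lieDer_one]) (fun ξ ω h => by
      simp only [LinearMap.sub_apply, LinearMap.comp_apply] at h ⊢
      have hω : lieDer x (interior K y ω) = interior K y (lieDer x ω) + interior K ⁅x, y⁆ ω := by
        rw [sub_sub, sub_eq_zero] at h; exact h
      rw [interior_ι_mul, lieDer_mul, map_sub, map_smul, lieDer_mul, map_add, interior_ι_mul,
        lieDer_ι, interior_ι_mul, interior_ι_mul, hω]
      rw [LinearMap.neg_apply, LinearMap.comp_apply, LieAlgebra.ad_apply, neg_smul, mul_add]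
      abel) a
  simp only [LinearMap.sub_apply, LinearMap.comp_apply, sub_sub, sub_eq_zero] at this
  exact this

/-- The square of an odd derivation is a derivation, so it suffices to treat a generator `ξ`. The
form `d²ξ` has degree `3` and is detected by two contractions, which Cartan's formulas turn into a
`1`-form vanishing by the Jacobi identity. -/
theorem ceDiff_ceDiff [CharZero K] (a : CE K g) : ceDiff K g (ceDiff K g a) = 0 := by
  have hgen : ∀ ξ : Module.Dual K g, ceDiff K g (ceDiff K g (ExteriorAlgebra.ι K ξ)) = 0 := by
    intro ξ
    have h3 := ceDiff_mem (ceDiff_mem (ι_mem_exteriorPower ξ))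
    refine eq_zero_of_interior h3 fun x => eq_zero_of_interior (interior_mem x h3) fun y => ?_
    have h1 : interior K x (ceDiff K g (ceDiff K g (ExteriorAlgebra.ι K ξ))) =
        lieDer x (ceDiff K g (ExteriorAlgebra.ι K ξ)) -
          ceDiff K g (lieDer x (ExteriorAlgebra.ι K ξ)) := by
      rw [lieDer_apply, interior_ceDiff_ι]; abel
    rw [h1, map_sub, eq_sub_of_add_eq (lieDer_interior x y _).symm, interior_ceDiff_ι,
      interior_ceDiff_ι, lieDer_ι x, interior_ceDiff_ι, lieDer_ι y, lieDer_ι, lieDer_ι, lieDer_ι,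
      ← map_sub, ← map_sub, ← map_zero (ExteriorAlgebra.ι K)]
    congr 1
    ext z
    simp only [LinearMap.sub_apply, LinearMap.neg_apply, LinearMap.comp_apply, LieAlgebra.ad_apply,
      LinearMap.zero_apply, lie_lie, map_sub]
    ring
  refine eq_zero_of_derivation (T := ceDiff K g ∘ₗ ceDiff K g) ?_ (fun ξ ω h => ?_) a
  · rw [LinearMap.comp_apply, ceDiff_one, map_zero]
  · rw [LinearMap.comp_apply] at h ⊢
    rw [ceDiff_ι_mul, map_sub, ceDiff_ι_mul, ceDiff_mul, hgen, h, parity_ceDiff, parity_ι, map_neg,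
      neg_neg]
    simp

/-- Both sides are derivations with value `-ξ ∘ ad_x` on `ξ`. In this form the Lie derivative
matches the sum in the differential of `η ⊗ x`. -/
theorem lieDer_eq_sum [CharZero K] (x : g) (a : CE K g) :
    lieDer x a = ∑ i, dualVec K g i * interior K ⁅Module.finBasis K g i, x⁆ a := by
  have := eq_zero_of_derivation
    (T := lieDer x - ∑ i, (LinearMap.mulLeft K (dualVec K g i)).comp
      (interior K ⁅Module.finBasis K g i, x⁆)) (by
      simp [interior_one, lieDer_one, LinearMap.sum_apply])
    (fun ξ ω h => by
      simp only [LinearMap.sub_apply, LinearMap.sum_apply, LinearMap.comp_apply,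
        LinearMap.mulLeft_apply, sub_eq_zero] at h ⊢
      have hs : ∀ i, dualVec K g i *
          (ExteriorAlgebra.ι K ξ * interior K ⁅Module.finBasis K g i, x⁆ ω) =
          -(ExteriorAlgebra.ι K ξ * (dualVec K g i *
            interior K ⁅Module.finBasis K g i, x⁆ ω)) := by
        intro i
        rw [← mul_assoc, ← mul_assoc, dualVec,
          eq_neg_of_add_eq_zero_left (ExteriorAlgebra.ι_add_mul_swap _ ξ), neg_mul]
      have hc : ∀ i, (-(ξ ∘ₗ (LieAlgebra.ad K g x : g →ₗ[K] g))) (Module.finBasis K g i) =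
          ξ ⁅Module.finBasis K g i, x⁆ := fun i => by
        rw [LinearMap.neg_apply, LinearMap.comp_apply, LieAlgebra.ad_apply, ← map_neg, lie_skew]
      simp only [interior_ι_mul, mul_sub, hs, sub_neg_eq_add, Finset.sum_add_distrib]
      rw [← Finset.mul_sum, ← h, lieDer_mul, lieDer_ι, ← sum_smul_dualVec, Finset.sum_mul]
      simp only [hc, smul_mul_assoc, mul_smul_comm]) a
  simpa [LinearMap.sum_apply, sub_eq_zero] using this

/-- Subspaces on which an operator acts by pairwise distinct integers form a grading. -/
theorem isInternal_of_eigenvalues [CharZero K] {N : Type*} [AddCommGroup N] [Module K N]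
    {𝒩 : ℤ → Submodule K N} (E : N →ₗ[K] N) (hE : ∀ n, ∀ x ∈ 𝒩 n, E x = (n : K) • x)
    (htop : ⨆ n, 𝒩 n = ⊤) : DirectSum.IsInternal 𝒩 := by
  refine (DirectSum.isInternal_submodule_iff_iSupIndep_and_iSup_eq_top _).2 ⟨?_, htop⟩
  have := (Module.End.eigenspaces_iSupIndep E).comp (f := fun n : ℤ => (n : K))
    Int.cast_injective
  exact this.mono fun n x hx => Module.End.mem_eigenspace_iff.2 (hE n x hx)

theorem isDGAlgebra_ce [CharZero K] : IsDGAlgebra (ceGr K g) (ceDiff K g) where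
  internal := by
    -- The degree is an eigenvalue of the Euler operator, and distinct integers stay distinct in
    -- characteristic zero.
    refine isInternal_of_eigenvalues (euler K g) ?_ ?_
    · intro n x hx
      obtain rfl | ⟨p, rfl, hx⟩ := mem_ceGr.1 hx
      · simp
      · rw [euler_apply hx]; simp
    · refine top_le_iff.1 (iSup_exteriorPower (K := K) (g := g) ▸ iSup_le fun p => ?_)
      exact le_iSup_of_le (p : ℤ) fun x hx => natCast_mem_ceGr hx
  one_mem := natCast_mem_ceGr (p := 0) (by
    have := algebraMap_mem_exteriorPower (K := K) (g := g) 1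
    rwa [map_one] at this)
  mul_mem m n a ha b hb := by
    obtain rfl | ⟨p, rfl, ha⟩ := mem_ceGr.1 ha
    · simp
    obtain rfl | ⟨q, rfl, hb⟩ := mem_ceGr.1 hb
    · simp
    exact_mod_cast natCast_mem_ceGr (mul_mem_exteriorPower ha hb)
  mul_comm m n a ha b hb := by
    obtain rfl | ⟨p, rfl, ha⟩ := mem_ceGr.1 ha
    · simp
    obtain rfl | ⟨q, rfl, hb⟩ := mem_ceGr.1 hb
    · simp
    exact mul_comm_exteriorPower ha hb
  d_mem n a ha := by
    obtain rfl | ⟨p, rfl, ha⟩ := mem_ceGr.1 ha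
    · simp
    exact_mod_cast natCast_mem_ceGr (ceDiff_mem ha)
  d_mul m a ha b := by
    obtain rfl | ⟨p, rfl, ha'⟩ := mem_ceGr.1 ha
    · simp
    rw [ceDiff_mul, parity_apply ha', Units.smul_def, Units.smul_def, smul_mul_assoc]
  d_d := ceDiff_ceDiff

end CEAlgebra

/-! ### The dg module of forms with values in a dg `g`-module -/

section DGModules

variable {K g M : Type*} [Field K] [LieRing g] [LieAlgebra K g]
  [AddCommGroup M] [Module K M] [LieRingModule g M] [LieModule K g M]

namespace DGLieModule

variable (V : DGLieModule K g M)

theorem tmul_mem_omegaGr {p : ℕ} {q n : ℤ} {ω : CE K g} {v : M}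
    (hω : ω ∈ ⋀[K]^p (Module.Dual K g)) (hv : v ∈ V.gr q) (h : p + q = n) :
    ω ⊗ₜ[K] v ∈ V.omegaGr n := by
  obtain rfl : q = n - p := by omega
  exact Submodule.mem_iSup_of_mem p (Submodule.apply_mem_map₂ _ hω hv)

theorem omegaGr_le {n : ℤ} {S : Submodule K (CE K g ⊗[K] M)}
    (h : ∀ (p : ℕ) (q : ℤ), p + q = n → ∀ ω ∈ ⋀[K]^p (Module.Dual K g), ∀ v ∈ V.gr q,
      ω ⊗ₜ[K] v ∈ S) : V.omegaGr n ≤ S :=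
  iSup_le fun p => Submodule.map₂_le.2 fun ω hω v hv => h p (n - p) (by omega) ω hω v hv

theorem map_mem_of_tmul {n : ℤ} {P : Type*} [AddCommGroup P] [Module K P] {S : Submodule K P}
    (f : CE K g ⊗[K] M →ₗ[K] P)
    (h : ∀ (p : ℕ) (q : ℤ), p + q = n → ∀ ω ∈ ⋀[K]^p (Module.Dual K g), ∀ v ∈ V.gr q,
      f (ω ⊗ₜ[K] v) ∈ S) {x : CE K g ⊗[K] M} (hx : x ∈ V.omegaGr n) : f x ∈ S :=
  V.omegaGr_le (S := S.comap f) h hx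

theorem eq_of_tmul {n : ℤ} {P : Type*} [AddCommGroup P] [Module K P]
    (f f' : CE K g ⊗[K] M →ₗ[K] P)
    (h : ∀ (p : ℕ) (q : ℤ), p + q = n → ∀ ω ∈ ⋀[K]^p (Module.Dual K g), ∀ v ∈ V.gr q,
      f (ω ⊗ₜ[K] v) = f' (ω ⊗ₜ[K] v)) {x : CE K g ⊗[K] M} (hx : x ∈ V.omegaGr n) : f x = f' x :=
  V.omegaGr_le (S := LinearMap.eqLocus f f') h hx

theorem iSup_gr : ⨆ i, (V.gr i).toSubmodule = ⊤ :=
  ((DirectSum.isInternal_submodule_iff_iSupIndep_and_iSup_eq_top _).1 V.internal).2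

theorem iSup_omegaGr : ⨆ n, V.omegaGr n = ⊤ := by
  refine eq_top_iff.2 fun x _ => ?_
  have key : Submodule.map₂ (TensorProduct.mk K (CE K g) M) (⨆ n : ℕ, ⋀[K]^n (Module.Dual K g))
      (⨆ i, (V.gr i).toSubmodule) ≤ ⨆ n, V.omegaGr n := by
    rw [Submodule.map₂_iSup_left]
    refine iSup_le fun p => ?_
    rw [Submodule.map₂_iSup_right]
    refine iSup_le fun q => Submodule.map₂_le.2 fun ω hω v hv => ?_
    exact Submodule.mem_iSup_of_mem (p + q) (V.tmul_mem_omegaGr hω hv rfl)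
  rw [iSup_exteriorPower, iSup_gr, TensorProduct.map₂_mk_top_top_eq_top] at key
  exact key Submodule.mem_top

theorem smul_mem_omegaGr {m n : ℤ} {a : CE K g} (ha : a ∈ ceGr K g m) {x : CE K g ⊗[K] M}
    (hx : x ∈ V.omegaGr n) : a • x ∈ V.omegaGr (m + n) := by
  obtain rfl | ⟨r, rfl, ha'⟩ := mem_ceGr.1 ha
  · rw [zero_smul]; exact zero_mem _
  · refine V.map_mem_of_tmul (Algebra.lsmul K K (CE K g ⊗[K] M) a)
      (fun p q h ω hω v hv => ?_) hx
    change a • ω ⊗ₜ[K] v ∈ _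
    rw [TensorProduct.smul_tmul', smul_eq_mul]
    exact V.tmul_mem_omegaGr (mul_mem_exteriorPower ha' hω) hv (by push_cast; omega)

variable [FiniteDimensional K g]

theorem ofModule_dtot (x : CE K g ⊗[K] M) :
    (ofModule K g M).dtot x = ceDiffMod K g M x := by
  have : (ofModule K g M).d.toLinearMap = 0 := rfl
  rw [dtot, this, TensorProduct.map_zero_right, add_zero]

/-- The total degree is the eigenvalue of the sum of two operators, one counting the degree of the
form and one the degree in `M`. -/
theorem isInternal_omegaGr [CharZero K] : DirectSum.IsInternal V.omegaGr := by
  refine isInternal_of_eigenvalues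
    ((euler K g).rTensor M + (gradedLift V.internal fun n : ℤ => (n : K) • LinearMap.id).lTensor _)
    (fun n x hx => ?_) V.iSup_omegaGr
  refine V.eq_of_tmul _ ((n : K) • LinearMap.id) (fun p q h ω hω v hv => ?_) hx
  rw [LinearMap.add_apply, LinearMap.rTensor_tmul, LinearMap.lTensor_tmul, euler_apply hω,
    gradedLift_apply V.internal _ hv, LinearMap.smul_apply, LinearMap.id_apply,
    LinearMap.smul_apply, LinearMap.id_apply, ← h, TensorProduct.tmul_smul,
    ← TensorProduct.smul_tmul', Int.cast_add, Int.cast_natCast, add_smul]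

end DGLieModule

variable [FiniteDimensional K g]

theorem ceDiffMod_tmul (ω : CE K g) (v : M) : ceDiffMod K g M (ω ⊗ₜ v) =
    ceDiff K g ω ⊗ₜ v + ∑ i, (dualVec K g i * ω) ⊗ₜ ⁅Module.finBasis K g i, v⁆ := by
  simp [ceDiffMod, LinearMap.sum_apply]

theorem dualVec_mul_eq (i : Fin (Module.finrank K g)) (a : CE K g) :
    dualVec K g i * a = parity K g a * dualVec K g i := ι_mul_eq _ _

theorem ceDiffMod_smul (a : CE K g) (x : CE K g ⊗[K] M) :
    ceDiffMod K g M (a • x) = ceDiff K g a • x + parity K g a • ceDiffMod K g M x := by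
  induction x using TensorProduct.induction_on with
  | zero => simp
  | tmul ω v =>
    simp only [ceDiffMod_tmul, TensorProduct.smul_tmul', smul_eq_mul, smul_add, Finset.smul_sum,
      ceDiff_mul, TensorProduct.add_tmul, ← mul_assoc, dualVec_mul_eq _ a, add_assoc]
  | add x y hx hy => rw [smul_add, map_add, hx, hy, map_add, smul_add, smul_add]; abel

theorem ceDiff_dualVec (i : Fin (Module.finrank K g)) : ceDiff K g (dualVec K g i) =
    -((2 : K)⁻¹ • ∑ j, ∑ k, (Module.finBasis K g).coord i
      ⁅Module.finBasis K g j, Module.finBasis K g k⁆ • (dualVec K g j * dualVec K g k)) := by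
  simp only [ceDiff_apply, dualVec, interior_ι, Algebra.algebraMap_eq_smul_one, mul_smul_comm,
    mul_one]

theorem sum_coord_tmul {ι A : Type*} [Fintype ι] [AddCommGroup A] [Module K A]
    (b : Module.Basis ι K g) (c : ι → ι → A) (v : M) :
    ∑ i, (∑ j, ∑ k, b.coord i ⁅b j, b k⁆ • c j k) ⊗ₜ[K] ⁅b i, v⁆ =
      ∑ j, ∑ k, c j k ⊗ₜ[K] ⁅⁅b j, b k⁆, v⁆ := by
  have : ∀ y : g, ⁅y, v⁆ = ∑ i, b.coord i y • ⁅b i, v⁆ := by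
    intro y
    conv_lhs => rw [← b.sum_repr y, sum_lie]
    simp
  conv_rhs => simp only [this ⁅b _, b _⁆]
  simp only [TensorProduct.sum_tmul, TensorProduct.tmul_sum, TensorProduct.smul_tmul]
  rw [Finset.sum_comm]
  refine Finset.sum_congr rfl fun j _ => ?_
  rw [Finset.sum_comm]

/-- Antisymmetry of `c` pairs the two orders of the action into a commutator. The resulting factor
`1/2` is the one in `ceDiff`. -/
theorem sum_tmul_lie_lie [CharZero K] {ι A : Type*} [Fintype ι] [AddCommGroup A] [Module K A]
    (b : ι → g) (c : ι → ι → A) (hc : ∀ j k, c k j = -c j k) (v : M) :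
    ∑ i, ∑ j, c j i ⊗ₜ[K] ⁅b j, ⁅b i, v⁆⁆ =
      (2 : K)⁻¹ • ∑ j, ∑ k, c j k ⊗ₜ[K] ⁅⁅b j, b k⁆, v⁆ := by
  rw [eq_inv_smul_iff₀ two_ne_zero, two_smul]
  nth_rewrite 1 [Finset.sum_comm]
  rw [← Finset.sum_add_distrib]
  refine Finset.sum_congr rfl fun j _ => ?_
  rw [← Finset.sum_add_distrib]
  refine Finset.sum_congr rfl fun k _ => ?_
  rw [hc j k, TensorProduct.neg_tmul, ← sub_eq_add_neg, ← TensorProduct.tmul_sub, lie_lie]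

theorem ceDiffMod_one_tmul (v : M) : ceDiffMod K g M (1 ⊗ₜ v) =
    ∑ i, dualVec K g i ⊗ₜ ⁅Module.finBasis K g i, v⁆ := by
  simp [ceDiffMod_tmul, ceDiff_one]

/-- The structure constants in `d e^i` cancel the commutators from acting twice: flatness of the
module structure. -/
theorem ceDiffMod_ceDiffMod_one [CharZero K] (v : M) :
    ceDiffMod K g M (ceDiffMod K g M (1 ⊗ₜ v)) = 0 := by
  rw [ceDiffMod_one_tmul, map_sum]
  simp only [ceDiffMod_tmul, Finset.sum_add_distrib]
  rw [sum_tmul_lie_lie (Module.finBasis K g) (fun j k => dualVec K g j * dualVec K g k)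
    (fun j k => eq_neg_of_add_eq_zero_left (ExteriorAlgebra.ι_add_mul_swap _ _))]
  simp only [ceDiff_dualVec, TensorProduct.neg_tmul, ← TensorProduct.smul_tmul',
    Finset.sum_neg_distrib, ← Finset.smul_sum]
  rw [sum_coord_tmul (Module.finBasis K g) (fun j k => dualVec K g j * dualVec K g k),
    neg_add_cancel]

theorem tmul_eq_smul (ω : CE K g) (v : M) : ω ⊗ₜ[K] v = ω • ((1 : CE K g) ⊗ₜ[K] v) := by
  rw [TensorProduct.smul_tmul', smul_eq_mul, mul_one]

theorem ceDiffMod_ceDiffMod [CharZero K] (x : CE K g ⊗[K] M) :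
    ceDiffMod K g M (ceDiffMod K g M x) = 0 := by
  induction x using TensorProduct.induction_on with
  | zero => simp
  | tmul ω v =>
    rw [tmul_eq_smul, ceDiffMod_smul, map_add, ceDiffMod_smul, ceDiffMod_smul, ceDiff_ceDiff,
      ceDiffMod_ceDiffMod_one, parity_ceDiff, zero_smul, smul_zero, zero_add, add_zero, ← add_smul]
    exact (congrArg (· • ceDiffMod K g M ((1 : CE K g) ⊗ₜ[K] v))
      (neg_add_cancel (ceDiff K g (parity K g ω)))).trans (zero_smul _ _)
  | add x y hx hy => rw [map_add, map_add, hx, hy, add_zero]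

theorem baseChange_ceDiffMod {M' : Type*} [AddCommGroup M'] [Module K M'] [LieRingModule g M']
    [LieModule K g M'] (f : M →ₗ[K] M') (hf : ∀ (x : g) v, f ⁅x, v⁆ = ⁅x, f v⁆)
    (x : CE K g ⊗[K] M) :
    f.baseChange (CE K g) (ceDiffMod K g M x) = ceDiffMod K g M' (f.baseChange (CE K g) x) := by
  induction x using TensorProduct.induction_on with
  | zero => simp
  | tmul ω v => simp [ceDiffMod_tmul, hf]
  | add x y hx hy => simp only [map_add, hx, hy]

namespace DGLieModule

variable (V : DGLieModule K g M)

theorem dtot_apply (x : CE K g ⊗[K] M) : V.dtot x =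
    ceDiffMod K g M x + TensorProduct.map (parity K g) V.d.toLinearMap x := rfl

theorem dtot_tmul (ω : CE K g) (v : M) : V.dtot (ω ⊗ₜ v) =
    ceDiff K g ω ⊗ₜ v + ∑ i, (dualVec K g i * ω) ⊗ₜ ⁅Module.finBasis K g i, v⁆ +
      parity K g ω ⊗ₜ V.d v := by
  rw [dtot_apply, ceDiffMod_tmul, TensorProduct.map_tmul]; rfl

theorem dtot_smul (a : CE K g) (x : CE K g ⊗[K] M) :
    V.dtot (a • x) = ceDiff K g a • x + parity K g a • V.dtot x := by
  induction x using TensorProduct.induction_on with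
  | zero => simp
  | tmul ω v =>
    rw [dtot_apply, dtot_apply, ceDiffMod_smul, smul_add, add_assoc]
    congr 2
    rw [TensorProduct.smul_tmul', TensorProduct.map_tmul, TensorProduct.map_tmul,
      TensorProduct.smul_tmul', smul_eq_mul, smul_eq_mul, parity_mul]
  | add x y hx hy => rw [smul_add, map_add, hx, hy, map_add, smul_add, smul_add]; abel

/-- Each of the two parts squares to zero. They anticommute because `V.d` is equivariant and
`parity` anticommutes with odd operators on forms. -/
theorem dtot_dtot [CharZero K] (x : CE K g ⊗[K] M) : V.dtot (V.dtot x) = 0 := by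
  have h : ∀ ω v, ceDiffMod K g M (parity K g ω ⊗ₜ V.d v) +
      TensorProduct.map (parity K g) V.d.toLinearMap (ceDiffMod K g M (ω ⊗ₜ v)) = 0 := by
    intro ω v
    have hp : ∀ i, parity K g (dualVec K g i) = -dualVec K g i := fun i => parity_ι _
    have hd : ∀ i v, V.d.toLinearMap ⁅Module.finBasis K g i, v⁆ =
      ⁅Module.finBasis K g i, V.d v⁆ := fun i v => V.d.map_lie _ _
    have hd' : ∀ v, V.d.toLinearMap v = V.d v := fun _ => rfl
    simp only [ceDiffMod_tmul, map_add, map_sum, TensorProduct.map_tmul, parity_ceDiff, parity_mul,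
      hp, hd, hd', TensorProduct.neg_tmul, neg_mul, Finset.sum_neg_distrib]
    abel
  induction x using TensorProduct.induction_on with
  | zero => simp
  | tmul ω v =>
    have hdd : TensorProduct.map (parity K g) V.d.toLinearMap (parity K g ω ⊗ₜ V.d v) = 0 := by
      rw [TensorProduct.map_tmul]
      change _ ⊗ₜ V.d (V.d v) = _
      rw [V.d_d, TensorProduct.tmul_zero]
    have h' := h ω v
    have e : TensorProduct.map (parity K g) V.d.toLinearMap (ω ⊗ₜ v) =
      parity K g ω ⊗ₜ V.d v := rfl
    rw [dtot_apply, dtot_apply, map_add, map_add, ceDiffMod_ceDiffMod, e, hdd, zero_add, add_zero, h']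
  | add x y hx hy => rw [map_add, map_add, hx, hy, add_zero]

theorem dtot_mem {n : ℤ} {x : CE K g ⊗[K] M} (hx : x ∈ V.omegaGr n) :
    V.dtot x ∈ V.omegaGr (n + 1) := by
  refine V.map_mem_of_tmul V.dtot (fun p q h ω hω v hv => ?_) hx
  rw [dtot_tmul]
  refine add_mem (add_mem ?_ (sum_mem fun i _ => ?_)) ?_
  · exact V.tmul_mem_omegaGr (ceDiff_mem hω) hv (by push_cast; omega)
  · exact V.tmul_mem_omegaGr (ι_mul_mem_exteriorPower _ hω) ((V.gr q).lie_mem hv)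
      (by push_cast; omega)
  · refine V.tmul_mem_omegaGr (p := p) ?_ (V.d_mem q v hv) (by omega)
    rw [parity_apply hω, Units.smul_def]
    exact zsmul_mem hω _

theorem isDGModule [CharZero K] :
    IsDGModule (ceGr K g) (ceDiff K g) V.omegaGr V.dtot where
  internal := V.isInternal_omegaGr
  smul_mem _ _ _ ha _ hx := V.smul_mem_omegaGr ha hx
  del_mem _ _ hx := V.dtot_mem hx
  del_smul m a ha x := by
    obtain rfl | ⟨r, rfl, ha'⟩ := mem_ceGr.1 ha
    · simp
    · rw [dtot_smul, parity_apply ha']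
      congr 1
      exact units_smul_smul (A := CE K g) (N := CE K g ⊗[K] M) a (r : ℤ).negOnePow (V.dtot x)
  del_del := V.dtot_dtot

theorem shift_omegaGr (n : ℤ) : V.shift.omegaGr n = V.omegaGr (n + 1) := by
  refine le_antisymm (V.shift.omegaGr_le fun p q h ω hω v hv => ?_)
    (V.omegaGr_le fun p q h ω hω v hv => ?_)
  · exact V.tmul_mem_omegaGr hω hv (by omega)
  · refine V.shift.tmul_mem_omegaGr (q := q - 1) hω ?_ (by omega)
    change v ∈ V.gr (q - 1 + 1)
    rwa [sub_add_cancel]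

end DGLieModule

/-! ### Contraction with vector valued forms -/

theorem interiorVec_tmul (η : CE K g) (x : g) (a : CE K g) :
    interiorVec K g (η ⊗ₜ x) a = η * interior K x a := by
  simp [interiorVec]

theorem interiorVec_smul (b : CE K g) (z : CE K g ⊗[K] g) (a : CE K g) :
    interiorVec K g (b • z) a = b * interiorVec K g z a := by
  induction z using TensorProduct.induction_on with
  | zero => simp
  | tmul η x =>
    rw [TensorProduct.smul_tmul', interiorVec_tmul, interiorVec_tmul, smul_eq_mul, mul_assoc]
  | add x y hx hy =>
    rw [smul_add, map_add, LinearMap.add_apply, hx, hy, map_add, LinearMap.add_apply, mul_add]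

theorem mem_ofModule_gr {q : ℤ} {v : M} (hv : v ∈ (DGLieModule.ofModule K g M).gr q) :
    q = 0 ∨ v = 0 := by
  by_cases h : q = 0
  · exact Or.inl h
  · right
    change v ∈ (if q = 0 then (⊤ : LieSubmodule K g M) else ⊥) at hv
    rw [if_neg h] at hv
    exact hv

theorem interior_mem_ceGr {m : ℤ} {a : CE K g} (x : g) (ha : a ∈ ceGr K g m) :
    interior K x a ∈ ceGr K g (m - 1) := by
  obtain rfl | ⟨r, rfl, ha'⟩ := mem_ceGr.1 ha
  · rw [map_zero]; exact zero_mem _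
  · cases r with
    | zero => rw [interior_exteriorPower_zero x ha']; exact zero_mem _
    | succ r => simpa using natCast_mem_ceGr (interior_mem x ha')

theorem parity_apply_ceGr {m : ℤ} {a : CE K g} (ha : a ∈ ceGr K g m) :
    parity K g a = m.negOnePow • a := by
  obtain rfl | ⟨r, rfl, ha'⟩ := mem_ceGr.1 ha
  · simp
  · exact parity_apply ha'

/-- A contraction lowers the degree by one, so an element of degree `n + 1` acts with degree `n`.
This matches the shift: degree `n` in `V[1]` is degree `n + 1` in `V`. -/
theorem interiorVec_mem [CharZero K] {n m : ℤ} {z : CE K g ⊗[K] g}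
    (hz : z ∈ (DGLieModule.ofModule K g g).omegaGr (n + 1)) {a : CE K g} (ha : a ∈ ceGr K g m) :
    interiorVec K g z a ∈ ceGr K g (n + m) := by
  refine (DGLieModule.ofModule K g g).map_mem_of_tmul
    (LinearMap.applyₗ a ∘ₗ interiorVec K g) (fun p q h η hη x hx => ?_) hz
  rw [LinearMap.comp_apply, LinearMap.applyₗ_apply_apply, interiorVec_tmul]
  obtain rfl | rfl := mem_ofModule_gr hx
  · rw [show n + m = p + (m - 1) by omega]
    exact isDGAlgebra_ce.mul_mem _ _ _ (natCast_mem_ceGr hη) _ (interior_mem_ceGr x ha)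
  · simp [interior]

theorem interiorVec_mul {n m : ℤ} {z : CE K g ⊗[K] g}
    (hz : z ∈ (DGLieModule.ofModule K g g).omegaGr (n + 1)) {a : CE K g} (ha : a ∈ ceGr K g m)
    (b : CE K g) : interiorVec K g z (a * b) =
      interiorVec K g z a * b + (n * m).negOnePow • (a * interiorVec K g z b) := by
  refine (DGLieModule.ofModule K g g).eq_of_tmul
    (LinearMap.applyₗ (a * b) ∘ₗ interiorVec K g)
    (LinearMap.mulRight K b ∘ₗ LinearMap.applyₗ a ∘ₗ interiorVec K g +
      (((n * m).negOnePow : ℤ) : K) •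
        (LinearMap.mulLeft K a ∘ₗ LinearMap.applyₗ b ∘ₗ interiorVec K g))
    (fun p q h η hη x hx => ?_) hz |>.trans (by
      simp [Units.smul_def, ← Int.cast_smul_eq_zsmul K])
  simp only [LinearMap.comp_apply, LinearMap.applyₗ_apply_apply, LinearMap.add_apply,
    LinearMap.smul_apply, interiorVec_tmul, LinearMap.mulRight_apply, LinearMap.mulLeft_apply,
    Int.cast_smul_eq_zsmul]
  rw [← Units.smul_def, interior_mul, parity_apply_ceGr ha, mul_add, mul_assoc]
  congr 1
  obtain rfl | rfl := mem_ofModule_gr hx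
  · obtain rfl | ⟨r, rfl, ha'⟩ := mem_ceGr.1 ha
    · simp
    · rw [Units.smul_def, smul_mul_assoc, mul_smul_comm, ← mul_assoc, ← mul_assoc,
        mul_comm_exteriorPower hη ha', Units.smul_def, smul_mul_assoc, ← Units.smul_def,
        ← Units.smul_def, smul_smul, ← Int.negOnePow_add]
      apply negOnePow_smul_congr
      obtain rfl : n = p - 1 := by omega
      push_cast
      grind
  · simp [interior]

/-- By the Leibniz rule the graded commutator of `d` with `η ∧ ι_x` is `dη ∧ ι_x ± η ∧ L_x`. Writing
`L_x` as in `lieDer_eq_sum` gives the operator of `d(η ⊗ x)`. -/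
theorem interiorVec_ceDiffMod [CharZero K] {n : ℤ} {z : CE K g ⊗[K] g}
    (hz : z ∈ (DGLieModule.ofModule K g g).omegaGr (n + 1)) (a : CE K g) :
    interiorVec K g (ceDiffMod K g g z) a =
      ceDiff K g (interiorVec K g z a) - n.negOnePow • interiorVec K g z (ceDiff K g a) := by
  refine (DGLieModule.ofModule K g g).eq_of_tmul
    (LinearMap.applyₗ a ∘ₗ interiorVec K g ∘ₗ ceDiffMod K g g)
    (ceDiff K g ∘ₗ LinearMap.applyₗ a ∘ₗ interiorVec K g -
      ((n.negOnePow : ℤ) : K) • (LinearMap.applyₗ (ceDiff K g a) ∘ₗ interiorVec K g))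
    (fun p q h η hη x hx => ?_) hz |>.trans (by
      simp [Units.smul_def, ← Int.cast_smul_eq_zsmul K])
  simp only [LinearMap.comp_apply, LinearMap.applyₗ_apply_apply, LinearMap.sub_apply,
    LinearMap.smul_apply, interiorVec_tmul, ceDiffMod_tmul, map_add, map_sum, Int.cast_smul_eq_zsmul]
  rw [← Units.smul_def, ceDiff_mul]
  obtain rfl | rfl := mem_ofModule_gr hx
  · have h1 : ceDiff K g (interior K x a) = lieDer x a - interior K x (ceDiff K g a) := by
      rw [lieDer_apply]; abel
    simp only [h1, lieDer_eq_sum, dualVec_mul_eq _ η, mul_sub, Finset.mul_sum, mul_assoc]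
    rw [add_sub_assoc, sub_sub, parity_apply hη]
    obtain rfl : n = p - 1 := by omega
    rw [Int.negOnePow_sub, Int.negOnePow_one, mul_neg, mul_one, Units.neg_smul,
      Units.smul_def, Units.smul_def, smul_mul_assoc, add_neg_cancel, sub_zero]
  · simp [interior]

end DGModules

/-! ### The connection of an anchor -/

section Connection

variable {K g M : Type*} [Field K] [LieRing g] [LieAlgebra K g] [FiniteDimensional K g]
  [AddCommGroup M] [Module K M] [LieRingModule g M] [LieModule K g M]

theorem nabla_tmul (α : CE K g ⊗[K] M →ₗ[CE K g] CE K g ⊗[K] g) (b : CE K g ⊗[K] M)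
    (ω : CE K g) (v : M) : nabla α b (ω ⊗ₜ v) = interiorVec K g (α b) ω ⊗ₜ v := rfl

/-- The anchor `b ↦ ι_{α(b)}` is compatible with the differentials because `α` and `z ↦ ι_z` are. -/
theorem isConnection_nabla [CharZero K] {V : DGLieModule K g M}
    (α : WeakMorphism V (DGLieModule.ofModule K g g)) :
    IsConnection (ceGr K g) (ceDiff K g) V.shift.omegaGr V.shift.dtot (nabla α.map)
      (fun b a => interiorVec K g (α.map b) a) where
  mem n b hb m y hy := by
    rw [V.shift_omegaGr] at hb
    refine V.shift.map_mem_of_tmul (nabla α.map b) (fun p q h ω hω v hv => ?_) hy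
    rw [nabla_tmul]
    have := interiorVec_mem (α.map_mem _ _ hb) (natCast_mem_ceGr hω)
    obtain h0 | ⟨r, hr, h'⟩ := mem_ceGr.1 this
    · rw [h0, TensorProduct.zero_tmul]; exact zero_mem _
    · exact V.shift.tmul_mem_omegaGr h' hv (by omega)
  anc_mem n b hb m a ha := by
    rw [V.shift_omegaGr] at hb
    exact interiorVec_mem (α.map_mem _ _ hb) ha
  smul_left a b y := by
    induction y using TensorProduct.induction_on with
    | zero => simp
    | tmul ω v =>
      rw [nabla_tmul, nabla_tmul, map_smul, interiorVec_smul, TensorProduct.smul_tmul', smul_eq_mul]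
    | add x y hx hy => rw [map_add, hx, hy, map_add, smul_add]
  smul_right n b hb m a ha y := by
    rw [V.shift_omegaGr] at hb
    induction y using TensorProduct.induction_on with
    | zero => simp
    | tmul ω v =>
      rw [TensorProduct.smul_tmul', nabla_tmul, nabla_tmul, smul_eq_mul,
        interiorVec_mul (α.map_mem _ _ hb) ha, TensorProduct.add_tmul, TensorProduct.smul_tmul',
        TensorProduct.smul_tmul', smul_eq_mul, smul_eq_mul]
      congr 1
    | add x y hx hy =>
      rw [smul_add, map_add, hx, hy, map_add, smul_add, smul_add, smul_add]
      abel
  anc_del n b hb a := by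
    rw [V.shift_omegaGr] at hb
    have h : α.map (V.shift.dtot b) = ceDiffMod K g g (α.map b) :=
      (α.map_dtot b).trans (DGLieModule.ofModule_dtot _)
    simp only [h]
    exact interiorVec_ceDiffMod (α.map_mem _ _ hb) a

end Connection

/-! ### The dg Leibniz algebra of a Loday–Pirashvili module -/

section LodayPirashvili

variable {K g G : Type*} [Field K] [LieRing g] [LieAlgebra K g] [FiniteDimensional K g]
  [AddCommGroup G] [Module K G] [LieRingModule g G] [LieModule K g G]

/-- A Loday–Pirashvili module, as a weak morphism between complexes concentrated in degree `0`. -/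
def anchor (X : G →ₗ⁅K,g⁆ g) :
    WeakMorphism (DGLieModule.ofModule K g G) (DGLieModule.ofModule K g g) where
  map := (X : G →ₗ[K] g).baseChange (CE K g)
  map_mem n x hx := by
    refine (DGLieModule.ofModule K g G).map_mem_of_tmul
      (((X : G →ₗ[K] g).baseChange (CE K g)).restrictScalars K) (fun p q h ω hω v hv => ?_) hx
    refine DGLieModule.tmul_mem_omegaGr _ hω (q := q) ?_ h
    obtain rfl | rfl := mem_ofModule_gr hv
    · trivial
    · exact (map_zero (X : G →ₗ[K] g)).symm ▸ zero_mem _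
  map_dtot x := by
    rw [DGLieModule.ofModule_dtot, DGLieModule.ofModule_dtot]
    exact baseChange_ceDiffMod (X : G →ₗ[K] g) (fun x v => X.map_lie x v) x

theorem anchor_tmul (X : G →ₗ⁅K,g⁆ g) (η : CE K g) (x : G) :
    (anchor X).map (η ⊗ₜ x) = η ⊗ₜ X x := rfl

theorem lpBracket_tmul (X : G →ₗ⁅K,g⁆ g) (η ω : CE K g) (x y : G) :
    lpBracket X (η ⊗ₜ x) (ω ⊗ₜ y) = -((parity K g η * ω) ⊗ₜ ⁅X x, y⁆) := by
  rw [← TensorProduct.neg_tmul, ← neg_mul]; rfl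

theorem units_smul_tmul {M : Type*} [AddCommGroup M] [Module K M] (u : ℤˣ) (a : CE K g) (v : M) :
    (u • a) ⊗ₜ[K] v = u • (a ⊗ₜ[K] v) :=
  map_units_smul ((TensorProduct.mk K (CE K g) M).flip v).toAddMonoidHom u a

theorem mem_shift_ofModule_gr {q : ℤ} {v : G}
    (hv : v ∈ (DGLieModule.ofModule K g G).shift.gr q) : q = -1 ∨ v = 0 :=
  (mem_ofModule_gr (q := q + 1) hv).imp_left fun h => by omega

theorem sum_dualVec_tmul_lie {M : Type*} [AddCommGroup M] [Module K M] [LieRingModule g M]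
    [LieModule K g M] (η ω : CE K g) (z : g) (v : M) :
    ∑ i, (η * interior K z (dualVec K g i) * ω) ⊗ₜ[K] ⁅Module.finBasis K g i, v⁆ =
      (η * ω) ⊗ₜ ⁅z, v⁆ := by
  conv_rhs => rw [← (Module.finBasis K g).sum_repr z, sum_lie, TensorProduct.tmul_sum]
  refine Finset.sum_congr rfl fun i _ => ?_
  rw [dualVec, interior_ι, Algebra.algebraMap_eq_smul_one, mul_smul_comm, mul_one, smul_mul_assoc,
    smul_lie, TensorProduct.smul_tmul, Module.Basis.coord_apply]

/-- The terms in which `ω` is differentiated cancel, the anchor being a chain map. What remains is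
the contraction of `α(b)` with the covectors `e^i` created by the action part of the differential.
-/
theorem atiyah_tmul [CharZero K] (X : G →ₗ⁅K,g⁆ g) {n : ℤ} {b : CE K g ⊗[K] G}
    (hb : b ∈ (DGLieModule.ofModule K g G).shift.omegaGr n) (ω : CE K g) (v : G) :
    -ceDiffMod K g G (nabla (anchor X).map b (ω ⊗ₜ v)) +
      nabla (anchor X).map (ceDiffMod K g G b) (ω ⊗ₜ v) +
      n.negOnePow • nabla (anchor X).map b (ceDiffMod K g G (ω ⊗ₜ v)) =
    n.negOnePow • ∑ i, (interiorVec K g ((anchor X).map b) (dualVec K g i) * ω) ⊗ₜ[K]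
      ⁅Module.finBasis K g i, v⁆ := by
  have hmap : (anchor X).map (ceDiffMod K g G b) = ceDiffMod K g g ((anchor X).map b) :=
    baseChange_ceDiffMod (X : G →ₗ[K] g) (fun x v => X.map_lie x v) b
  rw [DGLieModule.shift_omegaGr] at hb
  have hb' := (anchor X).map_mem _ _ hb
  have hι : ∀ i, dualVec K g i ∈ ceGr K g (1 : ℕ) := fun i =>
    natCast_mem_ceGr (ι_mem_exteriorPower _)
  rw [ceDiffMod_tmul, nabla_tmul, nabla_tmul, map_add, nabla_tmul, ceDiffMod_tmul, map_sum,
    hmap, interiorVec_ceDiffMod hb', TensorProduct.sub_tmul, units_smul_tmul]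
  simp only [nabla_tmul, interiorVec_mul hb' (hι _), TensorProduct.add_tmul, units_smul_tmul,
    Finset.sum_add_distrib, ← Finset.smul_sum, Nat.cast_one, mul_one]
  rcases Int.units_eq_one_or n.negOnePow with h | h <;> rw [h] <;>
    simp only [one_smul, Units.neg_smul] <;> abel

/-- The bracket is parallel: it multiplies the form factors, `∇_b` acts on these alone, and there it
is a graded derivation. -/
theorem nabla_lpBracket [CharZero K] (X : G →ₗ⁅K,g⁆ g) {n m : ℤ} {b x : CE K g ⊗[K] G}
    (hb : b ∈ (DGLieModule.ofModule K g G).shift.omegaGr n)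
    (hx : x ∈ (DGLieModule.ofModule K g G).shift.omegaGr m) (y : CE K g ⊗[K] G) :
    n.negOnePow • nabla (anchor X).map b (lpBracket X x y) =
      lpBracket X (nabla (anchor X).map b x) y +
        (n * m).negOnePow • lpBracket X x (nabla (anchor X).map b y) := by
  rw [DGLieModule.shift_omegaGr] at hb
  have hb' := (anchor X).map_mem _ _ hb
  induction y using TensorProduct.induction_on with
  | zero => simp
  | add y y' hy hy' => simp only [map_add, smul_add, hy, hy']; abel
  | tmul ω v =>
    refine ((DGLieModule.ofModule K g G).shift.eq_of_tmul
      (((n.negOnePow : ℤ) : K) • (nabla (anchor X).map b ∘ₗ (lpBracket X).flip (ω ⊗ₜ v)))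
      ((lpBracket X).flip (ω ⊗ₜ v) ∘ₗ nabla (anchor X).map b + (((n * m).negOnePow : ℤ) : K) •
        (lpBracket X).flip (nabla (anchor X).map b (ω ⊗ₜ v)))
      (fun p q h η hη x hx => ?_) hx) |> fun h => (Eq.trans (by
          simp [Units.smul_def, ← Int.cast_smul_eq_zsmul K]) h).trans (by
          simp [Units.smul_def, ← Int.cast_smul_eq_zsmul K])
    obtain rfl | rfl := mem_shift_ofModule_gr hx
    · obtain rfl : m = p - 1 := by omega
      simp only [LinearMap.smul_apply, LinearMap.add_apply, LinearMap.comp_apply,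
        LinearMap.flip_apply, lpBracket_tmul, nabla_tmul, map_neg, Int.cast_smul_eq_zsmul]
      rw [← Units.smul_def, ← Units.smul_def,
        parity_apply_ceGr (interiorVec_mem hb' (natCast_mem_ceGr hη)), parity_apply hη]
      have e : ∀ (u : ℤˣ) (a c : CE K g), u • a * c = u • (a * c) := fun u a c =>
        (map_units_smul (LinearMap.mulRight K c).toAddMonoidHom _ _)
      have e' : ∀ (u : ℤˣ) (a : CE K g), interiorVec K g ((anchor X).map b) (u • a) =
        u • interiorVec K g ((anchor X).map b) a := fun u a =>
        (map_units_smul (interiorVec K g ((anchor X).map b)).toAddMonoidHom _ _)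
      rw [e, e, e', e, interiorVec_mul hb' (natCast_mem_ceGr hη), units_smul_tmul, units_smul_tmul,
        units_smul_tmul, TensorProduct.add_tmul, units_smul_tmul, Int.negOnePow_add, mul_sub,
        Int.negOnePow_sub, mul_one, mul_smul, mul_smul]
      simp only [smul_neg, smul_add, neg_add]
      congr 2
      simp only [smul_smul]
      congr 1
      ac_rfl
    · simp

/-- The dual bases in the Atiyah cocycle contract to the action of `X x`, which identifies the
binary bracket. Since it is parallel, the ternary bracket is zero, and so are all later ones. The dg
Leibniz identities thus follow from the general theorem on Kapranov brackets. -/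
theorem isKapranov_lpBrackets [CharZero K] (X : G →ₗ⁅K,g⁆ g) :
    IsKapranov (DGLieModule.ofModule K g G).shift.omegaGr (DGLieModule.ofModule K g G).shift.dtot
      (nabla (anchor X).map) (lpBrackets X) where
  unary := by
    refine LinearMap.ext fun x => ?_
    exact (DGLieModule.ofModule_dtot x).symm
  binary n b hb e := by
    have hd : ∀ x, (DGLieModule.ofModule K g G).shift.dtot x = ceDiffMod K g G x :=
      DGLieModule.ofModule_dtot
    simp only [lpBrackets_two, hd]
    induction e using TensorProduct.induction_on with
    | zero => simp
    | tmul ω v =>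
      rw [atiyah_tmul X hb]
      refine (DGLieModule.ofModule K g G).shift.eq_of_tmul ((lpBracket X).flip (ω ⊗ₜ v))
        (((n.negOnePow : ℤ) : K) • ∑ i,
          (TensorProduct.mk K (CE K g) G).flip ⁅Module.finBasis K g i, v⁆ ∘ₗ
            LinearMap.mulRight K ω ∘ₗ LinearMap.applyₗ (dualVec K g i) ∘ₗ interiorVec K g ∘ₗ
              (anchor X).map.restrictScalars K)
        (fun p q h η hη x hx => ?_) hb |>.trans (by
          simp [Units.smul_def, ← Int.cast_smul_eq_zsmul K, LinearMap.sum_apply])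
      simp only [LinearMap.smul_apply, LinearMap.sum_apply, LinearMap.comp_apply,
        LinearMap.flip_apply, LinearMap.restrictScalars_apply, anchor_tmul,
        LinearMap.applyₗ_apply_apply, interiorVec_tmul, LinearMap.mulRight_apply,
        TensorProduct.mk_apply, sum_dualVec_tmul_lie, lpBracket_tmul, Int.cast_smul_eq_zsmul]
      rw [parity_apply hη, ← Units.smul_def]
      obtain rfl | rfl := mem_shift_ofModule_gr hx
      · obtain rfl : n = p - 1 := by omega
        rw [Int.negOnePow_sub, Int.negOnePow_one, mul_neg, mul_one, Units.neg_smul,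
          ← units_smul_tmul]
        congr 2
        exact (map_units_smul (LinearMap.mulRight K ω).toAddMonoidHom _ _)
      · simp
    | add x y hx hy => simp only [map_add, hx, hy, smul_add]; abel
  higher k hk n deg b₀ hb₀ b hb := by
    match k, hk with
    | 2, _ =>
      obtain ⟨x, y, rfl⟩ : ∃ x y, b = ![x, y] := ⟨b 0, b 1, by ext i; fin_cases i <;> rfl⟩
      have hx : x ∈ _ := hb 0
      have hy : y ∈ _ := hb 1
      have h3 : lpBrackets X 3 = 0 := rfl
      have e0 : Function.update ![x, y] 0 (nabla (anchor X).map b₀ x) =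
        ![nabla (anchor X).map b₀ x, y] := by ext i; fin_cases i <;> rfl
      have e1 : Function.update ![x, y] 1 (nabla (anchor X).map b₀ y) =
        ![x, nabla (anchor X).map b₀ y] := by ext i; fin_cases i <;> rfl
      have i0 : Finset.Iio (0 : Fin 2) = ∅ := rfl
      have i1 : Finset.Iio (1 : Fin 2) = {0} := rfl
      simp only [Fin.sum_univ_two, Matrix.cons_val_zero, Matrix.cons_val_one, e0, e1, i0, i1,
        lpBrackets_two, h3, Finset.sum_empty, Finset.sum_singleton, mul_zero, Int.negOnePow_zero,
        one_smul, zero_apply]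
      rw [nabla_lpBracket X hb₀ hx, sub_self]
    | k + 3, _ =>
      have h : ∀ j, lpBrackets X (j + 3) = 0 := fun j => rfl
      simp [h]

theorem isDGLeibnizOver_lpBrackets [CharZero K] (X : G →ₗ⁅K,g⁆ g) :
    IsDGLeibnizOver (ceGr K g) (ceDiff K g)
      (DGLieModule.ofModule K g G).shift.omegaGr (lpBrackets X) where
  leibniz := (isKapranov_lpBrackets X).isLeibnizInfinityOver
    (DGLieModule.ofModule K g G).shift.isDGModule (isConnection_nabla (anchor X)) isDGAlgebra_ce
  higher k hk := by
    obtain ⟨j, rfl⟩ : ∃ j, k = j + 3 := ⟨k - 3, by omega⟩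
    rfl

end LodayPirashvili

/-! ### Lifting a Loday–Pirashvili module to a resolution -/

section Lift

variable {K g G M : Type*} [Field K] [LieRing g] [LieAlgebra K g]
  [AddCommGroup G] [Module K G] [LieRingModule g G] [LieModule K g G]
  [AddCommGroup M] [Module K M] [LieRingModule g M] [LieModule K g M]

namespace DGLieModule

variable (V : DGLieModule K g M)

/-- In each degree a linear section of `d` onto its image is extended to all of `M`. Equivariance is
neither claimed nor available in general. -/
theorem exists_generalizedInverse : ∃ σ : M →ₗ[K] M,
    (∀ n, ∀ v ∈ V.gr n, σ v ∈ V.gr (n - 1)) ∧ ∀ v, V.d (σ (V.d v)) = V.d v := by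
  have h : ∀ n : ℤ, ∃ s : M →ₗ[K] (V.gr (n - 1)).toSubmodule,
      ∀ w ∈ V.gr (n - 1), V.d (s (V.d w)) = V.d w := by
    intro n
    let f : (V.gr (n - 1)).toSubmodule →ₗ[K] M :=
      V.d.toLinearMap ∘ₗ (V.gr (n - 1)).toSubmodule.subtype
    obtain ⟨t, ht⟩ := f.rangeRestrict.exists_rightInverse_of_surjective f.range_rangeRestrict
    obtain ⟨s, hs⟩ := LinearMap.exists_extend t
    refine ⟨s, fun w hw => ?_⟩
    have hw' : V.d w ∈ f.range := ⟨⟨w, hw⟩, rfl⟩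
    have h1 : s (V.d w) = t ⟨V.d w, hw'⟩ := LinearMap.congr_fun hs ⟨V.d w, hw'⟩
    have h2 := congrArg Subtype.val (LinearMap.congr_fun ht ⟨V.d w, hw'⟩)
    rw [h1]
    exact h2
  choose s hs using h
  have hσ : ∀ n, ∀ v ∈ V.gr n, gradedLift V.internal
      (fun n => (V.gr (n - 1)).toSubmodule.subtype ∘ₗ s n) v = s n v :=
    fun n v hv => gradedLift_apply V.internal _ hv
  refine ⟨gradedLift V.internal fun n => (V.gr (n - 1)).toSubmodule.subtype ∘ₗ s n,
    fun n v hv => ?_, fun v => ?_⟩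
  · rw [hσ n v hv]; exact (s n v).2
  · refine LinearMap.congr_fun (LinearMap.ext_of_isInternal V.internal
      (f := V.d.toLinearMap ∘ₗ gradedLift V.internal
        (fun n => (V.gr (n - 1)).toSubmodule.subtype ∘ₗ s n) ∘ₗ V.d.toLinearMap)
      (g := V.d.toLinearMap) fun n w hw => ?_) v
    change V.d (gradedLift V.internal _ (V.d w)) = V.d w
    rw [hσ (n + 1) _ (V.d_mem n w hw)]
    exact hs (n + 1) w (by rwa [add_sub_cancel_right])

end DGLieModule

/-! ### Linear homotopy and retraction of a resolution -/

namespace Resolution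

variable {V : DGLieModule K g M}

theorem exists_homotopy (r : Resolution V G) :
    ∃ h : M →ₗ[K] M, (∀ n, ∀ v ∈ V.gr n, h v ∈ V.gr (n - 1)) ∧
      (∀ n, n ≠ 0 → ∀ v ∈ V.gr n, v - V.d (h v) - h (V.d v) = 0) ∧
      ∀ v ∈ V.gr 0, v - V.d (h v) - h (V.d v) ∈ V.H0 := by
  obtain ⟨σ, hσ, hd⟩ := V.exists_generalizedInverse
  have hneg : ∀ n < 0, ∀ v ∈ V.gr n, v = 0 := fun n hn v hv => by
    rw [r.nonneg n hn] at hv; exact hv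
  have hker : ∀ v, V.d (v - σ (V.d v)) = 0 := fun v => by rw [map_sub, hd, sub_self]
  have hmem : ∀ n, ∀ v ∈ V.gr n, σ (V.d v) ∈ V.gr n := fun n v hv => by
    simpa using hσ _ _ (V.d_mem n v hv)
  -- The homotopy is `h = σ (1 - σ d)`. Here `h d = σ d` as `d² = 0`, while `1 - σ d` maps to
  -- cocycles. In positive degree these are exact, so `d σ` fixes them and `d h = 1 - σ d`. In
  -- degree `0`, `h` vanishes and the defect `1 - σ d` maps to `H0`.
  refine ⟨σ - σ ∘ₗ σ ∘ₗ V.d.toLinearMap, fun n v hv => sub_mem (hσ n v hv) (hσ n _ (hmem n v hv)),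
    fun n hn v hv => ?_, fun v hv => ?_⟩
  · change v - V.d (σ v - σ (σ (V.d v))) - (σ (V.d v) - σ (σ (V.d (V.d v)))) = 0
    rcases lt_or_ge n 0 with h | h
    · rw [hneg n h v hv]; simp
    · obtain ⟨w, -, hw⟩ := r.acyclic n (by omega) _ (sub_mem hv (hmem n v hv)) (hker v)
      rw [V.d_d, map_zero, map_zero, sub_zero, ← map_sub σ, ← hw, hd, hw]
      abel
  · change v - V.d (σ v - σ (σ (V.d v))) - (σ (V.d v) - σ (σ (V.d (V.d v)))) ∈ _
    have h0 : ∀ w ∈ V.gr 0, σ w = 0 := fun w hw => hneg _ (by norm_num) _ (hσ 0 w hw)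
    rw [V.d_d, h0 v hv, h0 _ (hmem 0 v hv), map_zero, map_zero, sub_zero, map_zero, sub_zero,
      sub_zero]
    exact ⟨sub_mem hv (hmem 0 v hv), hker v⟩

theorem incl_mem (r : Resolution V G) (x : G) : r.incl x ∈ V.H0 := (r.iso x).2

theorem d_incl (r : Resolution V G) (x : G) : V.d (r.incl x) = 0 := (r.incl_mem x).2

theorem incl_lie (r : Resolution V G) (y : g) (x : G) : r.incl ⁅y, x⁆ = ⁅y, r.incl x⁆ :=
  congrArg Subtype.val (r.iso.map_lie y x)

theorem incl_injective (r : Resolution V G) : Function.Injective r.incl :=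
  Subtype.val_injective.comp r.iso.injective

theorem exists_incl_eq (r : Resolution V G) {v : M} (hv : v ∈ V.H0) : ∃ x, r.incl x = v := by
  obtain ⟨x, hx⟩ := r.iso.surjective ⟨v, hv⟩
  exact ⟨x, congrArg Subtype.val hx⟩

theorem exists_retraction (r : Resolution V G) : ∃ π : M →ₗ[K] G, (∀ x, π (r.incl x) = x) ∧
    ∀ n, n ≠ 0 → ∀ v ∈ V.gr n, π v = 0 := by
  obtain ⟨π, hπ⟩ := r.incl.exists_leftInverse_of_injective (LinearMap.ker_eq_bot.2 r.incl_injective)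
  refine ⟨gradedLift V.internal fun n => if n = 0 then π else 0, fun x => ?_, fun n hn v hv => ?_⟩
  · rw [gradedLift_apply V.internal (n := 0) _ (r.incl_mem x).1, if_pos rfl]
    exact LinearMap.congr_fun hπ x
  · rw [gradedLift_apply V.internal _ hv, if_neg hn, LinearMap.zero_apply]

variable [FiniteDimensional K g]

theorem dtot_baseChange_incl (r : Resolution V G) (x : CE K g ⊗[K] G) :
    V.dtot (r.incl.baseChange (CE K g) x) =
      r.incl.baseChange (CE K g) (ceDiffMod K g G x) := by
  rw [DGLieModule.dtot_apply, baseChange_ceDiffMod r.incl r.incl_lie, add_eq_left]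
  induction x using TensorProduct.induction_on with
  | zero => simp
  | tmul ω v =>
    rw [LinearMap.baseChange_tmul, TensorProduct.map_tmul]
    exact (congrArg _ (r.d_incl v)).trans (TensorProduct.tmul_zero _ _)
  | add x y hx hy => rw [map_add, map_add, hx, hy, add_zero]

end Resolution

/-! ### The perturbed contraction and the filtration -/

namespace DGLieModule

variable [FiniteDimensional K g] (V : DGLieModule K g M)

/-- The contraction `1 - (D H + H D)` of `Ω_g(V)`, where `D` is the total differential and
`H (ω ⊗ v) = (-1)^|ω| ω ⊗ h v`. -/
def contraction (h : M →ₗ[K] M) : CE K g ⊗[K] M →ₗ[CE K g] CE K g ⊗[K] M where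
  toFun x := x - (V.dtot (TensorProduct.map (parity K g) h x) +
    TensorProduct.map (parity K g) h (V.dtot x))
  map_add' x y := by simp only [map_add]; abel
  -- `H` is linear up to the sign of an odd operator, so the terms with `d a` from `DH` and `HD`
  -- cancel.
  map_smul' a x := by
    have hs : ∀ (a : CE K g) x, TensorProduct.map (parity K g) h (a • x) =
        parity K g a • TensorProduct.map (parity K g) h x := by
      intro a x
      induction x using TensorProduct.induction_on with
      | zero => simp
      | tmul ω v =>
        rw [TensorProduct.smul_tmul', TensorProduct.map_tmul, TensorProduct.map_tmul,
          TensorProduct.smul_tmul', smul_eq_mul, smul_eq_mul, parity_mul]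
      | add x y hx hy => rw [smul_add, map_add, hx, hy, map_add, smul_add]
    have hn : ∀ (a : CE K g) (x : CE K g ⊗[K] M), (-a) • x = -(a • x) := fun a x => neg_smul a x
    rw [hs, dtot_smul, dtot_smul, map_add, hs, hs, parity_parity, parity_ceDiff, hn,
      RingHom.id_apply, smul_sub, smul_add]
    abel

theorem contraction_apply (h : M →ₗ[K] M) (x : CE K g ⊗[K] M) : V.contraction h x =
    x - (V.dtot (TensorProduct.map (parity K g) h x) +
      TensorProduct.map (parity K g) h (V.dtot x)) := rfl

theorem contraction_dtot [CharZero K] (h : M →ₗ[K] M) (x : CE K g ⊗[K] M) :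
    V.contraction h (V.dtot x) = V.dtot (V.contraction h x) := by
  rw [contraction_apply, contraction_apply, map_sub, map_add, dtot_dtot, dtot_dtot, map_zero,
    add_zero, zero_add]

theorem contraction_mem {h : M →ₗ[K] M} (hh : ∀ n, ∀ v ∈ V.gr n, h v ∈ V.gr (n - 1)) {n : ℤ}
    {x : CE K g ⊗[K] M} (hx : x ∈ V.omegaGr n) : V.contraction h x ∈ V.omegaGr n := by
  have hH : ∀ n, ∀ x ∈ V.omegaGr n, TensorProduct.map (parity K g) h x ∈ V.omegaGr (n - 1) := by
    intro n x hx
    refine V.map_mem_of_tmul _ (fun p q e ω hω v hv => ?_) hx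
    rw [TensorProduct.map_tmul]
    refine V.tmul_mem_omegaGr (p := p) ?_ (hh q v hv) (by omega)
    rw [parity_apply hω, Units.smul_def]
    exact zsmul_mem hω _
  refine sub_mem hx (add_mem ?_ ?_)
  · simpa using V.dtot_mem (hH n x hx)
  · simpa using hH _ _ (V.dtot_mem hx)

/-- The first term is the homotopy defect of `h`. The sum measures its failure to be equivariant and
takes values one degree lower in `V`, when `h` lowers degrees by one. -/
theorem contraction_one_tmul (h : M →ₗ[K] M) (v : M) : V.contraction h (1 ⊗ₜ v) =
    1 ⊗ₜ (v - V.d (h v) - h (V.d v)) - ∑ i, dualVec K g i ⊗ₜ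
      (⁅Module.finBasis K g i, h v⁆ - h ⁅Module.finBasis K g i, v⁆) := by
  have hp : ∀ i, parity K g (dualVec K g i) = -dualVec K g i := fun i => parity_ι _
  simp only [contraction_apply, TensorProduct.map_tmul, parity_one, dtot_tmul, ceDiff_one,
    TensorProduct.zero_tmul, zero_add, mul_one, map_add, map_sum, hp, TensorProduct.neg_tmul,
    Finset.sum_neg_distrib, TensorProduct.tmul_sub, Finset.sum_sub_distrib]
  abel

/-- The subspaces of a filtration of a resolution: the cocycles of degree `0`, followed by the
elements of degree at most `m`, for `m = 0, 1, …`. -/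
def filtration : ℕ → Submodule K M
  | 0 => V.H0.toSubmodule
  | m + 1 => ⨆ q : ℤ, ⨆ _ : q ≤ m, (V.gr q).toSubmodule

theorem gr_le_filtration {q : ℤ} {m : ℕ} (h : q ≤ m) :
    (V.gr q).toSubmodule ≤ V.filtration (m + 1) :=
  le_iSup₂_of_le q h le_rfl

theorem H0_le_filtration (m : ℕ) : V.H0.toSubmodule ≤ V.filtration m := by
  cases m with
  | zero => exact le_rfl
  | succ m => exact le_trans (fun v hv => hv.1) (V.gr_le_filtration (q := 0) (by omega))

theorem exists_filtration_eq_top : ∃ m, V.filtration m = ⊤ := by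
  obtain ⟨a, b, hab⟩ := V.bounded
  -- Step `m + 1` collects the degrees up to `m`. The bound `b` may be negative, in which case
  -- `b.toNat = 0` still serves.
  refine ⟨b.toNat + 1, eq_top_iff.2 ?_⟩
  rw [← V.iSup_gr]
  refine iSup_le fun q => ?_
  by_cases hq : q ≤ b.toNat
  · exact V.gr_le_filtration hq
  · rw [hab q (Or.inr (by omega))]
    exact bot_le

/-- The forms with values in a step of the filtration. -/
def omegaFiltration (m : ℕ) : Submodule K (CE K g ⊗[K] M) :=
  Submodule.map₂ (TensorProduct.mk K (CE K g) M) ⊤ (V.filtration m)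

theorem tmul_mem_omegaFiltration {m : ℕ} (ω : CE K g) {v : M} (hv : v ∈ V.filtration m) :
    ω ⊗ₜ[K] v ∈ V.omegaFiltration m :=
  Submodule.apply_mem_map₂ _ Submodule.mem_top hv

theorem smul_mem_omegaFiltration {m : ℕ} (a : CE K g) {x : CE K g ⊗[K] M}
    (hx : x ∈ V.omegaFiltration m) : a • x ∈ V.omegaFiltration m := by
  have : V.omegaFiltration m ≤
      (V.omegaFiltration m).comap (Algebra.lsmul K K (CE K g ⊗[K] M) a) :=
    Submodule.map₂_le.2 fun ω _ v hv => by
      change a • ω ⊗ₜ[K] v ∈ V.omegaFiltration m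
      rw [TensorProduct.smul_tmul']
      exact V.tmul_mem_omegaFiltration _ hv
  exact this hx

end DGLieModule

/-! ### Projection onto forms with values in `G`, and the lift -/

namespace Resolution

variable {V : DGLieModule K g M} [FiniteDimensional K g]

/-- The homotopy defect vanishes outside degree `0` and lies in `H0` in degree `0`, and the
equivariance defect drops the degree by one. -/
theorem contraction_mem_omegaFiltration (r : Resolution V G) {h : M →ₗ[K] M}
    (hh : ∀ n, ∀ v ∈ V.gr n, h v ∈ V.gr (n - 1))
    (h1 : ∀ n, n ≠ 0 → ∀ v ∈ V.gr n, v - V.d (h v) - h (V.d v) = 0)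
    (h0 : ∀ v ∈ V.gr 0, v - V.d (h v) - h (V.d v) ∈ V.H0) {m : ℕ} {x : CE K g ⊗[K] M}
    (hx : x ∈ V.omegaFiltration (m + 1)) : V.contraction h x ∈ V.omegaFiltration m := by
  have hle : V.filtration (m + 1) ≤ ((V.omegaFiltration m).comap
      ((V.contraction h).restrictScalars K ∘ₗ TensorProduct.mk K (CE K g) M 1)) := by
    refine iSup₂_le fun q hq v hv => ?_
    have hgr : (V.gr (q - 1)).toSubmodule ≤ V.filtration m := by
      cases m with
      | zero =>
        -- Here `q ≤ 0`, so the equivariance defect lies in a negative degree, where `V` is zero.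
        have : V.gr (q - 1) = ⊥ := r.nonneg _ (by push_cast at hq; omega)
        rw [this]
        exact bot_le
      | succ m => exact V.gr_le_filtration (by push_cast at hq; omega)
    change V.contraction h (1 ⊗ₜ v) ∈ V.omegaFiltration m
    rw [V.contraction_one_tmul]
    refine sub_mem (V.tmul_mem_omegaFiltration _ ?_) (sum_mem fun i _ =>
      V.tmul_mem_omegaFiltration _ (hgr (sub_mem ((V.gr (q - 1)).lie_mem (hh q v hv))
        (hh q _ ((V.gr q).lie_mem hv)))))
    by_cases hq0 : q = 0
    · subst hq0
      exact V.H0_le_filtration m (h0 v hv)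
    · rw [h1 q hq0 v hv]
      exact zero_mem _
  have : V.omegaFiltration (m + 1) ≤
      (V.omegaFiltration m).comap ((V.contraction h).restrictScalars K) :=
    Submodule.map₂_le.2 fun ω _ v hv => by
      change V.contraction h (ω ⊗ₜ[K] v) ∈ V.omegaFiltration m
      rw [tmul_eq_smul, map_smul]
      exact V.smul_mem_omegaFiltration _ (hle hv)
  exact this hx

theorem contraction_baseChange_incl (r : Resolution V G) {h : M →ₗ[K] M}
    (hh : ∀ n, ∀ v ∈ V.gr n, h v ∈ V.gr (n - 1)) (x : CE K g ⊗[K] G) :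
    V.contraction h (r.incl.baseChange (CE K g) x) = r.incl.baseChange (CE K g) x := by
  have h0 : ∀ v ∈ V.gr 0, h v = 0 := fun v hv => by
    have := hh 0 v hv
    rwa [r.nonneg _ (by norm_num)] at this
  induction x using TensorProduct.induction_on with
  | zero => simp
  | tmul ω v =>
    have hl : ∀ i, h ⁅Module.finBasis K g i, r.incl v⁆ = 0 := fun i =>
      h0 _ ((V.gr 0).lie_mem (r.incl_mem v).1)
    rw [LinearMap.baseChange_tmul, tmul_eq_smul, map_smul, V.contraction_one_tmul,
      h0 _ (r.incl_mem v).1, r.d_incl]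
    simp [hl]
  | add x y hx hy => rw [map_add, map_add, hx, hy]

/-- The power is the length of the filtration, so every form ends in step `0`, the forms with values
in cocycles of degree `0`. Each factor is an `Ω_g`-linear chain map which fixes these forms. -/
theorem exists_projection [CharZero K] (r : Resolution V G) :
    ∃ P : CE K g ⊗[K] M →ₗ[CE K g] CE K g ⊗[K] M,
      (∀ n, ∀ x ∈ V.omegaGr n, P x ∈ V.omegaGr n) ∧ (∀ x, P (V.dtot x) = V.dtot (P x)) ∧
      (∀ x, P x ∈ (r.incl.baseChange (CE K g)).range) ∧
      ∀ x, P (r.incl.baseChange (CE K g) x) = r.incl.baseChange (CE K g) x := by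
  obtain ⟨h, hh, h1, h0⟩ := r.exists_homotopy
  obtain ⟨m, hm⟩ := V.exists_filtration_eq_top
  have hpow : ∀ (k : ℕ) (x : CE K g ⊗[K] M), (V.contraction h ^ (k + 1)) x =
      V.contraction h ((V.contraction h ^ k) x) := fun k x => by
    rw [pow_succ', Module.End.mul_apply]
  have hle : ∀ k ≤ m, ∀ x, (V.contraction h ^ k) x ∈ V.omegaFiltration (m - k) := by
    intro k hk x
    induction k with
    | zero =>
      rw [DGLieModule.omegaFiltration, Nat.sub_zero, hm, TensorProduct.map₂_mk_top_top_eq_top]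
      exact Submodule.mem_top
    | succ k ih =>
      rw [hpow]
      refine r.contraction_mem_omegaFiltration hh h1 h0 ?_
      rw [show m - (k + 1) + 1 = m - k by omega]
      exact ih (by omega)
  refine ⟨V.contraction h ^ m, fun n x hx => ?_, fun x => ?_, fun x => ?_, fun x => ?_⟩
  · generalize m = k
    induction k with
    | zero => exact hx
    | succ k ih => rw [hpow]; exact V.contraction_mem hh ih
  · generalize m = k
    induction k with
    | zero => rfl
    | succ k ih => rw [hpow, hpow, ih, V.contraction_dtot]
  · have hx := hle m le_rfl x
    rw [Nat.sub_self] at hx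
    have : V.omegaFiltration 0 ≤ ((r.incl.baseChange (CE K g)).range).restrictScalars K :=
      Submodule.map₂_le.2 fun ω _ v hv => by
        obtain ⟨z, rfl⟩ := r.exists_incl_eq hv
        exact ⟨ω ⊗ₜ z, rfl⟩
    exact this hx
  · generalize m = k
    induction k with
    | zero => rfl
    | succ k ih => rw [hpow, ih, r.contraction_baseChange_incl hh]

/-- The lift is `X ∘ π ∘ P`. The retraction `π` is merely linear, but on the image of `P` it inverts
the inclusion of `Ω_g(G)`, which is a chain map, so the composite `π ∘ P` is one too. -/
theorem exists_isDGLift [CharZero K] (r : Resolution V G) (X : G →ₗ⁅K,g⁆ g) :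
    ∃ α : WeakMorphism V (DGLieModule.ofModule K g g), IsDGLift r X α := by
  obtain ⟨P, hP, hPd, hPr, hPi⟩ := r.exists_projection
  obtain ⟨π, hπ, hπ0⟩ := r.exists_retraction
  have hπi : ∀ x, π.baseChange (CE K g) (r.incl.baseChange (CE K g) x) = x := by
    intro x
    rw [← LinearMap.comp_apply, ← LinearMap.baseChange_comp,
      show π ∘ₗ r.incl = LinearMap.id from LinearMap.ext hπ, LinearMap.baseChange_id,
      LinearMap.id_apply]
  refine ⟨⟨(anchor X).map ∘ₗ π.baseChange (CE K g) ∘ₗ P, fun n x hx => ?_, fun x => ?_⟩,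
    fun x => ?_⟩
  · refine (anchor X).map_mem n _ ?_
    refine V.map_mem_of_tmul ((π.baseChange (CE K g)).restrictScalars K)
      (fun p q e ω hω v hv => ?_) (hP n x hx)
    refine DGLieModule.tmul_mem_omegaGr _ hω (q := q) ?_ e
    by_cases hq : q = 0
    · subst hq; trivial
    · rw [hπ0 q hq v hv]; exact zero_mem _
  · obtain ⟨z, hz⟩ := hPr x
    rw [LinearMap.comp_apply, LinearMap.comp_apply, hPd, ← hz, r.dtot_baseChange_incl, hπi,
      LinearMap.comp_apply, LinearMap.comp_apply, ← hz, hπi, ← (anchor X).map_dtot,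
      DGLieModule.ofModule_dtot]
  · have := hPi (1 ⊗ₜ x)
    rw [LinearMap.baseChange_tmul] at this
    change (anchor X).map (π.baseChange (CE K g) (P (1 ⊗ₜ r.incl x))) = _
    rw [this, LinearMap.baseChange_tmul, hπ, anchor_tmul]

end Resolution

end Lift

/-! ### Restriction of the brackets to `Ω_g(G[1])` -/

section Extension

variable {K g G M : Type*} [Field K] [CharZero K] [LieRing g] [LieAlgebra K g]
  [FiniteDimensional K g]
  [AddCommGroup G] [Module K G] [LieRingModule g G] [LieModule K g G]
  [AddCommGroup M] [Module K M] [LieRingModule g M] [LieModule K g M]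

theorem IsDGLift.map_baseChange_incl {V : DGLieModule K g M} {r : Resolution V G}
    {X : G →ₗ⁅K,g⁆ g} {α : WeakMorphism V (DGLieModule.ofModule K g g)} (hα : IsDGLift r X α)
    (x : CE K g ⊗[K] G) : α.map (r.incl.baseChange (CE K g) x) = (anchor X).map x := by
  induction x using TensorProduct.induction_on with
  | zero => simp
  | tmul ω x =>
    rw [LinearMap.baseChange_tmul, tmul_eq_smul, map_smul, hα, anchor_tmul, ← tmul_eq_smul]
  | add x y hx hy => rw [map_add, map_add, hx, hy, map_add]

theorem IsDGLift.nabla_baseChange_incl {V : DGLieModule K g M} {r : Resolution V G}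
    {X : G →ₗ⁅K,g⁆ g} {α : WeakMorphism V (DGLieModule.ofModule K g g)} (hα : IsDGLift r X α)
    (b e : CE K g ⊗[K] G) :
    nabla α.map (r.incl.baseChange (CE K g) b) (r.incl.baseChange (CE K g) e) =
      r.incl.baseChange (CE K g) (nabla (anchor X).map b e) := by
  induction e using TensorProduct.induction_on with
  | zero => simp
  | tmul ω x =>
    rw [LinearMap.baseChange_tmul, nabla_tmul, nabla_tmul, hα.map_baseChange_incl,
      LinearMap.baseChange_tmul]
  | add x y hx hy => rw [map_add, map_add, hx, hy, map_add, map_add]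

theorem IsDGLift.extends {V : DGLieModule K g M} {r : Resolution V G}
    {X : G →ₗ⁅K,g⁆ g} {α : WeakMorphism V (DGLieModule.ofModule K g g)} (hα : IsDGLift r X α)
    {R : Brackets K (CE K g ⊗[K] M)}
    (hR : IsKapranov V.shift.omegaGr V.shift.dtot (nabla α.map) R) :
    Extends (DGLieModule.ofModule K g G).shift.omegaGr (lpBrackets X)
      V.shift.omegaGr R (r.incl.baseChange (CE K g)) := by
  have hdeg : ∀ n, ∀ x ∈ (DGLieModule.ofModule K g G).shift.omegaGr n,
      r.incl.baseChange (CE K g) x ∈ V.shift.omegaGr n := by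
    intro n x hx
    refine DGLieModule.map_mem_of_tmul _ ((r.incl.baseChange (CE K g)).restrictScalars K)
      (fun p q e ω hω v hv => ?_) hx
    refine V.shift.tmul_mem_omegaGr hω (q := q) ?_ e
    obtain rfl | rfl := mem_shift_ofModule_gr hv
    · exact (r.incl_mem v).1
    · rw [map_zero]; exact zero_mem _
  refine ⟨?_, hdeg, fun k hk v => ?_⟩
  -- Tensoring over a field is exact.
  · exact Module.Flat.lTensor_preserves_injective_linearMap r.incl r.incl_injective
  · refine hR.map_apply (isKapranov_lpBrackets X)
      (DGLieModule.ofModule K g G).shift.isInternal_omegaGr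
      ((r.incl.baseChange (CE K g)).restrictScalars K) hdeg (fun x => ?_)
      hα.nabla_baseChange_incl (isConnection_nabla (anchor X)).mem hk v
    exact (r.dtot_baseChange_incl x).trans
      (congrArg (r.incl.baseChange (CE K g)) (DGLieModule.ofModule_dtot x).symm)

end Extension

end DGLP

end

theorem mainTheorem10 {K g G M : Type*} [Field K] [CharZero K]
    [LieRing g] [LieAlgebra K g] [FiniteDimensional K g]
    [AddCommGroup G] [Module K G] [LieRingModule g G] [LieModule K g G]
    [AddCommGroup M] [Module K M] [LieRingModule g M] [LieModule K g M]
    (V : DGLieModule K g M) (r : Resolution V G) (X : G →ₗ⁅K,g⁆ g) :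
    IsDGLeibnizOver (ceGr K g) (ceDiff K g)
      (DGLieModule.ofModule K g G).shift.omegaGr (lpBrackets X) ∧
    ∃ α : WeakMorphism V (DGLieModule.ofModule K g g), IsDGLift r X α ∧
      ∃ R : Brackets K (TensorProduct K (CE K g) M),
        IsKapranov V.shift.omegaGr V.shift.dtot (nabla α.map) R ∧
        IsLeibnizInfinityOver (ceGr K g) (ceDiff K g) V.shift.omegaGr R ∧
        Extends (DGLieModule.ofModule K g G).shift.omegaGr (lpBrackets X)
          V.shift.omegaGr R (r.incl.baseChange (CE K g)) := by
  obtain ⟨α, hα⟩ := r.exists_isDGLift X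
  have hR := isKapranov_kapranov V.shift.isInternal_omegaGr V.shift.dtot (nabla α.map)
  exact ⟨isDGLeibnizOver_lpBrackets X, α, hα, _, hR,
    hR.isLeibnizInfinityOver V.shift.isDGModule (isConnection_nabla α) isDGAlgebra_ce,
    hα.extends hR⟩
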